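/- An instance of \textsc{EF-GC} (envy-free graph cutting) consists of a finite set $A$ of agents, a finite connected simple graph $G=(V,E)$ and, for each $a\in A$, a utility function $u_a:E\to\mathbb{Q}_{\ge 0}$ with $\sum_{e\in E}u_a(e)>0$ (for example normalized utilities, where this sum is $1$). Fix a linear order on $V$ and identify every edge $e=uv$ with $u<v$ with a copy of $[0,1]$, where $u$ corresponds to $0$ and $v$ to $1$. An edge piece is a pair $(e,I)$ with $e\in E$ and $I\subseteq[0,1]$ a (possibly empty; open, closed or half-open) interval of length $|I|$. Pieces of two different edges are adjacent if both contain a common endpoint of these edges. A piece of $G$ is a finite set $P$ of edge pieces any two of which are joined by a sequence of edge pieces in $P$ with consecutive ones adjacent; its utility for $a$ is $u_a(P)=\sum_{(e,I)\in P}|I|\,u_a(e)$. A partition of $G$ into pieces is a set $\Pi$ of pieces such that for every $e\in E$ and every real $\alpha\in[0,1]$ there are exactly one $P\in\Pi$ and exactly one $(e,I)\in P$ with $\alpha\in I$. A solution is a partition $\Pi$ together with a bijection $\pi:A\to\Pi$ such that $u_a(\pi(a))\ge u_a(\pi(a'))$ for all $a,a'\in A$. To solve the instance means to output a solution, all of whose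 intervals have rational endpoints, or to report correctly that no solution exists. **Theorem.** For all $c,d\in\mathbb{N}$ there is a deterministic algorithm that solves every instance of \textsc{EF-GC} with $|A|\le c$ in which $G$ is a tree of maximum degree at most $d$, in time polynomial in the encoding length of the instance (all numbers being written in binary). -/

import Mathlib

namespace EFGC

/-! ### A machine model with a logarithmic (bit-level) time count

Programs transform a single piece of data, a binary tree whose leaves carry integers. Every
elementary operation is charged the full bit size of the data it reads and of the data it writes, so
arithmetic on long numbers and the copying of large trees are never free. Up to polynomial factors
the running time is the one of a multi-tape Turing machine. -/

/-- Binary trees with integers at the leaves. -/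
inductive Data : Type
  | num : ℤ → Data
  | node : Data → Data → Data

/-- The encoding length of a tree, integers being written in binary with a sign. -/
def Data.size : Data → ℕ
  | .num z => Nat.size z.natAbs + 1
  | .node x y => x.size + y.size + 1

/-- Elementary operations. Binary ones act on a tree with two leaves. -/
inductive Prim : Type
  | const : Data → Prim
  | copy : Prim
  | left : Prim
  | right : Prim
  | isNode : Prim
  | add : Prim
  | sub : Prim
  | mul : Prim
  | le : Prim

/-- The effect of an elementary operation (with value `0` on data of the wrong shape). -/
def Prim.eval : Prim → Data → Data
  | .const v, _ => v
  | .copy, x => x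
  | .left, .node x _ => x
  | .right, .node _ y => y
  | .isNode, .node _ _ => .num 1
  | .add, .node (.num a) (.num b) => .num (a + b)
  | .sub, .node (.num a) (.num b) => .num (a - b)
  | .mul, .node (.num a) (.num b) => .num (a * b)
  | .le, .node (.num a) (.num b) => .num (if a ≤ b then 1 else 0)
  | _, _ => .num 0

/-- Programs: elementary operations, forming a pair of two results, sequential composition
(`seq p q` runs `p` first), branching and while loops. -/
inductive Program : Type
  | prim : Prim → Program
  | pair : Program → Program → Program
  | seq : Program → Program → Program
  | ite : Program → Program → Program → Program
  | loop : Program → Program → Program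

/-- `Runs p x y t`: started on `x`, the program `p` halts with result `y` after time `t`.
A test counts as failed iff its result is the number `0`. -/
inductive Runs : Program → Data → Data → ℕ → Prop
  | prim (o : Prim) (x : Data) :
      Runs (.prim o) x (o.eval x) (x.size + (o.eval x).size)
  | pair {p q : Program} {x y z : Data} {s t : ℕ} :
      Runs p x y s → Runs q x z t → Runs (.pair p q) x (.node y z) (s + t + 1)
  | seq {p q : Program} {x y z : Data} {s t : ℕ} :
      Runs p x y s → Runs q y z t → Runs (.seq p q) x z (s + t + 1)
  | ite_true {b p q : Program} {x v y : Data} {s t : ℕ} :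
      Runs b x v s → v ≠ .num 0 → Runs p x y t → Runs (.ite b p q) x y (s + t + 1)
  | ite_false {b p q : Program} {x y : Data} {s t : ℕ} :
      Runs b x (.num 0) s → Runs q x y t → Runs (.ite b p q) x y (s + t + 1)
  | loop_true {b p : Program} {x v y z : Data} {r s t : ℕ} :
      Runs b x v r → v ≠ .num 0 → Runs p x y s → Runs (.loop b p) y z t →
        Runs (.loop b p) x z (r + s + t + 1)
  | loop_false {b p : Program} {x : Data} {s : ℕ} :
      Runs b x (.num 0) s → Runs (.loop b p) x x (s + 1)

/-- Programs are deterministic: the result and the running time are determined by the input. -/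
theorem Runs.unique {p : Program} {x y y' : Data} {t t' : ℕ}
    (h : Runs p x y t) (h' : Runs p x y' t') : y = y' ∧ t = t' := by
  induction h generalizing y' t' with
  | prim o x => cases h'; exact ⟨rfl, rfl⟩
  | pair _ _ ih₁ ih₂ =>
    cases h' with
    | pair k₁ k₂ =>
      obtain ⟨rfl, rfl⟩ := ih₁ k₁
      obtain ⟨rfl, rfl⟩ := ih₂ k₂
      exact ⟨rfl, rfl⟩
  | seq _ _ ih₁ ih₂ =>
    cases h' with
    | seq k₁ k₂ =>
      obtain ⟨rfl, rfl⟩ := ih₁ k₁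
      obtain ⟨rfl, rfl⟩ := ih₂ k₂
      exact ⟨rfl, rfl⟩
  | ite_true _ hv _ ih₁ ih₂ =>
    cases h' with
    | ite_true k₁ _ k₂ =>
      obtain ⟨rfl, rfl⟩ := ih₁ k₁
      obtain ⟨rfl, rfl⟩ := ih₂ k₂
      exact ⟨rfl, rfl⟩
    | ite_false k₁ _ => exact absurd (ih₁ k₁).1 hv
  | ite_false _ _ ih₁ ih₂ =>
    cases h' with
    | ite_true k₁ hv _ => exact absurd (ih₁ k₁).1.symm hv
    | ite_false k₁ k₂ =>
      obtain ⟨-, rfl⟩ := ih₁ k₁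
      obtain ⟨rfl, rfl⟩ := ih₂ k₂
      exact ⟨rfl, rfl⟩
  | loop_true _ hv _ _ ih₁ ih₂ ih₃ =>
    cases h' with
    | loop_true k₁ _ k₂ k₃ =>
      obtain ⟨rfl, rfl⟩ := ih₁ k₁
      obtain ⟨rfl, rfl⟩ := ih₂ k₂
      obtain ⟨rfl, rfl⟩ := ih₃ k₃
      exact ⟨rfl, rfl⟩
    | loop_false k₁ => exact absurd (ih₁ k₁).1 hv
  | loop_false _ ih₁ =>
    cases h' with
    | loop_true k₁ hv _ _ => exact absurd (ih₁ k₁).1.symm hv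
    | loop_false k₁ =>
      obtain ⟨-, rfl⟩ := ih₁ k₁
      exact ⟨rfl, rfl⟩

/-- Lists as data: the empty list is the number `0`, a nonempty one is a node. -/
def listData : List Data → Data
  | [] => .num 0
  | x :: l => .node x (listData l)

/-! ### The problem -/

/-- Agents, a simple graph with ordered vertices, and a nonnegative rational utility of every agent
for every edge. Edge `e` is given by its endpoints, the smaller one first. -/
structure Instance : Type where
  vertices : ℕ
  edges : ℕ
  agents : ℕ
  ends : Fin edges → Fin vertices × Fin vertices
  ends_lt : ∀ e, (ends e).1 < (ends e).2
  ends_injective : Function.Injective ends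
  utility : Fin agents → Fin edges → ℚ
  utility_nonneg : ∀ a e, 0 ≤ utility a e

namespace Instance

/-- The underlying simple graph. -/
def graph (I : Instance) : SimpleGraph (Fin I.vertices) where
  Adj u v := ∃ e, I.ends e = (u, v) ∨ I.ends e = (v, u)
  symm := ⟨fun _ _ ⟨e, h⟩ => ⟨e, h.symm⟩⟩
  loopless := ⟨fun v ⟨e, h⟩ => by
    have h₁ := I.ends_lt e
    rcases h with h | h <;> simp [h] at h₁⟩

instance (I : Instance) : DecidableRel I.graph.Adj := fun u v =>
  inferInstanceAs (Decidable (∃ e, I.ends e = (u, v) ∨ I.ends e = (v, u)))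

/-- A pair `(e, J)` of an edge and a part `J` of the unit interval. The point `0` of the unit interval
is the smaller endpoint of `e` and the point `1` is the larger one. -/
abbrev EdgePiece (I : Instance) : Type := Fin I.edges × Set ℝ

variable (I : Instance)

/-- The edge piece contains the vertex `v`. -/
def ContainsVertex (p : I.EdgePiece) (v : Fin I.vertices) : Prop :=
  ((I.ends p.1).1 = v ∧ (0 : ℝ) ∈ p.2) ∨ ((I.ends p.1).2 = v ∧ (1 : ℝ) ∈ p.2)

/-- Pieces of two different edges are adjacent if they share a vertex. -/
def AdjacentPieces (p q : I.EdgePiece) : Prop :=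
  p.1 ≠ q.1 ∧ ∃ v, I.ContainsVertex p v ∧ I.ContainsVertex q v

/-- A piece of the graph: a connected collection of intervals (closed, open, half-open or empty)
on edges. -/
def IsPiece (P : Finset I.EdgePiece) : Prop :=
  (∀ p ∈ P, p.2 ⊆ Set.Icc 0 1 ∧ p.2.OrdConnected) ∧
  ∀ p ∈ P, ∀ q ∈ P,
    Relation.ReflTransGen (fun x y => x ∈ P ∧ y ∈ P ∧ I.AdjacentPieces x y) p q

/-- A partition of the graph into pieces: every point of every edge lies in exactly one edge piece
of exactly one piece. -/
def IsPartition (S : Set (Finset I.EdgePiece)) : Prop :=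
  (∀ P ∈ S, I.IsPiece P) ∧
  ∀ e : Fin I.edges, ∀ α ∈ Set.Icc (0 : ℝ) 1,
    ∃! x : Finset I.EdgePiece × Set ℝ, x.1 ∈ S ∧ (e, x.2) ∈ x.1 ∧ α ∈ x.2

/-- The utility of agent `a` for a piece; `volume.real` is the length of an interval. -/
noncomputable def pieceUtility (a : Fin I.agents) (P : Finset I.EdgePiece) : ℝ :=
  ∑ p ∈ P, MeasureTheory.volume.real p.2 * (I.utility a p.1 : ℝ)

/-- `π` is a bijection from the agents to a partition into pieces, and no agent envies another. -/
def IsEnvyFree (π : Fin I.agents → Finset I.EdgePiece) : Prop :=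
  I.IsPartition (Set.range π) ∧ Function.Injective π ∧
  ∀ a b, I.pieceUtility a (π b) ≤ I.pieceUtility a (π a)

/-- The input presented to a program: the number of vertices, the list of edges, and for every agent
the list of its utilities, as reduced fractions. -/
def encode : Data :=
  .node (.num I.vertices)
    (.node
      (listData (List.ofFn fun e => .node (.num ((I.ends e).1 : ℕ)) (.num ((I.ends e).2 : ℕ))))
      (listData (List.ofFn fun a => listData (List.ofFn fun e =>
        .node (.num (I.utility a e).num) (.num (I.utility a e).den)))))

end Instance

/-- A fraction, not necessarily reduced. -/
structure Fraction : Type where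
  num : ℤ
  den : ℕ
  den_pos : 0 < den

/-- The rational number denoted by a fraction. -/
def Fraction.value (q : Fraction) : ℚ := q.num / q.den

/-- A fraction as data. -/
def Fraction.encode (q : Fraction) : Data := .node (.num q.num) (.num q.den)

/-- A finite description of an interval with rational endpoints; the two Booleans tell whether
the left and the right endpoint belong to it. -/
structure RatInterval : Type where
  lo : Fraction
  hi : Fraction
  loClosed : Bool
  hiClosed : Bool

/-- The real interval that is described. -/
def RatInterval.toSet (J : RatInterval) : Set ℝ :=
  {x | ((J.lo.value : ℝ) < x ∨ (J.loClosed = true ∧ x = (J.lo.value : ℝ))) ∧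
    (x < (J.hi.value : ℝ) ∨ (J.hiClosed = true ∧ x = (J.hi.value : ℝ)))}

/-- A truth value as data. -/
def boolData (b : Bool) : Data := .num (if b then 1 else 0)

/-- The description of an interval as data. -/
def RatInterval.encode (J : RatInterval) : Data :=
  .node (.node J.lo.encode J.hi.encode) (.node (boolData J.loClosed) (boolData J.hiClosed))

namespace Instance

variable (I : Instance)

/-- A finite description of an assignment: for every agent a list of edges with intervals. -/
abbrev Description : Type := Fin I.agents → List (Fin I.edges × RatInterval)

open Classical in
/-- The assignment that is described. -/
noncomputable def Description.toAssignment {I : Instance} (D : I.Description) :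
    Fin I.agents → Finset I.EdgePiece :=
  fun a => ((D a).map fun p => (p.1, p.2.toSet)).toFinset

/-- The description of an assignment as data. -/
def Description.encode {I : Instance} (D : I.Description) : Data :=
  listData (List.ofFn fun a =>
    listData ((D a).map fun p => .node (.num (p.1 : ℕ)) p.2.encode))

/-- `y` is a correct answer to the instance: either `y` is the number `0` and there is no envy-free
assignment at all, or `y` is `1` together with a description of an envy-free assignment. -/
def IsCorrectAnswer (y : Data) : Prop :=
  (y = .num 0 ∧ ¬ ∃ π, I.IsEnvyFree π) ∨
  ∃ D : I.Description, y = .node (.num 1) D.encode ∧ I.IsEnvyFree D.toAssignment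

end Instance

/-- Envy-free graph cutting, restricted to the instances in `C`, is solvable in polynomial time:
one program solves all these instances in time polynomial in the encoding length. -/
def PolyTimeSolvableOn (C : Set Instance) : Prop :=
  ∃ (p : Program) (T : Polynomial ℕ), ∀ I ∈ C, ∃ (y : Data) (t : ℕ),
    Runs p I.encode y t ∧ t ≤ T.eval I.encode.size ∧ I.IsCorrectAnswer y

end EFGC

/-!
The tree is grown from a root edge by edge, every edge being directed away from the root. An
assignment is described combinatorially by a *labelled tree*: each arc carries the list of the
agents that share it, from its tail to its head. In an envy-free assignment every agent has a
connected share, and connectedness survives both the removal of degenerate intervals and the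
restriction to a growing subtree, because what is removed meets the rest in a single vertex
(`Joined.of_gate`). Hence an agent with shares in earlier arcs can only be the first one on a new
arc, and only if it owns the end of an earlier arc at the tail of the new one (`exists_labelled`).
This is the condition `admissible`, and conversely it keeps all shares connected
(`connected_shares`).

Two consequences make the problem tractable. First, every agent is at a position after the first
one for at most one arc. So the lengths of all shares are linear in at most `c` unknowns, and
envy-freeness becomes a system of linear inequalities in these; each of its solutions gives an
envy-free assignment (`isEnvyFree_of_sat`), and the lengths in an envy-free assignment form a
solution (`sat_unknowns`). Fourier–Motzkin elimination with a constant number of unknowns is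
polynomial, and it finds a rational solution if there is a real one (`exists_solve`); positivity
of the lengths is a strict inequality. Secondly, an arc that is not just handed over to the agent
arriving at its tail leaves a vertex where some agent has its first share, so in a tree of maximum
degree `d` there are at most `c * d` such arcs (`length_deviations_le`). All admissible
labellings can therefore be found by trying polynomially many lists of at most `c * d`
prescriptions, which is what `solveInstance` does (`isCorrectAnswer_solveInstance`).

For the running time, the functions computed by programs in polynomial time are shown to be closed
under composition, pairing, case distinctions and folds over lists with bounded growth of the
state (`PolyTime.foldl_of_le`). The algorithm is put together from such operations
(`PolyTime.solveInstance`).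
-/

namespace EFGC

/-! ### Polynomial-time functions between encoded types -/

/-- Types whose elements are presented to programs as data. -/
class Code (α : Type) where
  /-- The presentation of an element as data. -/
  enc : α → Data

open Code (enc)

instance : Code ℕ := ⟨fun n => .num n⟩
instance : Code ℤ := ⟨.num⟩
instance : Code Bool := ⟨boolData⟩
instance {α β : Type} [Code α] [Code β] : Code (α × β) := ⟨fun p => .node (enc p.1) (enc p.2)⟩
instance {α : Type} [Code α] : Code (List α) := ⟨fun l => listData (l.map enc)⟩
instance {α : Type} [Code α] : Code (Option α) :=
  ⟨fun o => o.elim (.num 0) fun a => .node (.num 1) (enc a)⟩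

/-- The encoding length of an element of an encoded type. -/
abbrev len {α : Type} [Code α] (a : α) : ℕ := (enc a).size

/-- Functions computed by a program in time polynomial in the encoding length of the argument. -/
def PolyTime {α β : Type} [Code α] [Code β] (f : α → β) : Prop :=
  ∃ (p : Program) (T : Polynomial ℕ), ∀ x, ∃ t, Runs p (enc x) (enc (f x)) t ∧ t ≤ T.eval (len x)

theorem Runs.size_le {p : Program} {x y : Data} {t : ℕ} (h : Runs p x y t) :
    x.size ≤ t ∧ y.size ≤ t := by
  induction h with
  | prim o x => omega
  | pair _ _ ih₁ ih₂ => simp only [Data.size]; omega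
  | seq _ _ ih₁ ih₂ => omega
  | ite_true _ _ _ ih₁ ih₂ => omega
  | ite_false _ _ ih₁ ih₂ => omega
  | loop_true _ _ _ _ ih₁ ih₂ ih₃ => omega
  | loop_false _ ih₁ => omega

theorem eval_mono (T : Polynomial ℕ) {m n : ℕ} (h : m ≤ n) : T.eval m ≤ T.eval n := by
  rw [Polynomial.eval_eq_sum, Polynomial.eval_eq_sum, Polynomial.sum, Polynomial.sum]
  gcongr

section
variable {α β γ δ σ : Type} [Code α] [Code β] [Code γ] [Code δ] [Code σ]

theorem len_prod (a : α) (b : β) : len (a, b) = len a + len b + 1 := rfl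

theorem len_nil : len ([] : List α) = 1 := rfl

theorem len_cons (a : α) (l : List α) : len (a :: l) = len a + len l + 1 := rfl

theorem len_some (a : α) : len (some a) = len a + 3 := by
  change 2 + len a + 1 = _
  omega

theorem len_none : len (none : Option α) = 1 := rfl

theorem len_mem_le {a : α} {l : List α} (h : a ∈ l) : len a ≤ len l := by
  induction l with
  | nil => simp at h
  | cons b l ih =>
    rw [len_cons]
    rcases List.mem_cons.1 h with rfl | h
    · omega
    · have := ih h; omega

theorem length_le_len (l : List α) : l.length ≤ len l := by
  induction l with
  | nil => simp
  | cons b l ih => rw [len_cons, List.length_cons]; omega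

theorem len_append (l₁ l₂ : List α) : len (l₁ ++ l₂) ≤ len l₁ + len l₂ := by
  induction l₁ with
  | nil => simp
  | cons b l ih => rw [List.cons_append, len_cons, len_cons]; omega

theorem len_bool (b : Bool) : len b ≤ 2 := by cases b <;> decide

namespace PolyTime

/-- Outputs of a polynomial-time function have polynomial encoding length. -/
theorem exists_len_le {f : α → β} (hf : PolyTime f) :
    ∃ T : Polynomial ℕ, ∀ x, len (f x) ≤ T.eval (len x) := by
  obtain ⟨p, T, h⟩ := hf
  refine ⟨T, fun x => ?_⟩
  obtain ⟨t, ht, hT⟩ := h x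
  exact ht.size_le.2.trans hT

theorem of_prim {f : α → β} (o : Prim) (h : ∀ x, o.eval (enc x) = enc (f x)) (T : Polynomial ℕ)
    (hT : ∀ x, len (f x) ≤ T.eval (len x)) : PolyTime f := by
  refine ⟨.prim o, .X + T, fun x => ⟨_, h x ▸ Runs.prim o (enc x), ?_⟩⟩
  rw [Polynomial.eval_add, Polynomial.eval_X]
  exact Nat.add_le_add_left (hT x) _

protected theorem id : PolyTime (fun x : α => x) :=
  of_prim .copy (fun _ => rfl) .X fun x => by simp

theorem const (b : β) : PolyTime (fun _ : α => b) :=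
  of_prim (.const (enc b)) (fun _ => rfl) (.C (len b)) fun x => by simp

theorem comp {g : β → γ} {f : α → β} (hg : PolyTime g) (hf : PolyTime f) :
    PolyTime (fun x => g (f x)) := by
  obtain ⟨p, S, hp⟩ := hf
  obtain ⟨q, T, hq⟩ := hg
  refine ⟨.seq p q, S + T.comp S + 1, fun x => ?_⟩
  obtain ⟨s, hs, hs'⟩ := hp x
  obtain ⟨t, ht, ht'⟩ := hq (f x)
  refine ⟨_, .seq hs ht, ?_⟩
  have := eval_mono T (hs.size_le.2.trans hs')
  simp only [Polynomial.eval_add, Polynomial.eval_comp, Polynomial.eval_one, len] at *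
  omega

theorem pair {f : α → β} {g : α → γ} (hf : PolyTime f) (hg : PolyTime g) :
    PolyTime (fun x => (f x, g x)) := by
  obtain ⟨p, S, hp⟩ := hf
  obtain ⟨q, T, hq⟩ := hg
  refine ⟨.pair p q, S + T + 1, fun x => ?_⟩
  obtain ⟨s, hs, hs'⟩ := hp x
  obtain ⟨t, ht, ht'⟩ := hq x
  refine ⟨_, .pair hs ht, ?_⟩
  simp only [Polynomial.eval_add, Polynomial.eval_one]
  omega

theorem fst {f : α → β × γ} (hf : PolyTime f) : PolyTime (fun x => (f x).1) :=
  comp (of_prim (f := fun p : β × γ => p.1) .left (fun _ => rfl) .X fun x => by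
    simp only [Polynomial.eval_X]
    have := len_prod x.1 x.2
    simp only [Prod.mk.eta] at this
    omega) hf

theorem snd {f : α → β × γ} (hf : PolyTime f) : PolyTime (fun x => (f x).2) :=
  comp (of_prim (f := fun p : β × γ => p.2) .right (fun _ => rfl) .X fun x => by
    simp only [Polynomial.eval_X]
    have := len_prod x.1 x.2
    simp only [Prod.mk.eta] at this
    omega) hf

/-- Binary functions may be applied to polynomial-time arguments. -/
theorem comp₂ {g : β → γ → δ} {f₁ : α → β} {f₂ : α → γ}
    (hg : PolyTime (fun p : β × γ => g p.1 p.2)) (h₁ : PolyTime f₁) (h₂ : PolyTime f₂) :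
    PolyTime (fun x => g (f₁ x) (f₂ x)) :=
  comp (g := fun p : β × γ => g p.1 p.2) hg (pair h₁ h₂)

theorem cond {b : α → Bool} {f g : α → β} (hb : PolyTime b) (hf : PolyTime f) (hg : PolyTime g) :
    PolyTime (fun x => bif b x then f x else g x) := by
  obtain ⟨r, R, hr⟩ := hb
  obtain ⟨p, S, hp⟩ := hf
  obtain ⟨q, T, hq⟩ := hg
  refine ⟨.ite r p q, R + S + T + 1, fun x => ?_⟩
  obtain ⟨u, hu, hu'⟩ := hr x
  obtain ⟨s, hs, hs'⟩ := hp x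
  obtain ⟨t, ht, ht'⟩ := hq x
  simp only [Polynomial.eval_add, Polynomial.eval_one]
  cases h : b x with
  | true =>
    rw [h] at hu
    exact ⟨_, .ite_true hu (by simp [enc, boolData]) hs, by omega⟩
  | false =>
    rw [h] at hu
    exact ⟨_, .ite_false hu ht, by omega⟩

/-- Case distinction on an optional value. -/
theorem elim {o : α → Option β} {f : α → γ} {g : α → β → γ} (ho : PolyTime o) (hf : PolyTime f)
    (hg : PolyTime (fun p : α × β => g p.1 p.2)) :
    PolyTime (fun x => (o x).elim (f x) (g x)) := by
  obtain ⟨r, R, hr⟩ := ho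
  obtain ⟨p, S, hp⟩ := hf
  obtain ⟨q, T, hq⟩ := hg
  -- The program `r` is run twice, for the test and for the value.
  refine ⟨.ite (.seq r (.prim .isNode)) (.seq (.pair (.prim .copy) (.seq r (.prim .right))) q) p,
    8 * R + S + T.comp (.X + R + 1) + 2 * .X + 20, fun x => ?_⟩
  obtain ⟨u, hu, hu'⟩ := hr x
  obtain ⟨s, hs, hs'⟩ := hp x
  have hout := hu.size_le.2
  simp only [Polynomial.eval_add, Polynomial.eval_mul, Polynomial.eval_one, Polynomial.eval_comp,
    Polynomial.eval_X, Polynomial.eval_ofNat]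
  cases h : o x with
  | none =>
    rw [h] at hu hout
    refine ⟨_, .ite_false (.seq hu (.prim .isNode _)) hs, ?_⟩
    have h1 : (enc (none : Option β)).size = 1 := rfl
    have h2 : (Prim.eval .isNode (enc (none : Option β))).size = 1 := rfl
    rw [h1, h2]
    omega
  | some b =>
    rw [h] at hu hout
    obtain ⟨t, ht, ht'⟩ := hq (x, b)
    refine ⟨_, .ite_true (.seq hu (.prim .isNode _)) (by simp [enc, Prim.eval])
      (.seq (.pair (.prim .copy _) (.seq hu (.prim .right _))) ht), ?_⟩
    have h1 : (enc (some b)).size = len b + 3 := len_some b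
    have h2 : (Prim.eval .isNode (enc (some b))).size = 2 := rfl
    have h3 : (Prim.eval .right (enc (some b))).size = len b := rfl
    have h4 : (Prim.eval .copy (enc x)).size = len x := rfl
    rw [h1, h2, h3, h4]
    rw [h1] at hout
    have h5 : len (x, b) ≤ len x + R.eval (len x) + 1 := by rw [len_prod]; omega
    have h6 := eval_mono T h5
    simp only [len] at *
    omega

/-! #### Folding over lists -/

/-- Folding is polynomial-time as soon as all intermediate states have polynomial size. -/
theorem foldl_of_le {g : γ → σ → α → σ} {init : γ → σ} {l : γ → List α}
    (hg : PolyTime (fun p : (γ × σ) × α => g p.1.1 p.1.2 p.2))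
    (hi : PolyTime init) (hl : PolyTime l) (B : Polynomial ℕ)
    (hB : ∀ c l₁, l₁ <+: l c → len (l₁.foldl (g c) (init c)) ≤ B.eval (len c)) :
    PolyTime (fun c => (l c).foldl (g c) (init c)) := by
  obtain ⟨p, P, hp⟩ := hi
  obtain ⟨r, R, hr⟩ := hl
  obtain ⟨q, Q, hq⟩ := hg
  -- The loop works on the triple of the parameter, the current state and the rest of the list.
  let l₁ := Program.prim .left
  let r₁ := Program.prim .right
  let body : Program := .pair l₁ (.pair
    (.seq (.pair (.pair l₁ (.seq r₁ l₁)) (.seq r₁ (.seq r₁ l₁))) q) (.seq r₁ (.seq r₁ r₁)))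
  let test : Program := .seq r₁ (.seq r₁ (.prim .isNode))
  have htest : ∀ (c : γ) (s : σ) (l : List α), ∃ t, Runs test (.node (enc c) (.node (enc s) (enc l)))
      (.num (if l = [] then 0 else 1)) t ∧ t ≤ 10 * (len c + len s + len l + 2) := by
    intro c s l
    cases l with
    | nil =>
      refine ⟨_, .seq (.prim .right _) (.seq (.prim .right _) (.prim .isNode _)), ?_⟩
      have h1 : (enc ([] : List α)).size = 1 := rfl
      have h2 : (Prim.eval .isNode (enc ([] : List α))).size = 1 := rfl
      simp only [Prim.eval, Data.size, len] at *
      omega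
    | cons a l =>
      refine ⟨_, .seq (.prim .right _) (.seq (.prim .right _) (.prim .isNode _)), ?_⟩
      have h1 : (enc (a :: l)).size = len (a :: l) := rfl
      have h2 : (Prim.eval .isNode (enc (a :: l))).size = 2 := rfl
      have h3 := len_cons a l
      simp only [Prim.eval, Data.size, len] at *
      omega
  have hbody : ∀ c S s a (l : List α), len s ≤ S → ∃ t,
      Runs body (.node (enc c) (.node (enc s) (enc (a :: l))))
        (.node (enc c) (.node (enc (g c s a)) (enc l))) t ∧
        t ≤ (Q.eval (len c + S + len (a :: l) + 2) + 30 * (len c + S + len (a :: l) + 2)) := by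
    intro c S s a l hs
    obtain ⟨t, ht, ht'⟩ := hq ((c, s), a)
    refine ⟨_, .pair (.prim .left _) (.pair (.seq (.pair (.pair (.prim .left _)
      (.seq (.prim .right _) (.prim .left _)))
      (.seq (.prim .right _) (.seq (.prim .right _) (.prim .left _)))) ht)
      (.seq (.prim .right _) (.seq (.prim .right _) (.prim .right _)))), ?_⟩
    have h2 : len ((c, s), a) ≤ len c + S + len (a :: l) + 2 := by
      rw [len_prod, len_prod, len_cons]; omega
    have h3 := eval_mono Q h2
    have h4 : enc (a :: l) = .node (enc a) (enc l) := rfl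
    rw [len_cons] at h3 ⊢
    simp only [h4, Prim.eval, Data.size, len] at *
    omega
  -- A bound for the size of this triple at every moment.
  let W : Polynomial ℕ := .X + B + R + 2
  refine ⟨.seq (.pair (.prim .copy) (.pair p r)) (.seq (.loop test body) (.seq r₁ l₁)),
    2 * .X + P + R + 10 + (R + 1) * (Q.comp W + 30 * W + 22 * W) + 6 * W, fun c => ?_⟩
  obtain ⟨t, ht, ht'⟩ := hp c
  obtain ⟨u, hu, hu'⟩ := hr c
  have hlen : len (l c) ≤ R.eval (len c) := hu.size_le.2.trans hu'
  have hbody' : ∀ (l₁ : List α), len l₁ ≤ R.eval (len c) → ∀ s,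
      (∀ l₂, l₂ <+: l₁ → len (l₂.foldl (g c) s) ≤ B.eval (len c)) → ∃ t,
      Runs (.loop test body) (.node (enc c) (.node (enc s) (enc l₁)))
      (.node (enc c) (.node (enc (l₁.foldl (g c) s)) (enc ([] : List α)))) t ∧
      t ≤ (l₁.length + 1) * ((Q.eval (len c + B.eval (len c) + R.eval (len c) + 2) +
        30 * (len c + B.eval (len c) + R.eval (len c) + 2)) +
        22 * (len c + B.eval (len c) + R.eval (len c) + 2)) := by
    intro l₁
    induction l₁ with
    | nil =>
      intro _ s hs
      obtain ⟨t, ht, ht'⟩ := htest c s []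
      have h0 : len s ≤ B.eval (len c) := hs [] (by simp)
      have h1 := len_nil (α := α)
      refine ⟨_, .loop_false ht, ?_⟩
      simp only [List.length_nil, zero_add, one_mul]
      omega
    | cons a l ih =>
      intro hl s hs
      have h0 : len s ≤ B.eval (len c) := hs [] (by simp)
      obtain ⟨t, ht, ht'⟩ := htest c s (a :: l)
      obtain ⟨r, hr, hr'⟩ := hbody c _ s a l h0
      have hl' := len_cons a l
      obtain ⟨u, hu, hu'⟩ := ih (by omega) (g c s a) fun l₁ h => hs (a :: l₁) (by simpa using h)
      simp only [reduceCtorEq, if_false] at ht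
      refine ⟨_, .loop_true ht (by simp) hr hu, ?_⟩
      rw [List.length_cons, add_mul (l.length + 1)]
      have h1 := eval_mono Q (show len c + B.eval (len c) + len (a :: l) + 2 ≤
        len c + B.eval (len c) + R.eval (len c) + 2 by omega)
      omega
  obtain ⟨v, hv, hv'⟩ := hbody' (l c) hlen (init c) (hB c)
  refine ⟨_, .seq (.pair (.prim .copy _) (.pair ht hu))
    (.seq hv (.seq (.prim .right _) (.prim .left _))), ?_⟩
  have h1 : len ((l c).foldl (g c) (init c)) ≤ B.eval (len c) := hB c _ (List.prefix_rfl)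
  have h2 : (l c).length ≤ R.eval (len c) := (length_le_len _).trans hlen
  have h3 := len_nil (α := α)
  simp only [Polynomial.eval_add, Polynomial.eval_mul, Polynomial.eval_one, Polynomial.eval_comp,
    Polynomial.eval_X, Polynomial.eval_ofNat, W, Prim.eval, Data.size]
  have h4 : v ≤ (R.eval (len c) + 1) *
      ((Q.eval (len c + B.eval (len c) + R.eval (len c) + 2) +
        30 * (len c + B.eval (len c) + R.eval (len c) + 2)) +
        22 * (len c + B.eval (len c) + R.eval (len c) + 2)) := hv'.trans (by gcongr)
  simp only [len] at *
  omega

/-- Folding is polynomial-time if every step enlarges the state by at most a polynomial in the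
sizes of the parameters and of the list element. -/
theorem foldl {g : γ → σ → α → σ} {init : γ → σ} {l : γ → List α}
    (hg : PolyTime (fun p : (γ × σ) × α => g p.1.1 p.1.2 p.2))
    (hi : PolyTime init) (hl : PolyTime l) (B : Polynomial ℕ)
    (hB : ∀ c s a, len (g c s a) ≤ len s + B.eval (len c + len a)) :
    PolyTime (fun c => (l c).foldl (g c) (init c)) := by
  obtain ⟨P, hP⟩ := hi.exists_len_le
  obtain ⟨R, hR⟩ := hl.exists_len_le
  refine foldl_of_le hg hi hl (P + R * B.comp (.X + R)) fun c l₁ h => ?_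
  have key : ∀ (l₁ : List α), (∀ a ∈ l₁, len a ≤ R.eval (len c)) → ∀ s, len (l₁.foldl (g c) s) ≤
      len s + l₁.length * B.eval (len c + R.eval (len c)) := by
    intro l₁
    induction l₁ with
    | nil => simp
    | cons a l₁ ih =>
      intro h s
      have h1 := ih (fun a ha => h a (by simp [ha])) (g c s a)
      have h2 := hB c s a
      have h3 := eval_mono B (Nat.add_le_add_left (h a (by simp)) (len c))
      rw [List.foldl_cons, List.length_cons, add_mul]
      omega
  have h1 := key l₁ (fun a ha => (len_mem_le (h.subset ha)).trans (hR c)) (init c)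
  have h2 : l₁.length ≤ R.eval (len c) := h.length_le.trans ((length_le_len _).trans (hR c))
  have h3 := hP c
  simp only [Polynomial.eval_add, Polynomial.eval_mul, Polynomial.eval_comp, Polynomial.eval_X]
  have h4 := Nat.mul_le_mul_right (B.eval (len c + R.eval (len c))) h2
  omega

end PolyTime
end

/-! #### Basic operations -/

theorem size_add_le (a b : ℤ) :
    Nat.size (a + b).natAbs ≤ Nat.size a.natAbs + Nat.size b.natAbs + 1 := by
  rw [Nat.size_le]
  have h1 := Nat.lt_size_self a.natAbs
  have h2 := Nat.lt_size_self b.natAbs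
  have h3 := Int.natAbs_add_le a b
  have h4 : 2 ^ a.natAbs.size ≤ 2 ^ (a.natAbs.size + b.natAbs.size) :=
    Nat.pow_le_pow_right (by norm_num) (by omega)
  have h5 : 2 ^ b.natAbs.size ≤ 2 ^ (a.natAbs.size + b.natAbs.size) :=
    Nat.pow_le_pow_right (by norm_num) (by omega)
  rw [pow_succ]
  omega

theorem size_mul_le (a b : ℤ) :
    Nat.size (a * b).natAbs ≤ Nat.size a.natAbs + Nat.size b.natAbs := by
  rw [Nat.size_le, Int.natAbs_mul, pow_add]
  exact Nat.mul_lt_mul'' (Nat.lt_size_self _) (Nat.lt_size_self _)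

theorem len_int (a : ℤ) : len a = Nat.size a.natAbs + 1 := rfl

theorem len_nat (a : ℕ) : len a = Nat.size a + 1 := rfl

namespace PolyTime
variable {α β γ δ σ : Type} [Code α] [Code β] [Code γ] [Code δ] [Code σ]

/-- Only the presentation of the values as data matters. -/
theorem of_enc_eq {f : α → β} {g : α → γ} (hf : PolyTime f) (h : ∀ x, enc (f x) = enc (g x)) :
    PolyTime g := by
  obtain ⟨p, T, hp⟩ := hf
  exact ⟨p, T, fun x => h x ▸ hp x⟩

theorem onFst {f : α → β} (hf : PolyTime f) : PolyTime (fun p : α × γ => f p.1) :=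
  comp hf (fst PolyTime.id)

theorem congr {f g : α → β} (hf : PolyTime f) (h : ∀ x, f x = g x) : PolyTime g :=
  (funext h : f = g) ▸ hf

theorem intAdd {f g : α → ℤ} (hf : PolyTime f) (hg : PolyTime g) :
    PolyTime (fun x => f x + g x) :=
  comp (of_prim (f := fun p : ℤ × ℤ => p.1 + p.2) .add (fun _ => rfl) (.X + 1) fun x => by
    have := size_add_le x.1 x.2
    have h := len_prod x.1 x.2
    simp only [Polynomial.eval_add, Polynomial.eval_X, Polynomial.eval_one, Prod.mk.eta] at *
    rw [h]
    simp only [len_int]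
    omega) (pair hf hg)

theorem intSub {f g : α → ℤ} (hf : PolyTime f) (hg : PolyTime g) :
    PolyTime (fun x => f x - g x) :=
  comp (of_prim (f := fun p : ℤ × ℤ => p.1 - p.2) .sub (fun _ => rfl) (.X + 1) fun x => by
    have := size_add_le x.1 (-x.2)
    have h := len_prod x.1 x.2
    simp only [Polynomial.eval_add, Polynomial.eval_X, Polynomial.eval_one, Prod.mk.eta,
      Int.natAbs_neg, ← sub_eq_add_neg] at *
    rw [h]
    simp only [len_int]
    omega) (pair hf hg)

theorem intMul {f g : α → ℤ} (hf : PolyTime f) (hg : PolyTime g) :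
    PolyTime (fun x => f x * g x) :=
  comp (of_prim (f := fun p : ℤ × ℤ => p.1 * p.2) .mul (fun _ => rfl) .X fun x => by
    have := size_mul_le x.1 x.2
    have h := len_prod x.1 x.2
    simp only [Polynomial.eval_X, Prod.mk.eta] at *
    rw [h]
    simp only [len_int]
    omega) (pair hf hg)

theorem intLe {f g : α → ℤ} (hf : PolyTime f) (hg : PolyTime g) :
    PolyTime (fun x => decide (f x ≤ g x)) :=
  comp (of_prim (f := fun p : ℤ × ℤ => decide (p.1 ≤ p.2)) .le
    (fun x => by simp [enc, Prim.eval, boolData]) 2 fun x => by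
    simpa using len_bool _) (pair hf hg)

theorem intLt {f g : α → ℤ} (hf : PolyTime f) (hg : PolyTime g) :
    PolyTime (fun x => decide (f x < g x)) :=
  intLe (intAdd hf (const 1)) hg

theorem natCast {f : α → ℕ} (hf : PolyTime f) : PolyTime (fun x => (f x : ℤ)) :=
  hf.of_enc_eq fun _ => rfl

theorem natAdd {f g : α → ℕ} (hf : PolyTime f) (hg : PolyTime g) :
    PolyTime (fun x => f x + g x) :=
  (intAdd hf.natCast hg.natCast).of_enc_eq fun x => by simp [enc]

theorem natLe {f g : α → ℕ} (hf : PolyTime f) (hg : PolyTime g) :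
    PolyTime (fun x => decide (f x ≤ g x)) :=
  (intLe hf.natCast hg.natCast).congr fun x => by simp

theorem natLt {f g : α → ℕ} (hf : PolyTime f) (hg : PolyTime g) :
    PolyTime (fun x => decide (f x < g x)) :=
  natLe (natAdd hf (const 1)) hg

theorem not {f : α → Bool} (hf : PolyTime f) : PolyTime (fun x => !f x) :=
  (cond hf (const false) (const true)).congr fun x => by cases f x <;> rfl

theorem and {f g : α → Bool} (hf : PolyTime f) (hg : PolyTime g) :
    PolyTime (fun x => f x && g x) :=
  (cond hf hg (const false)).congr fun x => by cases f x <;> rfl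

theorem or {f g : α → Bool} (hf : PolyTime f) (hg : PolyTime g) :
    PolyTime (fun x => f x || g x) :=
  (cond hf (const true) hg).congr fun x => by cases f x <;> rfl

theorem natEq {f g : α → ℕ} (hf : PolyTime f) (hg : PolyTime g) :
    PolyTime (fun x => decide (f x = g x)) :=
  (and (natLe hf hg) (natLe hg hf)).congr fun x => by
    rw [← Bool.decide_and]; exact decide_eq_decide.2 (by omega)

theorem intEq {f g : α → ℤ} (hf : PolyTime f) (hg : PolyTime g) :
    PolyTime (fun x => decide (f x = g x)) :=
  (and (intLe hf hg) (intLe hg hf)).congr fun x => by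
    rw [← Bool.decide_and]; exact decide_eq_decide.2 (by omega)

theorem some {f : α → β} (hf : PolyTime f) : PolyTime (fun x => Option.some (f x)) :=
  (pair (const (1 : ℕ)) hf).of_enc_eq fun _ => rfl

theorem optionMap {o : γ → Option α} {f : γ → α → β} (ho : PolyTime o)
    (hf : PolyTime (fun p : γ × α => f p.1 p.2)) : PolyTime (fun c => (o c).map (f c)) :=
  (elim ho (const none) (some hf)).congr fun x => by cases o x <;> rfl

theorem optionGetD {o : γ → Option α} {a : γ → α} (ho : PolyTime o) (ha : PolyTime a) :
    PolyTime (fun c => (o c).getD (a c)) :=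
  (elim ho ha (snd PolyTime.id)).congr fun x => by cases o x <;> rfl

/-! #### Operations on lists -/

theorem cons {f : γ → α} {l : γ → List α} (hf : PolyTime f) (hl : PolyTime l) :
    PolyTime (fun c => f c :: l c) :=
  (pair hf hl).of_enc_eq fun _ => rfl

theorem head? {l : γ → List α} (hl : PolyTime l) : PolyTime (fun c => (l c).head?) := by
  refine comp (g := fun l : List α => l.head?) ⟨.ite (.prim .isNode)
    (.pair (.prim (.const (.num 1))) (.prim .left)) (.prim (.const (.num 0))),
    5 * .X + 20, fun l => ?_⟩ hl
  cases l with
  | nil =>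
    refine ⟨_, .ite_false (.prim .isNode _) (.prim _ _), ?_⟩
    simp only [Polynomial.eval_add, Polynomial.eval_mul, Polynomial.eval_X, Polynomial.eval_ofNat,
      len, Prim.eval, Data.size, enc, List.map_nil, listData]
    simp
  | cons a l =>
    refine ⟨_, .ite_true (.prim .isNode _) (by simp [enc, Prim.eval, listData])
      (.pair (.prim _ _) (.prim .left _)), ?_⟩
    have h1 : (enc (a :: l)).size = len (a :: l) := rfl
    have h2 : (Prim.eval .isNode (enc (a :: l))).size = 2 := rfl
    have h3 : (Prim.eval .left (enc (a :: l))).size = len a := rfl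
    have h4 : (Prim.eval (.const (.num 1)) (enc (a :: l))).size = 2 := rfl
    rw [h1, h2, h3, h4, len_cons]
    simp only [Polynomial.eval_add, Polynomial.eval_mul, Polynomial.eval_X, Polynomial.eval_ofNat]
    omega

theorem reverse {l : γ → List α} (hl : PolyTime l) : PolyTime (fun c => (l c).reverse) :=
  (foldl (g := fun _ s a => a :: s) (cons (snd PolyTime.id) (snd (fst PolyTime.id)))
    (const []) hl (.X + 1) fun c s a => by
      rw [len_cons]; simp; omega).congr fun c => by simp

/-- Folding from the right, under a bound for the growth of the state in every step. -/
theorem foldr {g : γ → α → σ → σ} {init : γ → σ} {l : γ → List α}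
    (hg : PolyTime (fun p : (γ × σ) × α => g p.1.1 p.2 p.1.2))
    (hi : PolyTime init) (hl : PolyTime l) (B : Polynomial ℕ)
    (hB : ∀ c s a, len (g c a s) ≤ len s + B.eval (len c + len a)) :
    PolyTime (fun c => (l c).foldr (g c) (init c)) :=
  (foldl (g := fun c s a => g c a s) hg hi hl.reverse B hB).congr fun c => by simp

theorem map {f : γ → α → β} {l : γ → List α} (hl : PolyTime l)
    (hf : PolyTime (fun p : γ × α => f p.1 p.2)) : PolyTime (fun c => (l c).map (f c)) := by
  obtain ⟨T, hT⟩ := hf.exists_len_le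
  refine (foldr (g := fun c a s => f c a :: s) (cons (comp₂ (g := f) hf (fst (fst PolyTime.id))
    (snd PolyTime.id)) (snd (fst PolyTime.id))) (const []) hl (T.comp (.X + 1) + 1)
    fun c s a => ?_).congr fun c => by simp
  have := hT (c, a)
  rw [len_prod] at this
  rw [len_cons]
  simp only [] at this
  simp only [Polynomial.eval_add, Polynomial.eval_comp, Polynomial.eval_X, Polynomial.eval_one]
  omega

theorem append {l₁ l₂ : γ → List α} (h₁ : PolyTime l₁) (h₂ : PolyTime l₂) :
    PolyTime (fun c => l₁ c ++ l₂ c) :=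
  (foldr (g := fun _ a s => a :: s) (cons (snd PolyTime.id) (snd (fst PolyTime.id)))
    h₂ h₁ (.X + 1) fun c s a => by rw [len_cons]; simp; omega).congr fun c => by simp

theorem flatten {l : γ → List (List α)} (hl : PolyTime l) : PolyTime (fun c => (l c).flatten) :=
  (foldr (g := fun _ a s => a ++ s) (append (snd PolyTime.id) (snd (fst PolyTime.id)))
    (const []) hl .X fun c s a => by
      have := len_append a s
      simp only [Polynomial.eval_X]
      omega).congr fun c => by
        induction l c with
        | nil => rfl
        | cons a l ih => simp [ih]

theorem flatMap {f : γ → α → List β} {l : γ → List α} (hl : PolyTime l)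
    (hf : PolyTime (fun p : γ × α => f p.1 p.2)) : PolyTime (fun c => (l c).flatMap (f c)) :=
  (flatten (map hl hf)).congr fun c => by rw [List.flatMap_def]

theorem filter {f : γ → α → Bool} {l : γ → List α} (hl : PolyTime l)
    (hf : PolyTime (fun p : γ × α => f p.1 p.2)) : PolyTime (fun c => (l c).filter (f c)) :=
  (flatMap (f := fun c a => bif f c a then [a] else []) hl
    (cond hf (cons (snd PolyTime.id) (const [])) (const []))).congr fun c => by
      induction l c with
      | nil => rfl
      | cons a l ih => cases h : f c a <;> simp_all

theorem find? {f : γ → α → Bool} {l : γ → List α} (hl : PolyTime l)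
    (hf : PolyTime (fun p : γ × α => f p.1 p.2)) : PolyTime (fun c => (l c).find? (f c)) :=
  (head? (filter hl hf)).congr fun c => by simp

theorem any {f : γ → α → Bool} {l : γ → List α} (hl : PolyTime l)
    (hf : PolyTime (fun p : γ × α => f p.1 p.2)) : PolyTime (fun c => (l c).any (f c)) :=
  (elim (g := fun _ _ => true) (find? hl hf) (const false) (const true)).congr fun c => by
    induction l c with
    | nil => rfl
    | cons a l ih => cases h : f c a <;> simp_all

theorem all {f : γ → α → Bool} {l : γ → List α} (hl : PolyTime l)
    (hf : PolyTime (fun p : γ × α => f p.1 p.2)) : PolyTime (fun c => (l c).all (f c)) :=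
  (not (any (f := fun c a => !f c a) hl (not hf))).congr fun c => by
    induction l c with
    | nil => rfl
    | cons a l ih => cases h : f c a <;> simp_all

theorem intSum {l : γ → List ℤ} (hl : PolyTime l) : PolyTime (fun c => (l c).sum) :=
  (foldr (g := fun _ a s => a + s) (intAdd (snd PolyTime.id) (snd (fst PolyTime.id)))
    (const 0) hl .X fun c s a => by
      have := size_add_le a s
      simp only [Polynomial.eval_X, len_int]
      omega).congr fun c => rfl

theorem intProd {l : γ → List ℤ} (hl : PolyTime l) : PolyTime (fun c => (l c).prod) :=
  (foldr (g := fun _ a s => a * s) (intMul (snd PolyTime.id) (snd (fst PolyTime.id)))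
    (const 1) hl .X fun c s a => by
      have := size_mul_le a s
      simp only [Polynomial.eval_X, len_int]
      omega).congr fun c => rfl

theorem length {l : γ → List α} (hl : PolyTime l) : PolyTime (fun c => (l c).length) :=
  (intSum (map (f := fun _ _ => 1) hl (const 1))).of_enc_eq fun c => by simp [enc]

/-- Pairing the elements of a list with their positions. -/
theorem zipIdx {l : γ → List α} (hl : PolyTime l) : PolyTime (fun c => (l c).zipIdx) := by
  have h : PolyTime (fun c => (l c).foldl (fun (s : List (α × ℕ) × ℕ) a =>
      (((a, s.2) :: s.1), s.2 + 1)) ([], 0)) := by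
    -- The counter makes the growth of the state depend on the state; its size is bounded by
    -- the length of the whole list.
    refine foldl_of_le (g := fun _ s a => (((a, s.2) :: s.1), s.2 + 1)) (pair (cons (pair
      (snd PolyTime.id) (snd (snd (fst PolyTime.id)))) (fst (snd (fst PolyTime.id))))
      (natAdd (snd (snd (fst PolyTime.id))) (const 1))) (const ([], 0)) hl
      (let R := hl.exists_len_le.choose; 10 + R + R * (R + R + 10)) ?_
    intro c l₁ hl₁
    have hR := hl.exists_len_le.choose_spec c
    set R := hl.exists_len_le.choose
    have key : ∀ (l₁ : List α) (s : List (α × ℕ) × ℕ) (N : ℕ), (∀ a ∈ l₁, len a ≤ N) →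
        s.2 + l₁.length ≤ N → len (l₁.foldl (fun (s : List (α × ℕ) × ℕ) a =>
          (((a, s.2) :: s.1), s.2 + 1)) s) ≤ len s.1 + l₁.length * (N + N + 3) + N + 2 := by
      intro l₁
      induction l₁ with
      | nil =>
        intro s N _ h
        have h1 := len_prod s.1 s.2
        have h2 : Nat.size s.2 ≤ s.2 := Nat.size_le.2 Nat.lt_two_pow_self
        simp only [Prod.mk.eta, len_nat] at h1
        simp only [List.length_nil, List.foldl_nil, zero_mul] at h ⊢
        omega
      | cons a l₁ ih =>
        intro s N h1 h2
        rw [List.length_cons] at *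
        have h3 := ih ((a, s.2) :: s.1, s.2 + 1) N (fun a ha => h1 a (by simp [ha]))
          (by simp only []; omega)
        have h4 := h1 a (by simp)
        have h5 : Nat.size s.2 ≤ s.2 := Nat.size_le.2 Nat.lt_two_pow_self
        rw [List.foldl_cons, add_mul]
        simp only [len_cons, len_prod, len_nat] at h3
        omega
    have h1 : ∀ a ∈ l₁, len a ≤ R.eval (len c) :=
      fun a ha => (len_mem_le (hl₁.subset ha)).trans hR
    have h2 : l₁.length ≤ R.eval (len c) := hl₁.length_le.trans ((length_le_len _).trans hR)
    have h3 := key l₁ ([], 0) _ h1 (by simpa using h2)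
    have h4 := len_nil (α := α × ℕ)
    simp only [Polynomial.eval_add, Polynomial.eval_mul, Polynomial.eval_ofNat]
    have h5 : l₁.length * (R.eval (len c) + R.eval (len c) + 3) ≤
      R.eval (len c) * (R.eval (len c) + R.eval (len c) + 10) := by gcongr; norm_num
    simp only [h4] at h3
    omega
  refine (reverse (fst h)).congr fun c => ?_
  have key : ∀ (l : List α) (s : List (α × ℕ) × ℕ), (l.foldl (fun (s : List (α × ℕ) × ℕ) a =>
      (((a, s.2) :: s.1), s.2 + 1)) s).1 = (l.zipIdx s.2).reverse ++ s.1 := by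
    intro l
    induction l with
    | nil => simp
    | cons a l ih => intro s; rw [List.foldl_cons, ih]; simp
  rw [key]
  simp

theorem getElem? {l : γ → List α} {i : γ → ℕ} (hl : PolyTime l) (hi : PolyTime i) :
    PolyTime (fun c => (l c)[i c]?) := by
  refine (optionMap (f := fun _ (p : α × ℕ) => p.1)
    (find? (f := fun c (p : α × ℕ) => decide (p.2 = i c)) hl.zipIdx
    (natEq (snd (snd PolyTime.id)) (comp hi (fst PolyTime.id)))) (fst (snd PolyTime.id))).congr
    fun c => ?_
  have key : ∀ (l : List α) (n i : ℕ), ((l.zipIdx n).find? (fun p : α × ℕ => decide (p.2 = n + i))).map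
      (fun p => p.1) = l[i]? := by
    intro l
    induction l with
    | nil => simp
    | cons a l ih =>
      intro n i
      cases i with
      | zero => simp
      | succ i =>
        have := ih (n + 1) i
        simp only [List.zipIdx_cons, List.getElem?_cons_succ]
        rw [List.find?_cons_of_neg (by simp), ← this]
        congr 3
        funext p
        exact decide_eq_decide.2 (by omega)
  simpa using key (l c) 0 (i c)

theorem getD {l : γ → List α} {i : γ → ℕ} {a : γ → α} (hl : PolyTime l) (hi : PolyTime i)
    (ha : PolyTime a) : PolyTime (fun c => (l c).getD (i c) (a c)) :=
  (optionGetD (getElem? hl hi) ha).congr fun c => by rw [List.getD_eq_getElem?_getD]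

end PolyTime

/-! ### Homogeneous linear inequalities -/

/-- The value at `y` of the linear form whose coefficients, padded with zeros, are the first `n`
entries of `l`. -/
def linForm (n : ℕ) (l : List ℤ) (y : ℕ → ℝ) : ℝ := ∑ i ∈ Finset.range n, (l.getD i 0 : ℝ) * y i

/-- A linear inequality, strict if the flag is set: the given linear form in `n` unknowns is
positive or nonnegative at `y`. -/
def Sat (n : ℕ) (q : Bool × List ℤ) (y : ℕ → ℝ) : Prop :=
  (q.1 = true → 0 < linForm n q.2 y) ∧ 0 ≤ linForm n q.2 y

/-- The value of a linear form at an integer vector. -/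
def intForm (n : ℕ) (l y : List ℤ) : ℤ := ((List.range n).map fun i => l.getD i 0 * y.getD i 0).sum

/-- An integer vector as a real one. -/
def toReal (y : List ℤ) (i : ℕ) : ℝ := (y.getD i 0 : ℝ)

/-- Decision of an inequality at an integer vector. -/
def checkSat (n : ℕ) (q : Bool × List ℤ) (y : List ℤ) : Bool :=
  bif q.1 then decide (0 < intForm n q.2 y) else decide (0 ≤ intForm n q.2 y)

/-- The inequalities that bound unknown `n` from below. -/
def lowers (n : ℕ) (cs : List (Bool × List ℤ)) : List (Bool × List ℤ) :=
  cs.filter fun q => decide (0 < q.2.getD n 0)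

/-- The inequalities that bound unknown `n` from above. -/
def uppers (n : ℕ) (cs : List (Bool × List ℤ)) : List (Bool × List ℤ) :=
  cs.filter fun q => decide (q.2.getD n 0 < 0)

/-- The consequence without unknown `n` of a lower and an upper bound for it. -/
def combine (n : ℕ) (p q : Bool × List ℤ) : Bool × List ℤ :=
  (p.1 || q.1,
    (List.range n).map fun i => p.2.getD n 0 * q.2.getD i 0 - q.2.getD n 0 * p.2.getD i 0)

/-- Elimination of unknown `n`, the last one. -/
def eliminate (n : ℕ) (cs : List (Bool × List ℤ)) : List (Bool × List ℤ) :=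
  cs.filter (fun q => decide (q.2.getD n 0 = 0)) ++
    (lowers n cs).flatMap fun p => (uppers n cs).map fun q => combine n p q

/-- The extension of a vector `y` by the midpoint of the bounds which `p` and `q` impose on the
unknown `n`, the whole vector being rescaled to avoid denominators. -/
def extend (n : ℕ) (y : List ℤ) (p q : Bool × List ℤ) : List ℤ :=
  ((List.range n).map fun i => -2 * p.2.getD n 0 * q.2.getD n 0 * y.getD i 0) ++
    [intForm n p.2 y * q.2.getD n 0 + intForm n q.2 y * p.2.getD n 0]

/-- A solution of a system in the unknowns `0, …, n`, where unknown `0` is supposed to be positive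
and serves as the common denominator of the others. After elimination of the last unknown, all
midpoints between a lower and an upper bound for it are tried, so the search may fail for a solvable
system unless each unknown has bounds of both kinds. -/
def solve : ℕ → List (Bool × List ℤ) → Option (List ℤ)
  | 0, cs => bif cs.all (fun q => checkSat 1 q [1]) then some [1] else none
  | n + 1, cs => (solve n (eliminate (n + 1) cs)).elim none fun y =>
      ((lowers (n + 1) cs).flatMap fun p => (uppers (n + 1) cs).map fun q =>
        extend (n + 1) y p q).find? fun z => cs.all fun q => checkSat (n + 2) q z

theorem intForm_cast (n : ℕ) (l y : List ℤ) : (intForm n l y : ℝ) = linForm n l (toReal y) := by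
  rw [intForm, linForm, ← List.sum_toFinset _ List.nodup_range, List.toFinset_range]
  simp [toReal]

theorem checkSat_iff {n : ℕ} {q : Bool × List ℤ} {y : List ℤ} :
    checkSat n q y = true ↔ Sat n q (toReal y) := by
  rw [checkSat, Sat, ← intForm_cast]
  cases q.1 with
  | true => simpa using le_of_lt
  | false => simp

theorem sat_of_solve {n : ℕ} {cs : List (Bool × List ℤ)} {y : List ℤ} (h : solve n cs = some y) :
    ∀ q ∈ cs, Sat (n + 1) q (toReal y) := by
  intro q hq
  rw [← checkSat_iff]
  cases n with
  | zero =>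
    rw [solve] at h
    cases hc : cs.all (fun q => checkSat 1 q [1]) with
    | false => rw [hc] at h; cases h
    | true =>
      rw [hc] at h
      cases h
      exact List.all_eq_true.1 hc q hq
  | succ n =>
    rw [solve] at h
    cases hs : solve n (eliminate (n + 1) cs) with
    | none => rw [hs] at h; cases h
    | some x =>
      rw [hs] at h
      have := List.find?_some h
      exact List.all_eq_true.1 this q hq

theorem linForm_succ (n : ℕ) (l : List ℤ) (y : ℕ → ℝ) :
    linForm (n + 1) l y = linForm n l y + l.getD n 0 * y n := Finset.sum_range_succ _ _

theorem linForm_combine (n : ℕ) (p q : Bool × List ℤ) (y : ℕ → ℝ) :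
    linForm n (combine n p q).2 y =
      p.2.getD n 0 * linForm n q.2 y - q.2.getD n 0 * linForm n p.2 y := by
  rw [linForm, linForm, linForm, Finset.mul_sum, Finset.mul_sum, ← Finset.sum_sub_distrib]
  refine Finset.sum_congr rfl fun i hi => ?_
  have hi' : i < n := Finset.mem_range.1 hi
  have : (combine n p q).2.getD i 0 = p.2.getD n 0 * q.2.getD i 0 - q.2.getD n 0 * p.2.getD i 0 := by
    simp [combine, List.getD_eq_getElem?_getD, hi']
  rw [this]
  push_cast
  ring

theorem linForm_extend (n : ℕ) (y : List ℤ) (p q r : Bool × List ℤ) :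
    linForm (n + 1) r.2 (toReal (extend n y p q)) =
      -2 * p.2.getD n 0 * q.2.getD n 0 * linForm n r.2 (toReal y) +
        r.2.getD n 0 * (linForm n p.2 (toReal y) * q.2.getD n 0 +
          linForm n q.2 (toReal y) * p.2.getD n 0) := by
  rw [linForm_succ]
  congr 1
  · rw [linForm, linForm, Finset.mul_sum]
    refine Finset.sum_congr rfl fun i hi => ?_
    have hi' : i < n := Finset.mem_range.1 hi
    have : (extend n y p q).getD i 0 = -2 * p.2.getD n 0 * q.2.getD n 0 * y.getD i 0 := by
      rw [extend, List.getD_append _ _ _ _ (by simpa using hi')]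
      simp [List.getD_eq_getElem?_getD, hi']
    rw [toReal, this, toReal]
    push_cast
    ring
  · have : (extend n y p q).getD n 0 =
        intForm n p.2 y * q.2.getD n 0 + intForm n q.2 y * p.2.getD n 0 := by
      rw [extend, List.getD_append_right _ _ _ _ (by simp)]
      simp
    rw [toReal, this]
    push_cast
    rw [intForm_cast, intForm_cast]

/-- Fourier–Motzkin elimination: a system that bounds each unknown in terms of the previous ones is
solved by `solve` as soon as it is solvable over the reals. -/
theorem exists_solve {n : ℕ} {cs : List (Bool × List ℤ)} {y : ℕ → ℝ} (h0 : 0 < y 0)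
    (hy : ∀ q ∈ cs, Sat (n + 1) q y)
    (hlow : ∀ i, 1 ≤ i → i ≤ n → ∃ p ∈ cs, 0 < p.2.getD i 0 ∧ ∀ j, i < j → p.2.getD j 0 = 0)
    (hup : ∀ i, 1 ≤ i → i ≤ n → ∃ p ∈ cs, p.2.getD i 0 < 0 ∧ ∀ j, i < j → p.2.getD j 0 = 0) :
    ∃ z, solve n cs = some z := by
  induction n generalizing cs with
  | zero =>
    refine ⟨[1], ?_⟩
    rw [solve]
    have : cs.all (fun q => checkSat 1 q [1]) = true := by
      refine List.all_eq_true.2 fun q hq => checkSat_iff.2 ?_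
      obtain ⟨h1, h2⟩ := hy q hq
      simp only [zero_add, linForm, Finset.sum_range_one] at h1 h2
      simp only [Sat, linForm, Finset.sum_range_one]
      have h3 : toReal [1] 0 = 1 := by simp [toReal]
      rw [h3, mul_one]
      exact ⟨fun h => pos_of_mul_pos_left (h1 h) h0.le, nonneg_of_mul_nonneg_left h2 h0⟩
    rw [this]
    rfl
  | succ n ih =>
    set m := n + 1 with hm
    have hz : ∀ q ∈ cs, q.2.getD m 0 = 0 → q ∈ eliminate m cs := fun q hq h =>
      List.mem_append_left _ (List.mem_filter.2 ⟨hq, by simpa using h⟩)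
    -- The real solution also solves the system without the last unknown, so that an integer
    -- solution `x` of this system is found.
    obtain ⟨x, hx⟩ := ih (cs := eliminate m cs) (fun q hq => by
      rcases List.mem_append.1 hq with hq | hq
      · obtain ⟨hq, h⟩ := List.mem_filter.1 hq
        have h' : q.2.getD m 0 = 0 := of_decide_eq_true h
        have := hy q hq
        rwa [Sat, linForm_succ, h', Int.cast_zero, zero_mul, add_zero] at this
      · obtain ⟨p, hp, hq⟩ := List.mem_flatMap.1 hq
        obtain ⟨r, hr, rfl⟩ := List.mem_map.1 hq
        obtain ⟨hp, hp'⟩ := List.mem_filter.1 hp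
        obtain ⟨hr, hr'⟩ := List.mem_filter.1 hr
        have hp0 : (0 : ℝ) < p.2.getD m 0 := by exact_mod_cast of_decide_eq_true hp'
        have hr0 : (r.2.getD m 0 : ℝ) < 0 := by exact_mod_cast of_decide_eq_true hr'
        obtain ⟨p1, p2⟩ := hy p hp
        obtain ⟨r1, r2⟩ := hy r hr
        rw [linForm_succ] at p1 p2 r1 r2
        rw [Sat, linForm_combine]
        have e : (p.2.getD m 0 : ℝ) * linForm m r.2 y - r.2.getD m 0 * linForm m p.2 y =
          p.2.getD m 0 * (linForm m r.2 y + r.2.getD m 0 * y m) +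
            (-r.2.getD m 0) * (linForm m p.2 y + p.2.getD m 0 * y m) := by ring
        rw [e]
        have n1 := mul_nonneg hp0.le r2
        have n2 := mul_nonneg (neg_pos.2 hr0).le p2
        refine ⟨fun h => ?_, by positivity⟩
        rcases (Bool.or_eq_true_iff).1 h with h | h
        · have := mul_pos (neg_pos.2 hr0) (p1 h)
          linarith
        · have := mul_pos hp0 (r1 h)
          linarith)
      (fun i hi hi' => by
        obtain ⟨p, hp, h1, h2⟩ := hlow i hi (by omega)
        exact ⟨p, hz p hp (h2 m (by omega)), h1, h2⟩)
      (fun i hi hi' => by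
        obtain ⟨p, hp, h1, h2⟩ := hup i hi (by omega)
        exact ⟨p, hz p hp (h2 m (by omega)), h1, h2⟩)
    have hsat := sat_of_solve hx
    rw [← hm] at hsat
    -- The bound for unknown `m` that an inequality imposes at `x`.
    let f : Bool × List ℤ → ℝ := fun q => -linForm m q.2 (toReal x) / q.2.getD m 0
    -- The largest lower bound and the smallest upper bound.
    obtain ⟨p, hp, hpmax⟩ := (lowers m cs).toFinset.exists_max_image f (by
      obtain ⟨p, hp, h, -⟩ := hlow m (by omega) le_rfl
      exact ⟨p, List.mem_toFinset.2 (List.mem_filter.2 ⟨hp, by simpa using h⟩)⟩)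
    obtain ⟨q, hq, hqmin⟩ := (uppers m cs).toFinset.exists_min_image f (by
      obtain ⟨p, hp, h, -⟩ := hup m (by omega) le_rfl
      exact ⟨p, List.mem_toFinset.2 (List.mem_filter.2 ⟨hp, by simpa using h⟩)⟩)
    rw [List.mem_toFinset] at hp hq
    have low0 : ∀ p ∈ lowers m cs, (0 : ℝ) < p.2.getD m 0 := fun p hp => by
      exact_mod_cast of_decide_eq_true (List.mem_filter.1 hp).2
    have up0 : ∀ p ∈ uppers m cs, (p.2.getD m 0 : ℝ) < 0 := fun p hp => by
      exact_mod_cast of_decide_eq_true (List.mem_filter.1 hp).2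
    have hle : ∀ p ∈ lowers m cs, ∀ q ∈ uppers m cs,
        ((p.1 || q.1) = true → f p < f q) ∧ f p ≤ f q := fun p hp q hq => by
      have hc := hsat (combine m p q) (List.mem_append_right _
        (List.mem_flatMap.2 ⟨p, hp, List.mem_map.2 ⟨q, hq, rfl⟩⟩))
      have hp0 := low0 p hp
      have hq0 := up0 q hq
      rw [Sat, linForm_combine] at hc
      have e : (p.2.getD m 0 : ℝ) * linForm m q.2 (toReal x) -
          q.2.getD m 0 * linForm m p.2 (toReal x) =
          (p.2.getD m 0 * -q.2.getD m 0) * (f q - f p) := by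
        simp only [f]
        have := hp0.ne'
        have := hq0.ne
        field_simp
        ring
      have hpq : (0 : ℝ) < p.2.getD m 0 * -q.2.getD m 0 := mul_pos hp0 (neg_pos.2 hq0)
      rw [e] at hc
      exact ⟨fun h => sub_pos.1 (pos_of_mul_pos_right (hc.1 h) hpq.le),
        sub_nonneg.1 (nonneg_of_mul_nonneg_right hc.2 hpq)⟩
    have hp0 := low0 p hp
    have hq0 := up0 q hq
    have hs : (0 : ℝ) < -2 * p.2.getD m 0 * q.2.getD m 0 := by
      have := mul_pos hp0 (neg_pos.2 hq0)
      linarith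
    -- The midpoint between them satisfies all inequalities.
    have hall : ∀ r ∈ cs, Sat (m + 1) r (toReal (extend m x p q)) := by
      intro r hr
      have hpq := hle p hp q hq
      rw [Sat, linForm_extend]
      rcases eq_or_ne (r.2.getD m 0) 0 with h | h
      · have hr' := hsat r (hz r hr h)
        rw [h, Int.cast_zero, zero_mul, add_zero]
        exact ⟨fun h => mul_pos hs (hr'.1 h), mul_nonneg hs.le hr'.2⟩
      · have h' : (r.2.getD m 0 : ℝ) ≠ 0 := by exact_mod_cast h
        have e : -2 * (p.2.getD m 0 : ℝ) * q.2.getD m 0 * linForm m r.2 (toReal x) +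
            r.2.getD m 0 * (linForm m p.2 (toReal x) * q.2.getD m 0 +
              linForm m q.2 (toReal x) * p.2.getD m 0) =
            (-2 * p.2.getD m 0 * q.2.getD m 0) * (r.2.getD m 0 * ((f p + f q) / 2 - f r)) := by
          simp only [f]
          have := hp0.ne'
          have := hq0.ne
          field_simp
          ring
        rw [e]
        rcases lt_or_gt_of_ne h with h | h
        · have hru : r ∈ uppers m cs := List.mem_filter.2 ⟨hr, by simpa using h⟩
          have h0 := up0 r hru
          have h1 := hqmin r (List.mem_toFinset.2 hru)
          have h2 := hle p hp r hru
          rw [← neg_mul_neg (r.2.getD m 0 : ℝ)]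
          refine ⟨fun h => mul_pos hs (mul_pos (neg_pos.2 h0) ?_),
            mul_nonneg hs.le (mul_nonneg (neg_pos.2 h0).le ?_)⟩
          · have := h2.1 (by simp [h])
            linarith
          · linarith
        · have hrl : r ∈ lowers m cs := List.mem_filter.2 ⟨hr, by simpa using h⟩
          have h0 := low0 r hrl
          have h1 := hpmax r (List.mem_toFinset.2 hrl)
          have h2 := hle r hrl q hq
          refine ⟨fun h => mul_pos hs (mul_pos h0 ?_), mul_nonneg hs.le (mul_nonneg h0.le ?_)⟩
          · have := h2.1 (by simp [h])
            linarith
          · linarith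
    rw [solve, ← hm, hx]
    refine Option.isSome_iff_exists.1 ?_
    rw [Option.elim_some, List.find?_isSome]
    refine ⟨extend m x p q, List.mem_flatMap.2 ⟨p, hp, List.mem_map.2 ⟨q, hq, rfl⟩⟩, ?_⟩
    exact List.all_eq_true.2 fun r hr => checkSat_iff.2 (hall r hr)

namespace PolyTime
variable {γ : Type} [Code γ]

theorem intForm {n : ℕ} {l y : γ → List ℤ} (hl : PolyTime l) (hy : PolyTime y) :
    PolyTime (fun c => EFGC.intForm n (l c) (y c)) :=
  intSum (map (f := fun c i => (l c).getD i 0 * (y c).getD i 0) (const _) (intMul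
    (getD (comp hl (fst PolyTime.id)) (snd PolyTime.id) (const 0))
    (getD (comp hy (fst PolyTime.id)) (snd PolyTime.id) (const 0))))

theorem checkSat {n : ℕ} {q : γ → Bool × List ℤ} {y : γ → List ℤ} (hq : PolyTime q)
    (hy : PolyTime y) : PolyTime (fun c => EFGC.checkSat n (q c) (y c)) :=
  cond (fst hq) (intLt (const 0) (intForm (snd hq) hy)) (intLe (const 0) (intForm (snd hq) hy))

theorem lowers {n : ℕ} {cs : γ → List (Bool × List ℤ)} (h : PolyTime cs) :
    PolyTime (fun c => EFGC.lowers n (cs c)) :=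
  filter (f := fun _ (q : Bool × List ℤ) => decide (0 < q.2.getD n 0)) h
    (intLt (const 0) (getD (snd (snd PolyTime.id)) (const n) (const 0)))

theorem uppers {n : ℕ} {cs : γ → List (Bool × List ℤ)} (h : PolyTime cs) :
    PolyTime (fun c => EFGC.uppers n (cs c)) :=
  filter (f := fun _ (q : Bool × List ℤ) => decide (q.2.getD n 0 < 0)) h
    (intLt (getD (snd (snd PolyTime.id)) (const n) (const 0)) (const 0))

theorem combine {n : ℕ} {p q : γ → Bool × List ℤ} (hp : PolyTime p) (hq : PolyTime q) :
    PolyTime (fun c => EFGC.combine n (p c) (q c)) := by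
  refine pair (or (fst hp) (fst hq)) (map (f := fun c i => (p c).2.getD n 0 * (q c).2.getD i 0 -
    (q c).2.getD n 0 * (p c).2.getD i 0) (const _) ?_)
  have hp' := comp (snd hp) (fst (PolyTime.id (α := γ × ℕ)))
  have hq' := comp (snd hq) (fst (PolyTime.id (α := γ × ℕ)))
  have hi := snd (PolyTime.id (α := γ × ℕ))
  exact intSub (intMul (getD hp' (const n) (const 0)) (getD hq' hi (const 0)))
    (intMul (getD hq' (const n) (const 0)) (getD hp' hi (const 0)))

theorem eliminate {n : ℕ} {cs : γ → List (Bool × List ℤ)} (h : PolyTime cs) :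
    PolyTime (fun c => EFGC.eliminate n (cs c)) :=
  append (filter (f := fun _ (q : Bool × List ℤ) => decide (q.2.getD n 0 = 0)) h
      (intEq (getD (snd (snd PolyTime.id)) (const n) (const 0)) (const 0)))
    (flatMap (f := fun c p => (EFGC.uppers n (cs c)).map fun q => EFGC.combine n p q) (lowers h)
      (map (f := fun (c : γ × (Bool × List ℤ)) q => EFGC.combine n c.2 q)
        (uppers (comp h (fst PolyTime.id)))
        (combine (snd (fst PolyTime.id)) (snd PolyTime.id))))

theorem extend {n : ℕ} {y : γ → List ℤ} {p q : γ → Bool × List ℤ} (hy : PolyTime y)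
    (hp : PolyTime p) (hq : PolyTime q) : PolyTime (fun c => EFGC.extend n (y c) (p c) (q c)) := by
  refine append (map (f := fun c i => -2 * (p c).2.getD n 0 * (q c).2.getD n 0 * (y c).getD i 0)
    (const _) ?_) (cons ?_ (const []))
  · have hp' := comp (snd hp) (fst (PolyTime.id (α := γ × ℕ)))
    have hq' := comp (snd hq) (fst (PolyTime.id (α := γ × ℕ)))
    have hy' := comp hy (fst (PolyTime.id (α := γ × ℕ)))
    exact intMul (intMul (intMul (const _) (getD hp' (const n) (const 0)))
      (getD hq' (const n) (const 0))) (getD hy' (snd PolyTime.id) (const 0))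
  · exact intAdd (intMul (intForm (snd hp) hy) (getD (snd hq) (const n) (const 0)))
      (intMul (intForm (snd hq) hy) (getD (snd hp) (const n) (const 0)))

/-- For every fixed number of unknowns, Fourier–Motzkin elimination takes polynomial time: it is a
composition of a fixed number of polynomial-time functions. -/
theorem solve (n : ℕ) : PolyTime (fun cs : List (Bool × List ℤ) => EFGC.solve n cs) := by
  induction n with
  | zero =>
    exact cond (all (f := fun _ q => EFGC.checkSat 1 q [1]) PolyTime.id
      (checkSat (snd PolyTime.id) (const [1]))) (const (Option.some [1])) (const none)
  | succ n ih =>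
    refine elim (g := fun cs y => ((EFGC.lowers (n + 1) cs).flatMap fun p =>
      (EFGC.uppers (n + 1) cs).map fun q => EFGC.extend (n + 1) y p q).find? fun z =>
        cs.all fun q => EFGC.checkSat (n + 2) q z) (ih.comp (eliminate PolyTime.id)) (const none) ?_
    refine find? (f := fun (c : List (Bool × List ℤ) × List ℤ) z =>
        c.1.all fun q => EFGC.checkSat (n + 2) q z)
      (flatMap (f := fun (c : List (Bool × List ℤ) × List ℤ) p =>
        (EFGC.uppers (n + 1) c.1).map fun q => EFGC.extend (n + 1) c.2 p q)
        (lowers (fst PolyTime.id)) (map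
          (f := fun (c : (List (Bool × List ℤ) × List ℤ) × (Bool × List ℤ)) q =>
            EFGC.extend (n + 1) c.1.2 c.2 q) (uppers (fst (fst PolyTime.id))) ?_)) ?_
    · exact extend (snd (fst (fst PolyTime.id))) (snd (fst PolyTime.id)) (snd PolyTime.id)
    · exact all (f := fun (c : (List (Bool × List ℤ) × List ℤ) × List ℤ) q =>
        EFGC.checkSat (n + 2) q c.2) (fst (fst PolyTime.id))
        (checkSat (snd PolyTime.id) (snd (fst PolyTime.id)))

end PolyTime

/-! ### The algorithm -/

/-- An edge directed away from the root: the index of the edge, its tail and its head. Lists of arcs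
and of entries are kept in the reverse order of their creation. -/
abbrev Arc : Type := ℕ × ℕ × ℕ

/-- The agents that share an edge, in their order along the arc: the first one and the list of
the others. -/
abbrev Label : Type := ℕ × List ℕ

/-- An arc together with the agents that share it. -/
abbrev Entry : Type := Arc × Label

/-- The vertex is the root `0` or the head of an arc of the list. -/
def visited (done : List Arc) (x : ℕ) : Bool :=
  decide (x = 0) || done.any fun a => decide (a.2.2 = x)

/-- The edges that lead from a visited vertex to one that is not visited yet. -/
def nextArcs (E : List (ℕ × ℕ)) (done : List Arc) : List Arc :=
  E.zipIdx.flatMap fun p =>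
    bif visited done p.1.1 && !visited done p.1.2 then [(p.2, p.1.1, p.1.2)]
    else bif visited done p.1.2 && !visited done p.1.1 then [(p.2, p.1.2, p.1.1)] else []

/-- The tree with the given edges, grown from the root edge by edge. -/
def arcs (E : List (ℕ × ℕ)) : List Arc :=
  E.foldl (fun done _ => ((nextArcs E done).head?).elim done fun a => a :: done) []

/-- The last agent along an arc. -/
def Label.last (l : Label) : ℕ := l.2.reverse.head?.getD l.1

/-- The agent is one of those that share the edge. -/
def Label.has (l : Label) (x : ℕ) : Bool := decide (l.1 = x) || l.2.any fun y => decide (y = x)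

/-- The agent owns the end at `v` of the arc that leads to `v`. -/
def arrives (done : List Entry) (v x : ℕ) : Bool :=
  done.any fun en => decide (en.1.2.2 = v) && decide (en.2.last = x)

/-- The agent owns the end at `v` of some arc. -/
def touches (done : List Entry) (v x : ℕ) : Bool :=
  done.any fun en => (decide (en.1.2.2 = v) && decide (en.2.last = x)) ||
    (decide (en.1.2.1 = v) && decide (en.2.1 = x))

/-- The agent owns a part of some arc. -/
def used (done : List Entry) (x : ℕ) : Bool := done.any fun en => en.2.has x

/-- The agent smaller than `c` that arrives at `v`, and `0` if there is none, as at the root. -/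
def defaultAgent (c : ℕ) (done : List Entry) (v : ℕ) : ℕ :=
  ((List.range c).find? fun x => arrives done v x).getD 0

/-- The label of an arc: the prescribed one if there is one, and otherwise the arc is given to the
agent that arrives at its tail. -/
def chooseLabel (c : ℕ) (ov : List (ℕ × Label)) (done : List Entry) (a : Arc) : Label :=
  (ov.find? fun p => decide (p.1 = a.1)).elim (defaultAgent c done a.2.1, []) fun p => p.2

/-- The label keeps the shares of all agents connected: only its first agent may own parts of
earlier arcs, and then it must own one that ends at the tail of the new arc. -/
def admissible (k : ℕ) (done : List Entry) (a : Arc) (l : Label) : Bool :=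
  (decide (l.1 < k) && l.2.all fun x => decide (x < k)) &&
    ((l.2.all fun x => !used done x) && (!used done l.1 || touches done a.2.1 l.1))

/-- The labelling of one more arc. -/
def addArc (c k : ℕ) (ov : List (ℕ × Label)) (a : Arc) (done : List Entry) :
    Option (List Entry) :=
  bif admissible k done a (chooseLabel c ov done a)
  then some ((a, chooseLabel c ov done a) :: done) else none

/-- The labelling of a list of arcs with the prescribed labels, provided that it is admissible. -/
def build (c k : ℕ) (ov : List (ℕ × Label)) (as : List Arc) : Option (List Entry) :=
  as.foldr (fun a s => s.elim none fun done => addArc c k ov a done) (some [])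

/-- All lists of length at most `n` with entries from `xs`. -/
def listsUpTo {α : Type} : ℕ → List α → List (List α)
  | 0, _ => [[]]
  | n + 1, xs => [] :: xs.flatMap fun x => (listsUpTo n xs).map fun l => x :: l

/-- All labels with distinct agents smaller than `c`. -/
def labels (c : ℕ) : List Label :=
  (List.range c).flatMap fun h => ((listsUpTo c (List.range c)).filter fun t =>
    decide (h :: t).Nodup).map fun t => (h, t)

/-- All prescriptions of labels for at most `n` edges. -/
def prescriptions (c n : ℕ) (E : List (ℕ × ℕ)) : List (List (ℕ × Label)) :=
  listsUpTo n (E.zipIdx.flatMap fun p => (labels c).map fun l => (p.2, l))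

/-- The number `1` or `0` for a truth value. -/
def indicator (b : Bool) : ℤ := bif b then 1 else 0

/-- The coefficient of unknown `i` in the length of the share of agent `b` in an edge. Unknown `0`
stands for the length of the edge, and unknown `j + 1` for the length of the share of agent `j` in
the edge where it is not the first agent; the first agent gets the rest of the edge. -/
def coeff (l : Label) (b i : ℕ) : ℤ :=
  bif decide (i = 0) then indicator (decide (l.1 = b))
  else bif l.2.any fun j => decide (j + 1 = i) then
    indicator (decide (b + 1 = i)) - indicator (decide (l.1 = b)) else 0

/-- The length of the share of agent `b` in an edge, as a linear form. -/
def shareForm (c : ℕ) (l : Label) (b : ℕ) : List ℤ := (List.range (c + 1)).map fun i => coeff l b i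

/-- All unknowns are positive, and none exceeds unknown `0`. -/
def bounds (c : ℕ) : List (Bool × List ℤ) :=
  (true, [1]) :: (List.range c).flatMap fun i =>
    [(true, (List.range (c + 1)).map fun j => indicator (decide (j = i + 1))),
      (false, (List.range (c + 1)).map fun j =>
        indicator (decide (j = 0)) - indicator (decide (j = i + 1)))]

/-- The first agents of all edges have shares of positive length, and no agent envies another when
row `a` of `W` lists the utilities of agent `a`. -/
def system (c : ℕ) (W : List (List ℤ)) (cfg : List Entry) : List (Bool × List ℤ) :=
  bounds c ++ (cfg.map (fun en => (true, shareForm c en.2 en.2.1)) ++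
    W.zipIdx.flatMap fun r => (List.range c).map fun b => (false, (List.range (c + 1)).map fun i =>
      (cfg.map fun en => r.1.getD en.1.1 0 * (coeff en.2 r.2 i - coeff en.2 b i)).sum))

/-- The utilities of one agent multiplied by the product of their denominators: every numerator is
multiplied by the denominators of the other utilities. -/
def scaleRow (r : List (ℤ × ℕ)) : List ℤ :=
  r.zipIdx.map fun p => p.1.1 *
    ((r.zipIdx.filter fun q => !decide (q.2 = p.2)).map fun q => (q.1.2 : ℤ)).prod

/-- The agents that share an edge, from the endpoint `0` of the edge to the endpoint `1`. -/
def along (en : Entry) : List ℕ :=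
  bif decide (en.1.2.1 < en.1.2.2) then en.2.1 :: en.2.2 else (en.2.1 :: en.2.2).reverse

/-- The total length, multiplied by the common denominator, of the shares before the one of `b`. -/
def startOf (c : ℕ) (y : List ℤ) (en : Entry) (b : ℕ) : ℤ :=
  (((along en).takeWhile fun x => !decide (x = b)).map fun x =>
    intForm (c + 1) (shareForm c en.2 x) y).sum

/-- The end of the share of `b`, multiplied by the common denominator. -/
def stopOf (c : ℕ) (y : List ℤ) (en : Entry) (b : ℕ) : ℤ :=
  startOf c y en b + intForm (c + 1) (shareForm c en.2 b) y

/-- The description of the share of agent `b` in an edge: the edge, the endpoints of the interval as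
fractions, and whether they belong to the interval. All intervals contain their left endpoint, and
those that end at `1` their right one. -/
def share (c : ℕ) (y : List ℤ) (en : Entry) (b : ℕ) :
    ℕ × ((ℤ × ℤ) × (ℤ × ℤ)) × (Bool × Bool) :=
  (en.1.1, ((startOf c y en b, y.getD 0 0), (stopOf c y en b, y.getD 0 0)),
    (true, decide (stopOf c y en b = y.getD 0 0)))

/-- The shares of all agents. -/
def output (c : ℕ) (W : List (List ℤ)) (cfg : List Entry) (y : List ℤ) :
    List (List (ℕ × ((ℤ × ℤ) × (ℤ × ℤ)) × (Bool × Bool))) :=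
  W.zipIdx.map fun r => (cfg.filter fun en => en.2.has r.2).map fun en => share c y en r.2

/-- The algorithm for at most `c` agents: all labellings that deviate from the default at no more
than `n` edges are tried, and for each of them the lengths are found by Fourier–Motzkin elimination.
The input lists the number of vertices, the edges and the utilities as fractions. -/
def solveInstance (c n : ℕ) (inp : ℕ × List (ℕ × ℕ) × List (List (ℤ × ℕ))) :
    Option (List (List (ℕ × ((ℤ × ℤ) × (ℤ × ℤ)) × (Bool × Bool)))) :=
  ((prescriptions c n inp.2.1).flatMap fun ov =>
    (build c inp.2.2.length ov (arcs inp.2.1)).elim [] fun cfg =>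
      (solve c (system c (inp.2.2.map scaleRow) cfg)).elim [] fun y =>
        [output c (inp.2.2.map scaleRow) cfg y]).head?

namespace PolyTime
variable {γ α : Type} [Code γ] [Code α]

theorem visited {d : γ → List Arc} {x : γ → ℕ} (hd : PolyTime d) (hx : PolyTime x) :
    PolyTime (fun c => EFGC.visited (d c) (x c)) :=
  or (natEq hx (const 0)) (any (f := fun c (a : Arc) => decide (a.2.2 = x c)) hd
    (natEq (snd (snd (snd PolyTime.id))) (comp hx (fst PolyTime.id))))

theorem nextArcs {E : γ → List (ℕ × ℕ)} {d : γ → List Arc} (hE : PolyTime E) (hd : PolyTime d) :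
    PolyTime (fun c => EFGC.nextArcs (E c) (d c)) := by
  refine flatMap (f := fun c (p : (ℕ × ℕ) × ℕ) =>
    bif EFGC.visited (d c) p.1.1 && !EFGC.visited (d c) p.1.2 then [(p.2, p.1.1, p.1.2)]
    else bif EFGC.visited (d c) p.1.2 && !EFGC.visited (d c) p.1.1 then [(p.2, p.1.2, p.1.1)]
    else []) hE.zipIdx ?_
  have hd' := comp hd (fst (PolyTime.id (α := γ × ((ℕ × ℕ) × ℕ))))
  have hp := snd (PolyTime.id (α := γ × ((ℕ × ℕ) × ℕ)))
  have h1 := visited hd' (fst (fst hp))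
  have h2 := visited hd' (snd (fst hp))
  exact cond (and h1 (not h2)) (cons (pair (snd hp) (fst hp)) (const []))
    (cond (and h2 (not h1)) (cons (pair (snd hp) (pair (snd (fst hp)) (fst (fst hp)))) (const []))
      (const []))

theorem arcs : PolyTime EFGC.arcs := by
  obtain ⟨T, hT⟩ := (PolyTime.id (α := List (ℕ × ℕ))).zipIdx.exists_len_le
  refine foldl (g := fun E done _ => ((EFGC.nextArcs E done).head?).elim done fun a => a :: done)
    (elim (g := fun (p : (List (ℕ × ℕ) × List Arc) × (ℕ × ℕ)) (a : Arc) => a :: p.1.2)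
      (head? (nextArcs (fst (fst PolyTime.id)) (snd (fst PolyTime.id))))
      (snd (fst PolyTime.id)) (cons (snd PolyTime.id) (snd (fst (fst PolyTime.id)))))
    (const []) PolyTime.id (T + 1) fun E d x => ?_
  cases h : (EFGC.nextArcs E d).head? with
  | none => simp
  | some a =>
    have ha : a ∈ EFGC.nextArcs E d := List.mem_of_mem_head? h
    obtain ⟨p, hp, hap⟩ := List.mem_flatMap.1 ha
    have h1 : len a = len p := by
      have e1 := len_prod p.2 (p.1.1, p.1.2)
      have e2 := len_prod p.2 (p.1.2, p.1.1)
      have e3 := len_prod p.1.1 p.1.2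
      have e4 := len_prod p.1.2 p.1.1
      have e5 := len_prod p.1 p.2
      simp only [Prod.mk.eta] at *
      cases hb1 : (EFGC.visited d p.1.1 && !EFGC.visited d p.1.2) <;>
        cases hb2 : (EFGC.visited d p.1.2 && !EFGC.visited d p.1.1) <;>
        rw [hb1, hb2] at hap <;> simp at hap <;> rw [hap] <;> omega
    have h2 := (len_mem_le hp).trans (hT E)
    have h3 := eval_mono T (Nat.le_add_right (len E) (len x))
    rw [Option.elim_some, len_cons]
    simp only [Polynomial.eval_add, Polynomial.eval_one]
    omega

theorem labelLast {l : γ → Label} (hl : PolyTime l) : PolyTime (fun c => (l c).last) :=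
  optionGetD (head? (reverse (snd hl))) (fst hl)

theorem labelHas {l : γ → Label} {x : γ → ℕ} (hl : PolyTime l) (hx : PolyTime x) :
    PolyTime (fun c => (l c).has (x c)) :=
  or (natEq (fst hl) hx) (any (f := fun c y => decide (y = x c)) (snd hl)
    (natEq (snd PolyTime.id) (comp hx (fst PolyTime.id))))

theorem arrives {d : γ → List Entry} {v x : γ → ℕ} (hd : PolyTime d) (hv : PolyTime v)
    (hx : PolyTime x) : PolyTime (fun c => EFGC.arrives (d c) (v c) (x c)) :=
  any (f := fun c (en : Entry) => decide (en.1.2.2 = v c) && decide (en.2.last = x c)) hd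
    (and (natEq (snd (snd (fst (snd PolyTime.id)))) (comp hv (fst PolyTime.id)))
      (natEq (labelLast (snd (snd PolyTime.id))) (comp hx (fst PolyTime.id))))

theorem touches {d : γ → List Entry} {v x : γ → ℕ} (hd : PolyTime d) (hv : PolyTime v)
    (hx : PolyTime x) : PolyTime (fun c => EFGC.touches (d c) (v c) (x c)) :=
  any (f := fun c (en : Entry) => (decide (en.1.2.2 = v c) && decide (en.2.last = x c)) ||
      (decide (en.1.2.1 = v c) && decide (en.2.1 = x c))) hd
    (or (and (natEq (snd (snd (fst (snd PolyTime.id)))) (comp hv (fst PolyTime.id)))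
        (natEq (labelLast (snd (snd PolyTime.id))) (comp hx (fst PolyTime.id))))
      (and (natEq (fst (snd (fst (snd PolyTime.id)))) (comp hv (fst PolyTime.id)))
        (natEq (fst (snd (snd PolyTime.id))) (comp hx (fst PolyTime.id)))))

theorem used {d : γ → List Entry} {x : γ → ℕ} (hd : PolyTime d) (hx : PolyTime x) :
    PolyTime (fun c => EFGC.used (d c) (x c)) :=
  any (f := fun c (en : Entry) => en.2.has (x c)) hd
    (labelHas (snd (snd PolyTime.id)) (comp hx (fst PolyTime.id)))

theorem defaultAgent {n : ℕ} {d : γ → List Entry} {v : γ → ℕ} (hd : PolyTime d) (hv : PolyTime v) :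
    PolyTime (fun c => EFGC.defaultAgent n (d c) (v c)) :=
  optionGetD (find? (f := fun c x => EFGC.arrives (d c) (v c) x) (const _)
    (arrives (comp hd (fst PolyTime.id)) (comp hv (fst PolyTime.id)) (snd PolyTime.id))) (const 0)

theorem chooseLabel {n : ℕ} {ov : γ → List (ℕ × Label)} {d : γ → List Entry} {a : γ → Arc}
    (ho : PolyTime ov) (hd : PolyTime d) (ha : PolyTime a) :
    PolyTime (fun c => EFGC.chooseLabel n (ov c) (d c) (a c)) :=
  elim (g := fun _ (p : ℕ × Label) => p.2)
    (find? (f := fun c (p : ℕ × Label) => decide (p.1 = (a c).1)) ho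
      (natEq (fst (snd PolyTime.id)) (fst (comp ha (fst PolyTime.id)))))
    (pair (defaultAgent hd (fst (snd ha))) (const [])) (snd (snd PolyTime.id))

theorem admissible {k : γ → ℕ} {d : γ → List Entry} {a : γ → Arc} {l : γ → Label}
    (hk : PolyTime k) (hd : PolyTime d) (ha : PolyTime a) (hl : PolyTime l) :
    PolyTime (fun c => EFGC.admissible (k c) (d c) (a c) (l c)) :=
  and (and (natLt (fst hl) hk) (all (f := fun c x => decide (x < k c)) (snd hl)
      (natLt (snd PolyTime.id) (comp hk (fst PolyTime.id)))))
    (and (all (f := fun c x => !EFGC.used (d c) x) (snd hl)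
      (not (used (comp hd (fst PolyTime.id)) (snd PolyTime.id))))
      (or (not (used hd (fst hl))) (touches hd (fst (snd ha)) (fst hl))))

theorem _root_.EFGC.defaultAgent_le (c : ℕ) (d : List Entry) (v : ℕ) :
    EFGC.defaultAgent c d v ≤ c := by
  rw [EFGC.defaultAgent]
  cases h : (List.range c).find? fun x => EFGC.arrives d v x with
  | none => simp
  | some x =>
    have := List.mem_range.1 (List.mem_of_find?_eq_some h)
    simpa using this.le

theorem addArc {n : ℕ} {k : γ → ℕ} {ov : γ → List (ℕ × Label)} {a : γ → Arc} {d : γ → List Entry}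
    (hk : PolyTime k) (ho : PolyTime ov) (ha : PolyTime a) (hd : PolyTime d) :
    PolyTime (fun c => EFGC.addArc n (k c) (ov c) (a c) (d c)) :=
  cond (admissible hk hd ha (chooseLabel ho hd ha)) (some (cons (pair ha (chooseLabel ho hd ha)) hd))
    (const none)

/-- In every step of `build` the state grows by a polynomial in the sizes of the prescriptions
and of the arc. -/
theorem _root_.EFGC.len_addArc_le (n k : ℕ) (ov : List (ℕ × Label)) (a : Arc) (d : List Entry) :
    len (EFGC.addArc n k ov a d) ≤ len d + (len a + len ov + n + 15) := by
  have h1 : len (EFGC.chooseLabel n ov d a) ≤ len ov + n + 10 := by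
    rw [EFGC.chooseLabel]
    cases h : ov.find? fun q => decide (q.1 = a.1) with
    | none =>
      rw [Option.elim_none, len_prod, len_nat, len_nil]
      have h2 := defaultAgent_le n d a.2.1
      have h3 : Nat.size (EFGC.defaultAgent n d a.2.1) ≤ EFGC.defaultAgent n d a.2.1 :=
        Nat.size_le.2 Nat.lt_two_pow_self
      omega
    | some q =>
      have h2 := len_mem_le (List.mem_of_find?_eq_some h)
      have e3 := len_prod q.1 q.2
      simp only [Prod.mk.eta] at e3
      rw [Option.elim_some]
      omega
  rw [EFGC.addArc]
  cases EFGC.admissible k d a (EFGC.chooseLabel n ov d a) with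
  | false =>
    rw [cond_false, len_none]
    omega
  | true =>
    rw [cond_true, len_some, len_cons, len_prod]
    omega

theorem build {n : ℕ} {k : γ → ℕ} {ov : γ → List (ℕ × Label)} {as : γ → List Arc}
    (hk : PolyTime k) (ho : PolyTime ov) (ha : PolyTime as) :
    PolyTime (fun c => EFGC.build n (k c) (ov c) (as c)) := by
  have key : PolyTime (fun p : (ℕ × List (ℕ × Label)) × List Arc =>
      p.2.foldr (fun a s => s.elim none fun done => EFGC.addArc n p.1.1 p.1.2 a done)
        (Option.some [])) := by
    refine foldr (g := fun (p : (ℕ × List (ℕ × Label)) × List Arc) a (s : Option (List Entry)) =>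
        s.elim none fun done => EFGC.addArc n p.1.1 p.1.2 a done)
      (elim (g := fun (q : (((ℕ × List (ℕ × Label)) × List Arc) × Option (List Entry)) × Arc)
        done => EFGC.addArc n q.1.1.1.1 q.1.1.1.2 q.2 done)
        (snd (fst PolyTime.id)) (const none) ?_) (const (Option.some [])) (snd PolyTime.id)
        (.X + .C (n + 20)) ?_
    · have hq := fst (PolyTime.id (α :=
        ((((ℕ × List (ℕ × Label)) × List Arc) × Option (List Entry)) × Arc) × List Entry))
      exact addArc (fst (fst (fst (fst hq)))) (snd (fst (fst (fst hq)))) (snd hq) (snd PolyTime.id)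
    · intro p s a
      simp only [Polynomial.eval_add, Polynomial.eval_X, Polynomial.eval_C]
      cases s with
      | none =>
        rw [Option.elim_none]
        omega
      | some d =>
        have e1 := len_prod p.1 p.2
        have e2 := len_prod p.1.1 p.1.2
        simp only [Prod.mk.eta] at e1 e2
        have e3 := len_addArc_le n p.1.1 p.1.2 a d
        rw [Option.elim_some, len_some]
        omega
  exact comp (f := fun c => ((k c, ov c), as c)) key (pair (pair hk ho) ha)

/-- For lists of bounded length the enumeration is polynomial, as the bound is the depth of the
recursion. -/
theorem listsUpTo (n : ℕ) {xs : γ → List α} (h : PolyTime xs) :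
    PolyTime (fun c => EFGC.listsUpTo n (xs c)) := by
  induction n with
  | zero => exact const [[]]
  | succ n ih =>
    exact cons (const []) (flatMap (f := fun c x => (EFGC.listsUpTo n (xs c)).map fun l => x :: l) h
      (map (f := fun (p : γ × α) l => p.2 :: l) ih.onFst
        (cons (snd (fst PolyTime.id)) (snd PolyTime.id))))

/-- The list of labels does not depend on the input. -/
theorem prescriptions (c n : ℕ) {E : γ → List (ℕ × ℕ)} (h : PolyTime E) :
    PolyTime (fun x => EFGC.prescriptions c n (E x)) :=
  listsUpTo n (flatMap (f := fun _ (p : (ℕ × ℕ) × ℕ) => (labels c).map fun l => (p.2, l)) h.zipIdx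
    (map (f := fun (p : γ × ((ℕ × ℕ) × ℕ)) l => (p.2.2, l)) (const (labels c))
      (pair (snd (snd (fst PolyTime.id))) (snd PolyTime.id))))

theorem indicator {b : γ → Bool} (h : PolyTime b) : PolyTime (fun c => EFGC.indicator (b c)) :=
  cond h (const 1) (const 0)

theorem coeff {l : γ → Label} {b i : γ → ℕ} (hl : PolyTime l) (hb : PolyTime b)
    (hi : PolyTime i) : PolyTime (fun c => EFGC.coeff (l c) (b c) (i c)) :=
  cond (natEq hi (const 0)) (indicator (natEq (fst hl) hb))
    (cond (any (f := fun c j => decide (j + 1 = i c)) (snd hl)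
      (natEq (natAdd (snd PolyTime.id) (const 1)) (comp hi (fst PolyTime.id))))
      (intSub (indicator (natEq (natAdd hb (const 1)) hi)) (indicator (natEq (fst hl) hb)))
      (const 0))

theorem shareForm (n : ℕ) {l : γ → Label} {b : γ → ℕ} (hl : PolyTime l) (hb : PolyTime b) :
    PolyTime (fun c => EFGC.shareForm n (l c) (b c)) :=
  map (f := fun c i => EFGC.coeff (l c) (b c) i) (const _)
    (coeff (comp hl (fst PolyTime.id)) (comp hb (fst PolyTime.id)) (snd PolyTime.id))

theorem system (n : ℕ) {W : γ → List (List ℤ)} {cfg : γ → List Entry} (hW : PolyTime W)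
    (hc : PolyTime cfg) : PolyTime (fun c => EFGC.system n (W c) (cfg c)) := by
  refine append (const (bounds n)) (append
    (map (f := fun _ (en : Entry) => (true, EFGC.shareForm n en.2 en.2.1)) hc
      (pair (const true) (shareForm n (snd (snd PolyTime.id)) (fst (snd (snd PolyTime.id))))))
    (flatMap (f := fun x (r : List ℤ × ℕ) =>
      (List.range n).map fun b => (false, (List.range (n + 1)).map fun i =>
        ((cfg x).map fun en => r.1.getD en.1.1 0 *
          (EFGC.coeff en.2 r.2 i - EFGC.coeff en.2 b i)).sum)) hW.zipIdx
    (map (f := fun (p : γ × (List ℤ × ℕ)) b => (false, (List.range (n + 1)).map fun i =>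
        ((cfg p.1).map fun en => p.2.1.getD en.1.1 0 *
          (EFGC.coeff en.2 p.2.2 i - EFGC.coeff en.2 b i)).sum)) (const _)
      (pair (const false)
        (map (f := fun (p : (γ × (List ℤ × ℕ)) × ℕ) i =>
          ((cfg p.1.1).map fun en => p.1.2.1.getD en.1.1 0 *
            (EFGC.coeff en.2 p.1.2.2 i - EFGC.coeff en.2 p.2 i)).sum) (const _)
          (intSum (map (f := fun (p : ((γ × (List ℤ × ℕ)) × ℕ) × ℕ) (en : Entry) =>
            p.1.1.2.1.getD en.1.1 0 *
              (EFGC.coeff en.2 p.1.1.2.2 p.2 - EFGC.coeff en.2 p.1.2 p.2))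
            (comp hc (fst (fst (fst PolyTime.id)))) ?_)))))))
  have hp := fst (PolyTime.id (α := (((γ × (List ℤ × ℕ)) × ℕ) × ℕ) × Entry))
  have he := snd (PolyTime.id (α := (((γ × (List ℤ × ℕ)) × ℕ) × ℕ) × Entry))
  exact intMul (getD (fst (snd (fst (fst hp)))) (fst (fst he)) (const 0))
    (intSub (coeff (snd he) (snd (snd (fst (fst hp)))) (snd hp))
      (coeff (snd he) (snd (fst hp)) (snd hp)))

theorem scaleRow {r : γ → List (ℤ × ℕ)} (hr : PolyTime r) :
    PolyTime (fun c => EFGC.scaleRow (r c)) :=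
  map (f := fun c (p : (ℤ × ℕ) × ℕ) => p.1.1 *
    (((r c).zipIdx.filter fun q => !decide (q.2 = p.2)).map fun q => (q.1.2 : ℤ)).prod) hr.zipIdx
    (intMul (fst (fst (snd PolyTime.id))) (intProd (map (f := fun _ (q : (ℤ × ℕ) × ℕ) => (q.1.2 : ℤ))
      (filter (f := fun (c : γ × ((ℤ × ℕ) × ℕ)) (q : (ℤ × ℕ) × ℕ) => !decide (q.2 = c.2.2))
        (comp hr.zipIdx (fst PolyTime.id))
        (not (natEq (snd (snd PolyTime.id)) (snd (snd (fst PolyTime.id))))))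
      (natCast (snd (fst (snd PolyTime.id)))))))

theorem along {en : γ → Entry} (h : PolyTime en) : PolyTime (fun c => EFGC.along (en c)) :=
  cond (natLt (fst (snd (fst h))) (snd (snd (fst h)))) (cons (fst (snd h)) (snd (snd h)))
    (reverse (cons (fst (snd h)) (snd (snd h))))

theorem takeWhile {f : γ → α → Bool} {l : γ → List α} (hl : PolyTime l)
    (hf : PolyTime (fun p : γ × α => f p.1 p.2)) : PolyTime (fun c => (l c).takeWhile (f c)) :=
  (foldr (g := fun c a s => bif f c a then a :: s else [])
    (cond (comp₂ (g := f) hf (fst (fst PolyTime.id)) (snd PolyTime.id))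
      (cons (snd PolyTime.id) (snd (fst PolyTime.id))) (const []))
    (const []) hl (.X + 1) fun c s a => by
      simp only [Polynomial.eval_add, Polynomial.eval_X, Polynomial.eval_one]
      cases f c a with
      | true => rw [cond_true, len_cons]; omega
      | false => rw [cond_false, len_nil]; omega).congr fun c => by
        induction l c with
        | nil => rfl
        | cons a l ih => cases h : f c a <;> simp_all

theorem startOf (n : ℕ) {y : γ → List ℤ} {en : γ → Entry} {b : γ → ℕ} (hy : PolyTime y)
    (he : PolyTime en) (hb : PolyTime b) : PolyTime (fun c => EFGC.startOf n (y c) (en c) (b c)) :=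
  intSum (map (f := fun c x => EFGC.intForm (n + 1) (EFGC.shareForm n (en c).2 x) (y c))
    (takeWhile (f := fun c x => !decide (x = b c)) (along he)
      (not (natEq (snd PolyTime.id) (comp hb (fst PolyTime.id)))))
    (intForm (shareForm n (snd (comp he (fst PolyTime.id))) (snd PolyTime.id))
      (comp hy (fst PolyTime.id))))

theorem stopOf (n : ℕ) {y : γ → List ℤ} {en : γ → Entry} {b : γ → ℕ} (hy : PolyTime y)
    (he : PolyTime en) (hb : PolyTime b) : PolyTime (fun c => EFGC.stopOf n (y c) (en c) (b c)) :=
  intAdd (startOf n hy he hb) (intForm (shareForm n (snd he) hb) hy)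

theorem share (n : ℕ) {y : γ → List ℤ} {en : γ → Entry} {b : γ → ℕ} (hy : PolyTime y)
    (he : PolyTime en) (hb : PolyTime b) : PolyTime (fun c => EFGC.share n (y c) (en c) (b c)) := by
  have hD := getD hy (const 0) (const (0 : ℤ))
  have hs := stopOf n hy he hb
  exact pair (fst (fst he)) (pair (pair (pair (startOf n hy he hb) hD) (pair hs hD))
    (pair (const true) (intEq hs hD)))

theorem output (n : ℕ) {W : γ → List (List ℤ)} {cfg : γ → List Entry} {y : γ → List ℤ}
    (hW : PolyTime W) (hc : PolyTime cfg) (hy : PolyTime y) :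
    PolyTime (fun c => EFGC.output n (W c) (cfg c) (y c)) := by
  refine map (f := fun c (r : List ℤ × ℕ) =>
    ((cfg c).filter fun en => en.2.has r.2).map fun en => EFGC.share n (y c) en r.2) hW.zipIdx
    (map (f := fun (c : γ × (List ℤ × ℕ)) en => EFGC.share n (y c.1) en c.2.2)
      (filter (f := fun (c : γ × (List ℤ × ℕ)) (en : Entry) => en.2.has c.2.2)
        (comp hc (fst PolyTime.id))
        (labelHas (snd (snd PolyTime.id)) (snd (snd (fst PolyTime.id))))) ?_)
  exact share n (comp hy (fst (fst PolyTime.id))) (snd PolyTime.id) (snd (snd (fst PolyTime.id)))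

theorem solveInstance (c n : ℕ) : PolyTime (EFGC.solveInstance c n) := by
  let γ := ℕ × List (ℕ × ℕ) × List (List (ℤ × ℕ))
  have hW : PolyTime (fun inp : γ => inp.2.2.map EFGC.scaleRow) :=
    map (f := fun _ r => EFGC.scaleRow r) (snd (snd PolyTime.id)) (scaleRow (snd PolyTime.id))
  have hA : PolyTime (fun inp : γ => EFGC.arcs inp.2.1) := comp arcs (fst (snd PolyTime.id))
  refine head? (flatMap (f := fun (inp : γ) ov =>
    (EFGC.build c inp.2.2.length ov (EFGC.arcs inp.2.1)).elim [] fun cfg =>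
      (EFGC.solve c (EFGC.system c (inp.2.2.map EFGC.scaleRow) cfg)).elim [] fun y =>
        [EFGC.output c (inp.2.2.map EFGC.scaleRow) cfg y])
    (prescriptions c n (fst (snd PolyTime.id)))
    (elim (g := fun (p : γ × List (ℕ × Label)) cfg =>
      (EFGC.solve c (EFGC.system c (p.1.2.2.map EFGC.scaleRow) cfg)).elim [] fun y =>
        [EFGC.output c (p.1.2.2.map EFGC.scaleRow) cfg y])
      (build (length (snd (snd (fst PolyTime.id)))) (snd PolyTime.id) hA.onFst)
      (const [])
      (elim (g := fun (p : (γ × List (ℕ × Label)) × List Entry) y =>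
        [EFGC.output c (p.1.1.2.2.map EFGC.scaleRow) p.2 y])
        (comp (solve c) (system c hW.onFst.onFst (snd PolyTime.id)))
        (const [])
        (cons (output c hW.onFst.onFst.onFst (snd (fst PolyTime.id))
          (snd PolyTime.id)) (const [])))))

end PolyTime

/-! ### Growing the tree -/

/-- Every arc of the list leads from a vertex that was visited before to one that was not. -/
def Grown : List Arc → Prop
  | [] => True
  | a :: rest => Grown rest ∧ visited rest a.2.1 = true ∧ visited rest a.2.2 = false

theorem visited_cons {a : Arc} {rest : List Arc} {x : ℕ} :
    visited (a :: rest) x = true ↔ a.2.2 = x ∨ visited rest x = true := by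
  simp only [visited, List.any_cons, Bool.or_eq_true, decide_eq_true_eq]
  tauto

theorem Grown.visited_of_mem {as : List Arc} (h : Grown as) {a : Arc} (ha : a ∈ as) :
    visited as a.2.1 = true ∧ visited as a.2.2 = true := by
  induction as with
  | nil => simp at ha
  | cons b rest ih =>
    rw [visited_cons, visited_cons]
    rcases List.mem_cons.1 ha with rfl | ha
    · exact ⟨.inr h.2.1, .inl rfl⟩
    · exact ⟨.inr (ih h.1 ha).1, .inr (ih h.1 ha).2⟩

namespace Instance
variable (I : Instance)

/-- The edges of an instance as a list of pairs of numbers. -/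
def edgeList : List (ℕ × ℕ) := List.ofFn fun e => (((I.ends e).1 : ℕ), ((I.ends e).2 : ℕ))

/-- The utilities of an instance as lists of numerators and denominators. -/
def utilityList : List (List (ℤ × ℕ)) :=
  List.ofFn fun a => List.ofFn fun e => ((I.utility a e).num, (I.utility a e).den)

theorem enc_input : enc (I.vertices, I.edgeList, I.utilityList) = I.encode := by
  simp only [enc, encode, edgeList, utilityList, List.map_ofFn, Function.comp_def]

/-- The arc is an edge of the instance in one of its two directions. -/
def IsArc (a : Arc) : Prop :=
  ∃ e : Fin I.edges, a.1 = e ∧ ((a.2.1 = (I.ends e).1 ∧ a.2.2 = (I.ends e).2) ∨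
    (a.2.1 = (I.ends e).2 ∧ a.2.2 = (I.ends e).1))

variable {I}

theorem IsArc.lt_edges {a : Arc} (h : I.IsArc a) : a.1 < I.edges := by
  obtain ⟨e, he, -⟩ := h
  exact he ▸ e.2

theorem nodup_of_grown {as : List Arc} (hg : Grown as) (ha : ∀ a ∈ as, I.IsArc a) :
    (as.map fun a => a.1).Nodup := by
  induction as with
  | nil => simp
  | cons a rest ih =>
    rw [List.map_cons, List.nodup_cons]
    refine ⟨fun h => ?_, ih hg.1 fun b hb => ha b (List.mem_cons_of_mem _ hb)⟩
    obtain ⟨b, hb, hab⟩ := List.mem_map.1 h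
    obtain ⟨e, he, h1⟩ := ha a (by simp)
    obtain ⟨f, hf, h2⟩ := ha b (List.mem_cons_of_mem _ hb)
    have : e = f := Fin.ext (by rw [← he, ← hf, hab])
    subst this
    have hv := hg.1.visited_of_mem hb
    have hw := hg.2.2
    have : a.2.2 = b.2.1 ∨ a.2.2 = b.2.2 := by omega
    rcases this with h | h <;> simp_all

theorem mem_nextArcs {d : List Arc} {a : Arc} (h : a ∈ nextArcs I.edgeList d) :
    I.IsArc a ∧ visited d a.2.1 = true ∧ visited d a.2.2 = false := by
  obtain ⟨p, hp, hap⟩ := List.mem_flatMap.1 h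
  obtain ⟨h1, h2⟩ := List.mem_zipIdx' hp
  simp only [edgeList, List.length_ofFn] at h1
  simp only [edgeList, List.getElem_ofFn] at h2
  cases hb1 : (visited d p.1.1 && !visited d p.1.2) with
  | true =>
    rw [hb1] at hap
    simp only [cond_true, List.mem_singleton] at hap
    subst hap
    refine ⟨⟨⟨p.2, h1⟩, rfl, .inl ⟨?_, ?_⟩⟩, ?_⟩
    · simp [h2]
    · simp [h2]
    · simpa using hb1
  | false =>
    rw [hb1] at hap
    cases hb2 : (visited d p.1.2 && !visited d p.1.1) with
    | true =>
      rw [hb2] at hap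
      simp only [cond_true, cond_false, List.mem_singleton] at hap
      subst hap
      refine ⟨⟨⟨p.2, h1⟩, rfl, .inr ⟨?_, ?_⟩⟩, ?_⟩
      · simp [h2]
      · simp [h2]
      · simpa using hb2
    | false =>
      rw [hb2] at hap
      simp at hap

theorem nextArcs_ne_nil (hI : I.graph.Connected) {d : List Arc} (hd : d.length + 1 < I.vertices) :
    nextArcs I.edgeList d ≠ [] := by
  let S : Set (Fin I.vertices) := {x | visited d x = true}
  obtain ⟨x, hx⟩ : ∃ x : Fin I.vertices, visited d x = false := by
    by_contra! hall
    have h1 : Finset.range I.vertices ⊆ insert 0 (d.map fun a => a.2.2).toFinset := fun x hx => by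
      have := hall ⟨x, Finset.mem_range.1 hx⟩
      simp only [visited, ne_eq, Bool.not_eq_false, Bool.or_eq_true, decide_eq_true_eq,
        List.any_eq_true] at this
      simpa using this
    have h2 := Finset.card_le_card h1
    have h3 := Finset.card_insert_le 0 (d.map fun a => a.2.2).toFinset
    have h4 := List.toFinset_card_le (d.map fun a => a.2.2)
    rw [Finset.card_range] at h2
    rw [List.length_map] at h4
    omega
  -- A path from the root to the unvisited vertex leaves the set of visited vertices somewhere.
  obtain ⟨p⟩ := hI.preconnected ⟨0, by omega⟩ x
  obtain ⟨b, -, hb1, hb2⟩ := p.exists_boundary_dart S (by simp [S, visited]) (by simp [S, hx])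
  obtain ⟨e, he⟩ := b.adj
  have hmem : ((((I.ends e).1 : ℕ), ((I.ends e).2 : ℕ)), (e : ℕ)) ∈ I.edgeList.zipIdx := by
    rw [List.mem_zipIdx_iff_getElem?]
    simp [edgeList]
  have hb1 : visited d b.fst = true := hb1
  have hb2 : visited d b.snd = false := by simpa [S] using hb2
  refine List.ne_nil_of_mem (a := ((e : ℕ), (b.fst : ℕ), (b.snd : ℕ)))
    (List.mem_flatMap.2 ⟨_, hmem, ?_⟩)
  rcases he with he | he <;> rw [he] <;> simp [hb1, hb2]

theorem card_edges (hI : I.graph.IsTree) : I.edges + 1 = I.vertices := by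
  classical
  have h := hI.card_edgeFinset
  rw [Fintype.card_fin] at h
  rw [← h]
  congr 1
  have hinj : Function.Injective fun e => s((I.ends e).1, (I.ends e).2) := by
    intro e f hef
    have h1 := I.ends_lt e
    have h2 := I.ends_lt f
    rcases Sym2.eq_iff.1 hef with ⟨h, h'⟩ | ⟨h, h'⟩
    · exact I.ends_injective (Prod.ext h h')
    · rw [h, h'] at h1
      exact absurd h1 h2.asymm
  rw [← Fintype.card_fin I.edges, ← Finset.card_univ, ← Finset.card_image_of_injective _ hinj]
  congr 1
  ext z
  rw [SimpleGraph.mem_edgeFinset]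
  induction z with
  | h u v =>
    rw [SimpleGraph.mem_edgeSet]
    simp only [Finset.mem_image, Finset.mem_univ, true_and]
    refine exists_congr fun e => ?_
    rw [Sym2.eq_iff, Prod.ext_iff, Prod.ext_iff]

/-- In a tree the growing process reaches all edges. -/
theorem arcs_spec (hI : I.graph.IsTree) : Grown (arcs I.edgeList) ∧
    (∀ a ∈ arcs I.edgeList, I.IsArc a) ∧ ∀ e : Fin I.edges, ∃ a ∈ arcs I.edgeList, a.1 = e := by
  have key : ∀ (l : List (ℕ × ℕ)) (d : List Arc), Grown d → (∀ a ∈ d, I.IsArc a) →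
      d.length + l.length + 1 ≤ I.vertices →
      let d' := l.foldl (fun done _ =>
        ((nextArcs I.edgeList done).head?).elim done fun a => a :: done) d
      Grown d' ∧ (∀ a ∈ d', I.IsArc a) ∧ d'.length = d.length + l.length := by
    intro l
    induction l with
    | nil => intro d h1 h2 _; exact ⟨h1, h2, rfl⟩
    | cons x l ih =>
      intro d h1 h2 h3
      rw [List.length_cons] at h3
      -- Every round finds a new arc as long as the tree is not complete.
      have hne := nextArcs_ne_nil (d := d) hI.connected (by omega)
      obtain ⟨a, ha⟩ := Option.ne_none_iff_exists'.1 (mt List.head?_eq_none_iff.1 hne)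
      obtain ⟨h4, h5⟩ := mem_nextArcs (List.mem_of_mem_head? ha)
      have := ih (a :: d) ⟨h1, h5⟩ (List.forall_mem_cons.2 ⟨h4, h2⟩) (by rw [List.length_cons]; omega)
      simp only [List.foldl_cons, ha, Option.elim_some, List.length_cons] at this ⊢
      exact ⟨this.1, this.2.1, by omega⟩
  have hc := card_edges hI
  have hlen : I.edgeList.length = I.edges := List.length_ofFn
  obtain ⟨h1, h2, h3⟩ := key I.edgeList [] trivial (by simp) (by simp [hlen]; omega)
  rw [← arcs] at h1 h2 h3
  refine ⟨h1, h2, fun e => ?_⟩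
  have hn := nodup_of_grown h1 h2
  have hsub : ((arcs I.edgeList).map fun a => a.1).toFinset ⊆ Finset.range I.edges := fun i hi => by
    obtain ⟨a, ha, rfl⟩ := List.mem_map.1 (List.mem_toFinset.1 hi)
    exact Finset.mem_range.2 (h2 a ha).lt_edges
  -- The arcs have different indices, and there are as many arcs as edges.
  have heq := Finset.eq_of_subset_of_card_le hsub (by
    rw [Finset.card_range, List.toFinset_card_of_nodup hn, List.length_map, h3, hlen]
    simp)
  have : (e : ℕ) ∈ ((arcs I.edgeList).map fun a => a.1).toFinset := by
    rw [heq]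
    exact Finset.mem_range.2 e.2
  obtain ⟨a, ha, h⟩ := List.mem_map.1 (List.mem_toFinset.1 this)
  exact ⟨a, ha, h⟩

end Instance

/-! ### Labelled trees -/

/-- The label lists distinct agents. -/
def Label.Nodup (l : Label) : Prop := (l.1 :: l.2).Nodup

theorem Label.has_iff {l : Label} {x : ℕ} : l.has x = true ↔ x ∈ l.1 :: l.2 := by
  rw [Label.has, Bool.or_eq_true, decide_eq_true_eq, List.any_eq_true, List.mem_cons, eq_comm]
  simp

theorem Label.last_eq (l : Label) : l.last = (l.1 :: l.2).getLast (by simp) := by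
  rw [Label.last, List.head?_reverse]
  cases l.2 using List.reverseRecOn <;> simp

theorem Label.last_mem (l : Label) : l.last ∈ l.1 :: l.2 := by
  rw [Label.last_eq]; exact List.getLast_mem _

/-- Every label is admissible with respect to the earlier entries. -/
def Valid (k : ℕ) : List Entry → Prop
  | [] => True
  | en :: done => Valid k done ∧ en.2.Nodup ∧ admissible k done en.1 en.2 = true

theorem used_iff {done : List Entry} {x : ℕ} :
    used done x = true ↔ ∃ en ∈ done, x ∈ en.2.1 :: en.2.2 := by
  simp only [used, List.any_eq_true, Label.has_iff]

theorem touches_iff {done : List Entry} {v x : ℕ} : touches done v x = true ↔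
    ∃ en ∈ done, (en.1.2.2 = v ∧ en.2.last = x) ∨ (en.1.2.1 = v ∧ en.2.1 = x) := by
  simp [touches]

theorem arrives_iff {done : List Entry} {v x : ℕ} : arrives done v x = true ↔
    ∃ en ∈ done, en.1.2.2 = v ∧ en.2.last = x := by
  simp [arrives]

theorem admissible_iff {k : ℕ} {done : List Entry} {a : Arc} {l : Label} :
    admissible k done a l = true ↔ (∀ x ∈ l.1 :: l.2, x < k) ∧ (∀ x ∈ l.2, used done x = false) ∧
      (used done l.1 = true → touches done a.2.1 l.1 = true) := by
  simp only [admissible, Bool.and_eq_true, decide_eq_true_eq, List.all_eq_true, Bool.not_eq_true',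
    Bool.or_eq_true, List.forall_mem_cons]
  cases used done l.1 <;> simp

theorem Valid.lt {k : ℕ} {cfg : List Entry} (h : Valid k cfg) {en : Entry} (hen : en ∈ cfg) {x : ℕ}
    (hx : x ∈ en.2.1 :: en.2.2) : x < k := by
  induction cfg with
  | nil => simp at hen
  | cons b done ih =>
    rcases List.mem_cons.1 hen with rfl | hen
    · exact (admissible_iff.1 h.2.2).1 x hx
    · exact ih h.1 hen

theorem Valid.nodup {k : ℕ} {cfg : List Entry} (h : Valid k cfg) {en : Entry} (hen : en ∈ cfg) :
    en.2.Nodup := by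
  induction cfg with
  | nil => simp at hen
  | cons b done ih =>
    rcases List.mem_cons.1 hen with rfl | hen
    · exact h.2.1
    · exact ih h.1 hen

theorem build_cons (c k : ℕ) (ov : List (ℕ × Label)) (a : Arc) (as : List Arc) :
    build c k ov (a :: as) = (build c k ov as).elim none fun done => addArc c k ov a done := rfl

theorem valid_of_build {c k : ℕ} {ov : List (ℕ × Label)} (hov : ∀ p ∈ ov, p.2.Nodup)
    {as : List Arc} {cfg : List Entry} (h : build c k ov as = some cfg) :
    Valid k cfg ∧ cfg.map (fun en => en.1) = as := by
  induction as generalizing cfg with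
  | nil =>
    cases h
    exact ⟨trivial, rfl⟩
  | cons a as ih =>
    rw [build_cons] at h
    cases hb : build c k ov as with
    | none => rw [hb] at h; cases h
    | some done =>
      rw [hb, Option.elim_some, addArc] at h
      obtain ⟨h1, h2⟩ := ih hb
      cases hadm : admissible k done a (chooseLabel c ov done a) with
      | false => rw [hadm] at h; cases h
      | true =>
        rw [hadm] at h
        cases h
        refine ⟨⟨h1, ?_, hadm⟩, by rw [List.map_cons, h2]⟩
        show Label.Nodup (chooseLabel c ov done a)
        rw [chooseLabel]
        cases hf : ov.find? fun p => decide (p.1 = a.1) with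
        | none => simp [Label.Nodup]
        | some p => exact hov p (List.mem_of_find?_eq_some hf)

/-! ### The lengths of the shares -/

theorem getD_map_range {n i : ℕ} (hi : i < n) (f : ℕ → ℤ) :
    ((List.range n).map f).getD i 0 = f i := by
  simp [List.getD_eq_getElem?_getD, hi]

theorem linForm_map_range (n : ℕ) (f : ℕ → ℤ) (y : ℕ → ℝ) :
    linForm n ((List.range n).map f) y = ∑ i ∈ Finset.range n, (f i : ℝ) * y i :=
  Finset.sum_congr rfl fun i hi => by rw [getD_map_range (Finset.mem_range.1 hi)]

/-- The length of the share of agent `b` in an edge with the given label. -/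
def shareLen (c : ℕ) (y : ℕ → ℝ) (l : Label) (b : ℕ) : ℝ := linForm (c + 1) (shareForm c l b) y

theorem shareLen_eq (c : ℕ) (y : ℕ → ℝ) (l : Label) (b : ℕ) : shareLen c y l b =
    (∑ i ∈ Finset.range c, if i ∈ l.2 then
      ((if b = i then 1 else 0) - (if l.1 = b then 1 else 0)) * y (i + 1) else 0) +
      (if l.1 = b then y 0 else 0) := by
  rw [shareLen, shareForm, linForm_map_range, Finset.sum_range_succ']
  congr 1
  · refine Finset.sum_congr rfl fun i _ => ?_
    have : (l.2.any fun j => decide (j + 1 = i + 1)) = decide (i ∈ l.2) := by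
      rw [Bool.eq_iff_iff]; simp
    rw [coeff, this]
    by_cases h : i ∈ l.2 <;> by_cases h1 : b = i <;> by_cases h2 : l.1 = b <;>
      simp_all [indicator]
  · by_cases h : l.1 = b <;> simp [coeff, indicator, h]

theorem shareLen_rest {c : ℕ} {y : ℕ → ℝ} {l : Label} {b : ℕ} (hl : l.Nodup) (hb : b ∈ l.2)
    (hc : b < c) : shareLen c y l b = y (b + 1) := by
  have h1 : l.1 ≠ b := fun h => (List.nodup_cons.1 hl).1 (h ▸ hb)
  simp only [shareLen_eq, if_neg h1, add_zero]
  rw [Finset.sum_eq_single b]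
  · simp [hb]
  · intro i _ hi
    simp [hi.symm]
  · intro h
    exact absurd (Finset.mem_range.2 hc) h

theorem shareLen_of_notMem {c : ℕ} {y : ℕ → ℝ} {l : Label} {b : ℕ} (hb : b ∉ l.1 :: l.2) :
    shareLen c y l b = 0 := by
  rw [List.mem_cons, not_or] at hb
  simp only [shareLen_eq, if_neg (Ne.symm hb.1), add_zero]
  refine Finset.sum_eq_zero fun i _ => ?_
  split_ifs with h1 h2
  · exact absurd (h2 ▸ h1) hb.2
  · simp
  · rfl

theorem shareLen_first {c : ℕ} {y : ℕ → ℝ} {l : Label} (hl : l.Nodup) (hc : ∀ x ∈ l.2, x < c) :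
    shareLen c y l l.1 = y 0 - (l.2.map fun i => y (i + 1)).sum := by
  obtain ⟨h1, h2⟩ := List.nodup_cons.1 hl
  simp only [shareLen_eq, if_true]
  rw [← List.sum_toFinset (fun i => y (i + 1)) h2, ← Finset.sum_filter,
    add_comm, sub_eq_add_neg, ← Finset.sum_neg_distrib]
  congr 1
  apply Finset.sum_congr
  · ext i
    simp only [Finset.mem_filter, Finset.mem_range, List.mem_toFinset]
    exact ⟨fun h => h.2, fun h => ⟨hc i h, h⟩⟩
  · intro i hi
    have : l.1 ≠ i := fun h => h1 (h ▸ List.mem_toFinset.1 hi)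
    simp [this]

/-- The shares fill the edge. -/
theorem sum_shareLen {c : ℕ} {y : ℕ → ℝ} {l : Label} (hl : l.Nodup) (hc : ∀ x ∈ l.1 :: l.2, x < c) :
    ((l.1 :: l.2).map fun b => shareLen c y l b).sum = y 0 := by
  rw [List.map_cons, List.sum_cons,
    shareLen_first hl fun x hx => hc x (List.mem_cons_of_mem _ hx)]
  have : (l.2.map fun b => shareLen c y l b) = l.2.map fun i => y (i + 1) :=
    List.map_congr_left fun b hb => shareLen_rest hl hb (hc b (List.mem_cons_of_mem _ hb))
  rw [this]
  ring

theorem linForm_envy (c : ℕ) (r : List ℤ) (cfg : List Entry) (a b : ℕ) (y : ℕ → ℝ) :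
    linForm (c + 1) ((List.range (c + 1)).map fun i =>
      (cfg.map fun en => r.getD en.1.1 0 * (coeff en.2 a i - coeff en.2 b i)).sum) y =
    (cfg.map fun en => (r.getD en.1.1 0 : ℝ) *
      (shareLen c y en.2 a - shareLen c y en.2 b)).sum := by
  rw [linForm_map_range]
  induction cfg with
  | nil => simp
  | cons en cfg ih =>
    simp only [List.map_cons, List.sum_cons, Int.cast_add, add_mul, Finset.sum_add_distrib, ih]
    congr 1
    rw [shareLen, shareLen, shareForm, shareForm, linForm_map_range, linForm_map_range,
      ← Finset.sum_sub_distrib, Finset.mul_sum]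
    refine Finset.sum_congr rfl fun i _ => ?_
    push_cast
    ring

theorem sum_indicator {c m : ℕ} (hm : m < c + 1) (y : ℕ → ℝ) :
    ∑ j ∈ Finset.range (c + 1), (indicator (decide (j = m)) : ℝ) * y j = y m := by
  rw [Finset.sum_eq_single m]
  · simp [indicator]
  · intro j _ hj
    simp [indicator, hj]
  · intro h
    exact absurd (Finset.mem_range.2 hm) h

/-- The meaning of the system of inequalities. -/
theorem sat_system_iff {c : ℕ} {W : List (List ℤ)} {cfg : List Entry} {y : ℕ → ℝ} :
    (∀ q ∈ system c W cfg, Sat (c + 1) q y) ↔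
      0 < y 0 ∧ (∀ i < c, 0 < y (i + 1) ∧ y (i + 1) ≤ y 0) ∧
      (∀ en ∈ cfg, 0 < shareLen c y en.2 en.2.1) ∧
      ∀ a b, a < W.length → b < c → 0 ≤ (cfg.map fun en => ((W.getD a []).getD en.1.1 0 : ℝ) *
        (shareLen c y en.2 a - shareLen c y en.2 b)).sum := by
  have e0 : linForm (c + 1) [1] y = y 0 := by
    rw [linForm, Finset.sum_range_succ']
    simp
  have e1 : ∀ i < c, linForm (c + 1)
      ((List.range (c + 1)).map fun j => indicator (decide (j = i + 1))) y = y (i + 1) :=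
    fun i hi => by rw [linForm_map_range, sum_indicator (by omega)]
  have e2 : ∀ i < c, linForm (c + 1) ((List.range (c + 1)).map fun j =>
      indicator (decide (j = 0)) - indicator (decide (j = i + 1))) y = y 0 - y (i + 1) :=
    fun i hi => by
      rw [linForm_map_range]
      simp only [Int.cast_sub, sub_mul, Finset.sum_sub_distrib]
      rw [sum_indicator (by omega), sum_indicator (by omega)]
  have hbounds : (∀ q ∈ bounds c, Sat (c + 1) q y) ↔
      0 < y 0 ∧ ∀ i < c, 0 < y (i + 1) ∧ y (i + 1) ≤ y 0 := by
    simp only [bounds, List.forall_mem_cons, List.mem_flatMap, List.mem_range]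
    refine and_congr ?_ ⟨fun h i hi => ?_, ?_⟩
    · rw [Sat, e0]
      exact ⟨fun h => h.1 rfl, fun h => ⟨fun _ => h, h.le⟩⟩
    · have h1 := h _ ⟨i, hi, List.mem_cons_self⟩
      have h2 := h _ ⟨i, hi, List.mem_cons_of_mem _ List.mem_cons_self⟩
      rw [Sat, e1 i hi] at h1
      rw [Sat, e2 i hi] at h2
      exact ⟨h1.1 rfl, sub_nonneg.1 h2.2⟩
    · rintro h q ⟨i, hi, hq⟩
      rcases List.mem_cons.1 hq with rfl | hq
      · rw [Sat, e1 i hi]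
        exact ⟨fun _ => (h i hi).1, (h i hi).1.le⟩
      · rw [List.mem_singleton.1 hq, Sat, e2 i hi]
        exact ⟨fun h => (by cases h), sub_nonneg.2 (h i hi).2⟩
  rw [system]
  simp only [List.forall_mem_append]
  rw [hbounds, and_assoc]
  refine and_congr_right fun _ => and_congr_right fun _ => and_congr ?_ ⟨fun h a b ha hb => ?_, ?_⟩
  · simp only [List.forall_mem_map]
    refine forall₂_congr fun en _ => ?_
    rw [Sat, ← shareLen]
    exact ⟨fun h => h.1 rfl, fun h => ⟨fun _ => h, h.le⟩⟩
  · have := h _ (List.mem_flatMap.2 ⟨(W.getD a [], a), by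
      rw [List.mem_zipIdx_iff_getElem?]; simp [List.getD_eq_getElem?_getD, ha],
      List.mem_map.2 ⟨b, List.mem_range.2 hb, rfl⟩⟩)
    rw [Sat, linForm_envy] at this
    exact this.2
  · intro h q hq
    obtain ⟨r, hr, hq⟩ := List.mem_flatMap.1 hq
    obtain ⟨b, hb, rfl⟩ := List.mem_map.1 hq
    obtain ⟨h1, h2⟩ := List.mem_zipIdx' hr
    have := h r.2 b h1 (List.mem_range.1 hb)
    rw [Sat, linForm_envy]
    rw [List.getD_eq_getElem _ _ h1, ← h2] at this
    exact ⟨fun h => (by cases h), this⟩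

/-- The bounds of the system allow elimination of all unknowns but the first. -/
theorem exists_solve_system {c : ℕ} {W : List (List ℤ)} {cfg : List Entry} {y : ℕ → ℝ}
    (h : ∀ q ∈ system c W cfg, Sat (c + 1) q y) : ∃ z, solve c (system c W cfg) = some z := by
  refine exists_solve (sat_system_iff.1 h).1 h (fun i h1 h2 => ?_) (fun i h1 h2 => ?_)
  · refine ⟨(true, (List.range (c + 1)).map fun j => indicator (decide (j = i))),
      List.mem_append_left _ (List.mem_cons_of_mem _ (List.mem_flatMap.2
        ⟨i - 1, List.mem_range.2 (by omega), ?_⟩)), ?_, fun j hj => ?_⟩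
    · rw [Nat.sub_add_cancel h1]; simp
    · rw [getD_map_range (by omega)]; simp [indicator]
    · rcases lt_or_ge j (c + 1) with h | h
      · rw [getD_map_range h]; simp [indicator, hj.ne']
      · rw [List.getD_eq_default _ _ (by simpa using h)]
  · refine ⟨(false, (List.range (c + 1)).map fun j =>
      indicator (decide (j = 0)) - indicator (decide (j = i))),
      List.mem_append_left _ (List.mem_cons_of_mem _ (List.mem_flatMap.2
        ⟨i - 1, List.mem_range.2 (by omega), ?_⟩)), ?_, fun j hj => ?_⟩
    · rw [Nat.sub_add_cancel h1]; simp
    · rw [getD_map_range (by omega)]; simp [indicator, show i ≠ 0 by omega]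
    · rcases lt_or_ge j (c + 1) with h | h
      · rw [getD_map_range h]; simp [indicator, hj.ne', show j ≠ 0 by omega]
      · rw [List.getD_eq_default _ _ (by simpa using h)]

/-! ### Scaling the utilities -/

theorem prod_filter_zipIdx (r : List (ℤ × ℕ)) (n i : ℕ) (hi : i < r.length) :
    (((r.zipIdx n).filter fun q => !decide (q.2 = n + i)).map fun q => (q.1.2 : ℤ)).prod *
      (r[i].2 : ℤ) = (r.map fun q => (q.2 : ℤ)).prod := by
  induction r generalizing n i with
  | nil => simp at hi
  | cons a r ih =>
    cases i with
    | zero =>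
      have : (r.zipIdx (n + 1)).filter (fun q => !decide (q.2 = n)) = r.zipIdx (n + 1) := by
        refine List.filter_eq_self.2 fun q hq => ?_
        have := List.le_snd_of_mem_zipIdx hq
        simp
        omega
      simp [this, mul_comm]
      left
      have h2 : (List.map (fun q : (ℤ × ℕ) × ℕ => (q.1.2 : ℤ)) (r.zipIdx (n + 1))) =
          ((r.zipIdx (n + 1)).map Prod.fst).map fun q => (q.2 : ℤ) := by
        rw [List.map_map]
        rfl
      rw [h2, List.zipIdx_map_fst]
    | succ i =>
      have := ih (n + 1) i (by simpa using hi)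
      rw [List.map_cons, List.prod_cons, ← this, List.zipIdx_cons,
        List.filter_cons_of_pos (by simp)]
      simp only [List.map_cons, List.prod_cons, List.getElem_cons_succ, Nat.add_assoc,
        Nat.add_comm 1 i]
      ring

theorem scaleRow_getD (r : List (ℤ × ℕ)) (hr : ∀ q ∈ r, 0 < q.2) (i : ℕ) (hi : i < r.length) :
    ((scaleRow r).getD i 0 : ℝ) =
      (r[i].1 / r[i].2 : ℝ) * ((r.map fun q => (q.2 : ℤ)).prod : ℤ) := by
  have h1 : (scaleRow r).getD i 0 = r[i].1 *
      ((r.zipIdx.filter fun q => !decide (q.2 = i)).map fun q => (q.1.2 : ℤ)).prod := by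
    rw [List.getD_eq_getElem _ _ (by simpa [scaleRow] using hi)]
    simp [scaleRow]
  have h2 := prod_filter_zipIdx r 0 i hi
  have h3 : (r[i].2 : ℝ) ≠ 0 := by exact_mod_cast (hr _ (List.getElem_mem hi)).ne'
  rw [h1, ← h2]
  push_cast
  simp only [zero_add]
  field_simp

theorem prod_pos_of_den (r : List (ℤ × ℕ)) (hr : ∀ q ∈ r, 0 < q.2) :
    (0 : ℝ) < ((r.map fun q => (q.2 : ℤ)).prod : ℤ) := by
  have : (0 : ℤ) < (r.map fun q => (q.2 : ℤ)).prod := List.prod_pos fun x hx => by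
    obtain ⟨q, hq, rfl⟩ := List.mem_map.1 hx
    exact_mod_cast hr q hq
  exact_mod_cast this

/-- The integer utilities of an agent are the rational ones up to a positive factor. -/
theorem Instance.exists_scale (I : Instance) (a : Fin I.agents) : ∃ s : ℝ, 0 < s ∧ ∀ e : Fin I.edges,
    (((I.utilityList.map scaleRow).getD a []).getD e 0 : ℝ) = I.utility a e * s := by
  let r : List (ℤ × ℕ) := List.ofFn fun e => ((I.utility a e).num, (I.utility a e).den)
  have hr : ∀ q ∈ r, 0 < q.2 := fun q hq => by
    obtain ⟨e, rfl⟩ := (List.mem_ofFn' _ _).1 hq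
    exact (I.utility a e).den_pos
  have h1 : (I.utilityList.map scaleRow).getD a [] = scaleRow r := by
    rw [List.getD_eq_getElem _ _ (by simp [utilityList])]
    simp [utilityList, r]
  refine ⟨_, prod_pos_of_den r hr, fun e => ?_⟩
  rw [h1, scaleRow_getD r hr e (by simp [r])]
  congr 1
  simp only [r, List.getElem_ofFn, Fin.eta]
  exact_mod_cast congrArg (Rat.cast (K := ℝ)) (Rat.num_div_den (I.utility a e))

/-! ### Consecutive intervals -/

/-- The total length of the intervals before the one of `b`, when intervals of lengths `f` are
placed side by side in the order of the list `s`. -/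
def startIn (f : ℕ → ℝ) (s : List ℕ) (b : ℕ) : ℝ :=
  ((s.takeWhile fun x => !decide (x = b)).map f).sum

theorem startIn_cons (f : ℕ → ℝ) (x : ℕ) (s : List ℕ) (b : ℕ) :
    startIn f (x :: s) b = if x = b then 0 else f x + startIn f s b := by
  by_cases h : x = b <;> simp [startIn, h]

theorem startIn_nonneg {f : ℕ → ℝ} {s : List ℕ} (hf : ∀ x ∈ s, 0 < f x) (b : ℕ) :
    0 ≤ startIn f s b := by
  refine List.sum_nonneg fun x hx => ?_
  obtain ⟨z, hz, rfl⟩ := List.mem_map.1 hx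
  exact (hf z ((List.takeWhile_sublist _).subset hz)).le

theorem startIn_add_le {f : ℕ → ℝ} {s : List ℕ} (hf : ∀ x ∈ s, 0 < f x) {b : ℕ} (hb : b ∈ s) :
    startIn f s b + f b ≤ (s.map f).sum := by
  induction s with
  | nil => simp at hb
  | cons x s ih =>
    have hf' : ∀ x ∈ s, 0 < f x := fun z hz => hf z (List.mem_cons_of_mem _ hz)
    rw [startIn_cons, List.map_cons, List.sum_cons]
    split_ifs with h
    · subst h
      have : 0 ≤ (s.map f).sum := List.sum_nonneg fun z hz => by
        obtain ⟨w, hw, rfl⟩ := List.mem_map.1 hz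
        exact (hf' w hw).le
      linarith
    · have := ih hf' ((List.mem_cons.1 hb).resolve_left (Ne.symm h))
      linarith

theorem startIn_or {f : ℕ → ℝ} {s : List ℕ} (hf : ∀ x ∈ s, 0 < f x) {a b : ℕ} (ha : a ∈ s)
    (hb : b ∈ s) (hab : a ≠ b) :
    startIn f s a + f a ≤ startIn f s b ∨ startIn f s b + f b ≤ startIn f s a := by
  induction s with
  | nil => simp at hb
  | cons x s ih =>
    have hf' : ∀ x ∈ s, 0 < f x := fun z hz => hf z (List.mem_cons_of_mem _ hz)
    rw [startIn_cons, startIn_cons]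
    by_cases h1 : x = a
    · have h2 : x ≠ b := h1 ▸ hab
      rw [if_pos h1, if_neg h2, ← h1]
      left
      linarith [startIn_nonneg hf' b]
    · by_cases h2 : x = b
      · rw [if_pos h2, if_neg h1, ← h2]
        right
        linarith [startIn_nonneg hf' a]
      · rw [if_neg h1, if_neg h2]
        have := ih hf' ((List.mem_cons.1 ha).resolve_left (Ne.symm h1))
          ((List.mem_cons.1 hb).resolve_left (Ne.symm h2))
        exact this.imp (fun h => by linarith) fun h => by linarith

theorem startIn_getLast {f : ℕ → ℝ} {s : List ℕ} (hs : s.Nodup) (h : s ≠ []) :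
    startIn f s (s.getLast h) + f (s.getLast h) = (s.map f).sum := by
  induction s with
  | nil => exact absurd rfl h
  | cons x s ih =>
    obtain ⟨h1, h2⟩ := List.nodup_cons.1 hs
    rcases eq_or_ne s [] with rfl | hne
    · simp [startIn_cons]
    · rw [List.getLast_cons hne, startIn_cons,
        if_neg fun (e : x = s.getLast hne) => h1 (e ▸ List.getLast_mem hne), List.map_cons,
        List.sum_cons, ← ih h2 hne]
      ring

/-- The interval of `b`; it is half-open unless it is the last one. -/
def slot (f : ℕ → ℝ) (s : List ℕ) (b : ℕ) : Set ℝ :=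
  {x | startIn f s b ≤ x ∧ (x < startIn f s b + f b ∨
    (startIn f s b + f b = (s.map f).sum ∧ x = startIn f s b + f b))}

theorem exists_mem_slot {f : ℕ → ℝ} {s : List ℕ} (hn : s.Nodup) (hs : s ≠ []) {x : ℝ}
    (h0 : 0 ≤ x) (h1 : x ≤ (s.map f).sum) : ∃ b ∈ s, x ∈ slot f s b := by
  induction s generalizing x with
  | nil => exact absurd rfl hs
  | cons a s ih =>
    rw [List.map_cons, List.sum_cons] at h1
    rcases lt_or_ge x (f a) with h | h
    · exact ⟨a, by simp, by simp [startIn_cons, h0], .inl (by simpa [startIn_cons] using h)⟩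
    · rcases eq_or_ne s [] with rfl | hne
      · refine ⟨a, by simp, by simp [startIn_cons, h0], .inr ?_⟩
        simp only [List.map_nil, List.sum_nil, add_zero] at h1
        simp [startIn_cons, le_antisymm h1 h]
      · obtain ⟨b, hb, h2, h3⟩ := ih (List.nodup_cons.1 hn).2 hne (x := x - f a) (by linarith)
          (by linarith)
        have hab : a ≠ b := fun e => (List.nodup_cons.1 hn).1 (e ▸ hb)
        refine ⟨b, List.mem_cons_of_mem _ hb, ?_, ?_⟩
        · rw [startIn_cons, if_neg hab]; linarith
        · rw [startIn_cons, if_neg hab, List.map_cons, List.sum_cons]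
          exact h3.imp (fun h => by linarith) fun h => ⟨by linarith [h.1], by linarith [h.2]⟩

theorem eq_of_mem_slot {f : ℕ → ℝ} {s : List ℕ} (hf : ∀ x ∈ s, 0 < f x) {a b : ℕ} (ha : a ∈ s)
    (hb : b ∈ s) {x : ℝ} (hxa : x ∈ slot f s a) (hxb : x ∈ slot f s b) : a = b := by
  by_contra hab
  obtain ⟨a1, a2⟩ := hxa
  obtain ⟨b1, b2⟩ := hxb
  have ha' := hf a ha
  have hb' := hf b hb
  have ha2 := startIn_add_le hf ha
  have hb2 := startIn_add_le hf hb
  rcases startIn_or hf ha hb hab with h | h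
  · rcases a2 with a2 | ⟨a2, a3⟩ <;> linarith
  · rcases b2 with b2 | ⟨b2, b3⟩ <;> linarith

theorem slot_subset {f : ℕ → ℝ} {s : List ℕ} (hf : ∀ x ∈ s, 0 < f x) {b : ℕ} (hb : b ∈ s) :
    slot f s b ⊆ Set.Icc 0 (s.map f).sum := fun x hx =>
  ⟨(startIn_nonneg hf b).trans hx.1, by
    have := startIn_add_le hf hb
    rcases hx.2 with h | h
    · linarith
    · exact (h.2.trans h.1).le⟩

theorem ordConnected_slot (f : ℕ → ℝ) (s : List ℕ) (b : ℕ) : (slot f s b).OrdConnected := by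
  refine ⟨fun x hx y hy z hz => ⟨hx.1.trans hz.1, ?_⟩⟩
  rcases hy.2 with h | h
  · exact .inl (hz.2.trans_lt h)
  · rcases hz.2.eq_or_lt with h' | h'
    · exact .inr ⟨h.1, h'.trans h.2⟩
    · exact .inl (h'.trans_eq h.2)

theorem volume_slot {f : ℕ → ℝ} {s : List ℕ} {b : ℕ} (hb : 0 ≤ f b) :
    MeasureTheory.volume.real (slot f s b) = f b := by
  have h1 : MeasureTheory.volume (slot f s b) = ENNReal.ofReal (f b) := by
    refine le_antisymm ?_ ?_
    · refine (MeasureTheory.measure_mono (t := Set.Icc (startIn f s b) (startIn f s b + f b))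
        fun x hx => ⟨hx.1, ?_⟩).trans_eq (by simp)
      exact hx.2.elim le_of_lt fun h => h.2.le
    · refine Eq.trans_le (by simp) (MeasureTheory.measure_mono
        (s := Set.Ico (startIn f s b) (startIn f s b + f b)) fun x hx => ⟨hx.1, .inl hx.2⟩)
  rw [MeasureTheory.measureReal_def, h1, ENNReal.toReal_ofReal hb]

theorem zero_mem_slot {f : ℕ → ℝ} {a : ℕ} {s : List ℕ} (ha : 0 < f a) :
    0 ∈ slot f (a :: s) a := by
  simp [slot, startIn_cons, ha]

theorem sum_mem_slot {f : ℕ → ℝ} {s : List ℕ} (hs : s.Nodup) (h : s ≠ [])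
    (hf : 0 ≤ f (s.getLast h)) : (s.map f).sum ∈ slot f s (s.getLast h) := by
  have := startIn_getLast (f := f) hs h
  exact ⟨by linarith, .inr ⟨this, this.symm⟩⟩

/-! ### From a labelled tree to an assignment -/

/-- The share of agent `b` in an edge, when `y` lists the unknowns of the system of inequalities. -/
def shareSet (c : ℕ) (y : ℕ → ℝ) (en : Entry) (b : ℕ) : Set ℝ :=
  slot (fun x => shareLen c y en.2 x / y 0) (along en) b

/-- The lengths in all edges of the labelled tree are positive. -/
def Positive (c : ℕ) (y : ℕ → ℝ) (cfg : List Entry) : Prop :=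
  0 < y 0 ∧ ∀ en ∈ cfg, ∀ x ∈ en.2.1 :: en.2.2, 0 < shareLen c y en.2 x

theorem mem_along {en : Entry} {x : ℕ} : x ∈ along en ↔ x ∈ en.2.1 :: en.2.2 := by
  rw [along]
  cases decide (en.1.2.1 < en.1.2.2)
  · rw [cond_false, List.mem_reverse]
  · rw [cond_true]

theorem nodup_along {en : Entry} (h : en.2.Nodup) : (along en).Nodup := by
  rw [along]
  cases decide (en.1.2.1 < en.1.2.2)
  · rw [cond_false, List.nodup_reverse]; exact h
  · rw [cond_true]; exact h

theorem along_ne_nil (en : Entry) : along en ≠ [] :=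
  List.ne_nil_of_mem (mem_along.2 List.mem_cons_self)

section
variable {c : ℕ} {y : ℕ → ℝ} {en : Entry}

theorem sum_along (h0 : 0 < y 0) (hn : en.2.Nodup) (hc : ∀ x ∈ en.2.1 :: en.2.2, x < c) :
    ((along en).map fun x => shareLen c y en.2 x / y 0).sum = 1 := by
  have h1 : ((en.2.1 :: en.2.2).map fun x => shareLen c y en.2 x / y 0).sum = 1 := by
    simp only [div_eq_mul_inv]
    rw [List.sum_map_mul_right, sum_shareLen (y := y) hn hc, mul_inv_cancel₀ h0.ne']
  rw [← h1, along]
  cases decide (en.1.2.1 < en.1.2.2)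
  · rw [cond_false, List.map_reverse, List.sum_reverse]
  · rw [cond_true]

theorem one_mem_shareSet (h0 : 0 < y 0) (hn : en.2.Nodup) (hc : ∀ x ∈ en.2.1 :: en.2.2, x < c)
    (hp : ∀ x ∈ en.2.1 :: en.2.2, 0 < shareLen c y en.2 x) :
    (1 : ℝ) ∈ shareSet c y en ((along en).getLast (along_ne_nil en)) := by
  have := sum_mem_slot (f := fun x => shareLen c y en.2 x / y 0) (nodup_along hn) (along_ne_nil en)
    (div_pos (hp _ (mem_along.1 (List.getLast_mem _))) h0).le
  rwa [sum_along h0 hn hc] at this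

theorem zero_mem_shareSet (h0 : 0 < y 0)
    (hp : ∀ x ∈ en.2.1 :: en.2.2, 0 < shareLen c y en.2 x) :
    (0 : ℝ) ∈ shareSet c y en ((along en).head (along_ne_nil en)) := by
  have h1 : along en = (along en).head (along_ne_nil en) :: (along en).tail := by simp
  rw [shareSet]
  conv => enter [1, 2]; rw [h1]
  exact zero_mem_slot (div_pos (hp _ (mem_along.1 (List.head_mem _))) h0)

end

namespace Instance
variable {I : Instance}

/-- The first agent along an arc owns its tail. -/
theorem containsVertex_first {c : ℕ} {y : ℕ → ℝ} {en : Entry} {e : Fin I.edges} {v : Fin I.vertices}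
    (h0 : 0 < y 0) (hn : en.2.Nodup) (hc : ∀ x ∈ en.2.1 :: en.2.2, x < c)
    (hp : ∀ x ∈ en.2.1 :: en.2.2, 0 < shareLen c y en.2 x) (ha : I.IsArc en.1) (he : en.1.1 = e)
    (hv : en.1.2.1 = v) : I.ContainsVertex (e, shareSet c y en en.2.1) v := by
  obtain ⟨f, hf, h⟩ := ha
  have hef : e = f := Fin.ext (by omega)
  subst hef
  have hlt := I.ends_lt e
  rw [Fin.lt_def] at hlt
  rcases h with ⟨h1, h2⟩ | ⟨h1, h2⟩
  · left
    refine ⟨Fin.ext (by simp only []; omega), ?_⟩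
    have := zero_mem_shareSet (c := c) h0 hp
    have e1 : along en = en.2.1 :: en.2.2 := by
      rw [along, decide_eq_true (by omega)]; rfl
    simpa [e1] using this
  · right
    refine ⟨Fin.ext (by simp only []; omega), ?_⟩
    have := one_mem_shareSet (c := c) h0 hn hc hp
    have e1 : along en = (en.2.1 :: en.2.2).reverse := by
      rw [along, decide_eq_false (by omega)]; rfl
    simpa [e1] using this

/-- The last agent along an arc owns its head. -/
theorem containsVertex_last {c : ℕ} {y : ℕ → ℝ} {en : Entry} {e : Fin I.edges} {v : Fin I.vertices}
    (h0 : 0 < y 0) (hn : en.2.Nodup) (hc : ∀ x ∈ en.2.1 :: en.2.2, x < c)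
    (hp : ∀ x ∈ en.2.1 :: en.2.2, 0 < shareLen c y en.2 x) (ha : I.IsArc en.1) (he : en.1.1 = e)
    (hv : en.1.2.2 = v) : I.ContainsVertex (e, shareSet c y en en.2.last) v := by
  obtain ⟨f, hf, h⟩ := ha
  have hef : e = f := Fin.ext (by omega)
  subst hef
  have hlt := I.ends_lt e
  rw [Fin.lt_def] at hlt
  rw [Label.last_eq]
  rcases h with ⟨h1, h2⟩ | ⟨h1, h2⟩
  · right
    refine ⟨Fin.ext (by simp only []; omega), ?_⟩
    have := one_mem_shareSet (c := c) h0 hn hc hp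
    have e1 : along en = en.2.1 :: en.2.2 := by
      rw [along, decide_eq_true (by omega)]; rfl
    simpa [e1] using this
  · left
    refine ⟨Fin.ext (by simp only []; omega), ?_⟩
    have := zero_mem_shareSet (c := c) h0 hp
    have e1 : along en = (en.2.1 :: en.2.2).reverse := by
      rw [along, decide_eq_false (by omega)]; rfl
    simpa only [e1, List.head_reverse] using this

theorem adjacentPieces_comm (p q : I.EdgePiece) : I.AdjacentPieces p q ↔ I.AdjacentPieces q p :=
  and_congr ne_comm (exists_congr fun _ => and_comm)

/-- The shares of one agent are connected. -/
theorem connected_shares {c k : ℕ} {y : ℕ → ℝ} {cfg : List Entry} (hkc : k ≤ c) (hv : Valid k cfg)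
    (hp : Positive c y cfg) (ha : ∀ en ∈ cfg, I.IsArc en.1)
    (hnd : (cfg.map fun en => en.1.1).Nodup) (b : ℕ) (P : I.EdgePiece → Prop)
    (hP : ∀ p, P p ↔ ∃ en ∈ cfg, b ∈ en.2.1 :: en.2.2 ∧ en.1.1 = p.1 ∧ p.2 = shareSet c y en b)
    {p q : I.EdgePiece} (hpp : P p) (hpq : P q) :
    Relation.ReflTransGen (fun x y => P x ∧ P y ∧ I.AdjacentPieces x y) p q := by
  induction cfg generalizing P p q with
  | nil => simpa using (hP p).1 hpp
  | cons en done ih =>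
    -- The shares in the earlier edges.
    let Q : I.EdgePiece → Prop := fun p =>
      ∃ en ∈ done, b ∈ en.2.1 :: en.2.2 ∧ en.1.1 = p.1 ∧ p.2 = shareSet c y en b
    have hQP : ∀ p, Q p → P p := fun p ⟨f, hf, h⟩ => (hP p).2 ⟨f, List.mem_cons_of_mem _ hf, h⟩
    rw [List.map_cons, List.nodup_cons] at hnd
    have hp' : Positive c y done := ⟨hp.1, fun f hf => hp.2 f (List.mem_cons_of_mem _ hf)⟩
    have ih' : ∀ {p q : I.EdgePiece}, Q p → Q q →
        Relation.ReflTransGen (fun x y => P x ∧ P y ∧ I.AdjacentPieces x y) p q :=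
      fun h1 h2 => by
        refine Relation.ReflTransGen.mono ?_ _ _ (ih hv.1 hp'
          (fun f hf => ha f (List.mem_cons_of_mem _ hf)) hnd.2 Q (fun _ => Iff.rfl) h1 h2)
        exact fun x y h => ⟨hQP x h.1, hQP y h.2.1, h.2.2⟩
    have hcase : ∀ p, P p → Q p ∨
        (b ∈ en.2.1 :: en.2.2 ∧ en.1.1 = p.1 ∧ p.2 = shareSet c y en b) := fun p h => by
      obtain ⟨f, hf, h⟩ := (hP p).1 h
      rcases List.mem_cons.1 hf with rfl | hf
      · exact .inr h
      · exact .inl ⟨f, hf, h⟩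
    have hlt : ∀ f ∈ en :: done, ∀ x ∈ f.2.1 :: f.2.2, x < c :=
      fun f hf x hx => (Valid.lt hv hf hx).trans_le hkc
    -- The share in the new edge is adjacent to a share in an earlier edge, if there is one.
    have hnew : ∀ p q, P p → (b ∈ en.2.1 :: en.2.2 ∧ en.1.1 = p.1 ∧ p.2 = shareSet c y en b) →
        Q q → ∃ r, Q r ∧ I.AdjacentPieces p r := by
      rintro p q hpp ⟨hb, hpe, hps⟩ ⟨f, hf, hbf, -⟩
      have hused : used done b = true := used_iff.2 ⟨f, hf, hbf⟩
      obtain ⟨-, h1, h2⟩ := admissible_iff.1 hv.2.2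
      have hb1 : en.2.1 = b := by
        rcases List.mem_cons.1 hb with h | h
        · exact h.symm
        · rw [h1 b h] at hused; cases hused
      obtain ⟨g, hg, hgt⟩ := touches_iff.1 (h2 (hb1 ▸ hused))
      have hg' : g ∈ en :: done := List.mem_cons_of_mem _ hg
      obtain ⟨eg, heg, hgarc⟩ := ha g hg'
      obtain ⟨ee, hee, henarc⟩ := ha en (by simp)
      obtain ⟨v, hv'⟩ : ∃ v : Fin I.vertices, en.1.2.1 = v := by
        rcases henarc with h | h
        · exact ⟨_, h.1⟩
        · exact ⟨_, h.1⟩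
      have hpv : I.ContainsVertex p v := by
        have := containsVertex_first (I := I) (e := p.1) (v := v) hp.1 hv.2.1
          (hlt en (by simp)) (hp.2 en (by simp)) (ha en (by simp)) hpe hv'
        rw [hb1, ← hps] at this
        exact this
      have hne : p.1 ≠ eg := fun h => hnd.1 (List.mem_map.2 ⟨g, hg, by rw [heg, hpe, h]⟩)
      refine ⟨(eg, shareSet c y g b), ⟨g, hg, ?_, heg, rfl⟩, hne, v, hpv, ?_⟩
      · rcases hgt with h | h
        · rw [← hb1, ← h.2]; exact Label.last_mem _
        · rw [← hb1, ← h.2]; exact List.mem_cons_self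
      · rcases hgt with h | h
        · have := containsVertex_last (I := I) (e := eg) (v := v) hp.1 (Valid.nodup hv hg')
            (hlt g hg') (hp.2 g hg') (ha g hg') heg (h.1.trans hv')
          rwa [h.2, hb1] at this
        · have := containsVertex_first (I := I) (e := eg) (v := v) hp.1 (Valid.nodup hv hg')
            (hlt g hg') (hp.2 g hg') (ha g hg') heg (h.1.trans hv')
          rwa [h.2, hb1] at this
    rcases hcase p hpp with h1 | h1 <;> rcases hcase q hpq with h2 | h2
    · exact ih' h1 h2
    · obtain ⟨r, hr, hadj⟩ := hnew q p hpq h2 h1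
      exact (ih' h1 hr).tail ⟨hQP r hr, hpq, (adjacentPieces_comm _ _).1 hadj⟩
    · obtain ⟨r, hr, hadj⟩ := hnew p q hpp h1 h2
      exact .head ⟨hpp, hQP r hr, hadj⟩ (ih' hr h2)
    · have : p = q := Prod.ext (Fin.ext (h1.2.1.symm.trans h2.2.1)) (h1.2.2.trans h2.2.2.symm)
      rw [this]

end Instance

theorem positive_of_sat {c k : ℕ} {W : List (List ℤ)} {cfg : List Entry} {y : ℕ → ℝ} (hkc : k ≤ c)
    (hv : Valid k cfg) (h : ∀ q ∈ system c W cfg, Sat (c + 1) q y) : Positive c y cfg := by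
  obtain ⟨h0, h1, h2, -⟩ := sat_system_iff.1 h
  refine ⟨h0, fun en hen x hx => ?_⟩
  rcases List.mem_cons.1 hx with rfl | hx'
  · exact h2 en hen
  · have hxc := (hv.lt hen hx).trans_le hkc
    rw [shareLen_rest (hv.nodup hen) hx' hxc]
    exact (h1 x hxc).1

namespace Instance
variable {I : Instance}

/-- The list has exactly one entry for every edge. -/
def Covers (I : Instance) (cfg : List Entry) : Prop :=
  (∀ en ∈ cfg, I.IsArc en.1) ∧ (∀ e : Fin I.edges, ∃ en ∈ cfg, en.1.1 = e) ∧
    (cfg.map fun en => en.1.1).Nodup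

theorem Covers.exists_entry {cfg : List Entry} (h : I.Covers cfg) :
    ∃ ent : Fin I.edges → Entry, (∀ e, ent e ∈ cfg ∧ (ent e).1.1 = e) ∧
      (∀ en ∈ cfg, ∀ e : Fin I.edges, en.1.1 = e → en = ent e) ∧
      ∀ F : Entry → ℝ, (cfg.map F).sum = ∑ e, F (ent e) := by
  classical
  obtain ⟨h1, h2, h3⟩ := h
  choose ent hent hent' using h2
  have huniq : ∀ en ∈ cfg, ∀ e : Fin I.edges, en.1.1 = e → en = ent e := fun en hen e he =>
    List.inj_on_of_nodup_map h3 hen (hent e) (he.trans (hent' e).symm)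
  refine ⟨ent, fun e => ⟨hent e, hent' e⟩, huniq, fun F => ?_⟩
  rw [← List.sum_toFinset _ h3.of_map]
  symm
  refine Finset.sum_bij (fun e _ => ent e) (fun e _ => List.mem_toFinset.2 (hent e))
    (fun e _ f _ hef => ?_) (fun en hen => ?_) fun e _ => rfl
  · exact Fin.ext (by rw [← hent' e, ← hent' f, hef])
  · obtain ⟨e, he, -⟩ := h1 en (List.mem_toFinset.1 hen)
    exact ⟨e, Finset.mem_univ _, (huniq en (List.mem_toFinset.1 hen) e he).symm⟩

/-- The assignment given by the shares in a labelled tree. -/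
def IsShareAssignment (c : ℕ) (y : ℕ → ℝ) (cfg : List Entry)
    (π : Fin I.agents → Finset I.EdgePiece) : Prop :=
  ∀ a p, p ∈ π a ↔ ∃ en ∈ cfg, (a : ℕ) ∈ en.2.1 :: en.2.2 ∧ en.1.1 = p.1 ∧ p.2 = shareSet c y en a

theorem pieceUtility_eq {c : ℕ} {y : ℕ → ℝ} {cfg : List Entry}
    {π : Fin I.agents → Finset I.EdgePiece} (hπ : IsShareAssignment c y cfg π)
    (hp : Positive c y cfg) {ent : Fin I.edges → Entry}
    (hent : ∀ e, ent e ∈ cfg ∧ (ent e).1.1 = e)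
    (huniq : ∀ en ∈ cfg, ∀ e : Fin I.edges, en.1.1 = e → en = ent e) (a b : Fin I.agents) :
    I.pieceUtility a (π b) = ∑ e, shareLen c y (ent e).2 b / y 0 * I.utility a e := by
  classical
  have h1 : π b = (Finset.univ.filter fun e => (b : ℕ) ∈ (ent e).2.1 :: (ent e).2.2).image
      fun e => (e, shareSet c y (ent e) b) := by
    ext p
    rw [hπ, Finset.mem_image]
    constructor
    · rintro ⟨en, hen, hb, he, hs⟩
      rw [huniq en hen p.1 he] at hb hs
      exact ⟨p.1, by simpa using hb, by rw [← hs]⟩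
    · rintro ⟨e, he, rfl⟩
      exact ⟨ent e, (hent e).1, (Finset.mem_filter.1 he).2, (hent e).2, rfl⟩
  rw [pieceUtility, h1, Finset.sum_image fun e _ f _ h => congrArg Prod.fst h, Finset.sum_filter]
  refine Finset.sum_congr rfl fun e _ => ?_
  split_ifs with h
  · rw [shareSet, volume_slot (div_pos (hp.2 _ (hent e).1 _ h) hp.1).le]
  · rw [shareLen_of_notMem h, zero_div, zero_mul]

/-- A solution of the system of inequalities of a labelled tree gives an envy-free assignment. The
pieces of different agents are different since they are disjoint and not empty; the latter needs
that every agent values some edge. -/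
theorem isEnvyFree_of_sat {c : ℕ} {y : ℕ → ℝ} {cfg : List Entry}
    {π : Fin I.agents → Finset I.EdgePiece} (hkc : I.agents ≤ c)
    (hpos : ∀ a, 0 < ∑ e, I.utility a e) (hv : Valid I.agents cfg) (hcov : I.Covers cfg)
    (hsat : ∀ q ∈ system c (I.utilityList.map scaleRow) cfg, Sat (c + 1) q y)
    (hπ : IsShareAssignment c y cfg π) : I.IsEnvyFree π := by
  have hp := positive_of_sat hkc hv hsat
  obtain ⟨ent, hent, huniq, hsum⟩ := hcov.exists_entry
  have hlt : ∀ e, ∀ x ∈ (ent e).2.1 :: (ent e).2.2, x < c :=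
    fun e x hx => (hv.lt (hent e).1 hx).trans_le hkc
  have hf : ∀ e, ∀ x ∈ along (ent e), 0 < shareLen c y (ent e).2 x / y 0 :=
    fun e x hx => div_pos (hp.2 _ (hent e).1 x (mem_along.1 hx)) hp.1
  have hone : ∀ e, ((along (ent e)).map fun x => shareLen c y (ent e).2 x / y 0).sum = 1 :=
    fun e => sum_along hp.1 (hv.nodup (hent e).1) (hlt e)
  have hmem : ∀ (b : Fin I.agents) (e : Fin I.edges) (J : Set ℝ), (e, J) ∈ π b →
      (b : ℕ) ∈ along (ent e) ∧ J = shareSet c y (ent e) b := fun b e J h => by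
    obtain ⟨en, hen, h1, h2, h3⟩ := (hπ b (e, J)).1 h
    rw [huniq en hen e h2] at h1 h3
    exact ⟨mem_along.2 h1, h3⟩
  have hut := pieceUtility_eq hπ hp hent huniq
  have henvy : ∀ a b, I.pieceUtility a (π b) ≤ I.pieceUtility a (π a) := fun a b => by
    obtain ⟨s, hs, hW⟩ := I.exists_scale a
    have := (sat_system_iff.1 hsat).2.2.2 a b (by simp [utilityList]) (b.2.trans_le hkc)
    rw [hsum] at this
    have e1 : ∑ e, (((I.utilityList.map scaleRow).getD a []).getD (ent e).1.1 0 : ℝ) *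
        (shareLen c y (ent e).2 a - shareLen c y (ent e).2 b) =
        (I.pieceUtility a (π a) - I.pieceUtility a (π b)) * (s * y 0) := by
      rw [hut, hut, ← Finset.sum_sub_distrib, Finset.sum_mul]
      refine Finset.sum_congr rfl fun e _ => ?_
      rw [(hent e).2, hW]
      have := hp.1.ne'
      field_simp
    rw [e1] at this
    exact sub_nonneg.1 (nonneg_of_mul_nonneg_left this (mul_pos hs hp.1))
  have hne : ∀ a, (π a).Nonempty := fun a => by
    -- Otherwise the agent would envy the first owner of an edge that it values.
    by_contra hempty
    rw [Finset.not_nonempty_iff_eq_empty] at hempty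
    obtain ⟨e, -, he⟩ := Finset.exists_lt_of_sum_lt (s := Finset.univ) (f := fun _ => (0 : ℚ))
      (g := I.utility a) (by simpa using hpos a)
    have hb := hv.lt (hent e).1 (x := (ent e).2.1) (by simp)
    have h1 := henvy a ⟨_, hb⟩
    have h2 : I.pieceUtility a (π a) = 0 := by rw [hempty]; simp [pieceUtility]
    rw [h2, hut] at h1
    have h3 : 0 < ∑ f, shareLen c y (ent f).2 (ent e).2.1 / y 0 * (I.utility a f : ℝ) := by
      refine Finset.sum_pos' (fun f _ => ?_) ⟨e, Finset.mem_univ _, ?_⟩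
      · refine mul_nonneg (div_nonneg ?_ hp.1.le) (by exact_mod_cast I.utility_nonneg a f)
        by_cases h : (ent e).2.1 ∈ (ent f).2.1 :: (ent f).2.2
        · exact (hp.2 _ (hent f).1 _ h).le
        · rw [shareLen_of_notMem h]
      · exact mul_pos (div_pos (hp.2 _ (hent e).1 _ (by simp)) hp.1) (by exact_mod_cast he)
    exact absurd h3 h1.not_gt
  refine ⟨⟨?_, fun e α hα => ?_⟩, fun a b hab => ?_, henvy⟩
  · rintro _ ⟨a, rfl⟩
    refine ⟨fun p hpa => ?_, fun p hpa q hqa => ?_⟩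
    · obtain ⟨h1, h2⟩ := hmem a p.1 p.2 hpa
      rw [h2]
      refine ⟨?_, ordConnected_slot _ _ _⟩
      have := slot_subset (hf p.1) h1
      rwa [hone] at this
    · exact connected_shares hkc hv hp hcov.1 hcov.2.2 a (fun p => p ∈ π a) (hπ a) hpa hqa
  · obtain ⟨b, hb, hαb⟩ := exists_mem_slot (f := fun x => shareLen c y (ent e).2 x / y 0)
      (nodup_along (hv.nodup (hent e).1)) (along_ne_nil _) hα.1 (by rw [hone]; exact hα.2)
    have hbk := hv.lt (hent e).1 (mem_along.1 hb)
    refine ⟨(π ⟨b, hbk⟩, shareSet c y (ent e) b), ⟨⟨_, rfl⟩, ?_, hαb⟩, ?_⟩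
    · exact (hπ _ _).2 ⟨ent e, (hent e).1, mem_along.1 hb, (hent e).2, rfl⟩
    · rintro ⟨P, J⟩ ⟨⟨a, rfl⟩, h1, h2⟩
      obtain ⟨h3, rfl⟩ := hmem a e J h1
      have : (a : ℕ) = b := eq_of_mem_slot (hf e) h3 hb h2 hαb
      subst this
      rfl
  · obtain ⟨p, hpa⟩ := hne a
    have hpb : p ∈ π b := hab ▸ hpa
    obtain ⟨h1, h2⟩ := hmem a p.1 p.2 hpa
    obtain ⟨h3, h4⟩ := hmem b p.1 p.2 hpb
    obtain ⟨x, hx⟩ : (shareSet c y (ent p.1) a).Nonempty :=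
      ⟨_, le_rfl, .inl (by have := hf _ _ h1; linarith)⟩
    have hx' : x ∈ shareSet c y (ent p.1) b := by rw [← h4, h2]; exact hx
    exact Fin.ext (eq_of_mem_slot (hf p.1) h1 h3 hx hx')

/-! ### The output of the algorithm -/

/-- The interval that the algorithm puts out for a share. -/
def shareInterval (c : ℕ) (y : List ℤ) (h : 0 < y.getD 0 0) (en : Entry) (b : ℕ) : RatInterval where
  lo := ⟨startOf c y en b, (y.getD 0 0).toNat, by omega⟩
  hi := ⟨stopOf c y en b, (y.getD 0 0).toNat, by omega⟩
  loClosed := true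
  hiClosed := decide (stopOf c y en b = y.getD 0 0)

theorem startOf_cast (c : ℕ) (y : List ℤ) (en : Entry) (b : ℕ) :
    (startOf c y en b : ℝ) / toReal y 0 =
      startIn (fun x => shareLen c (toReal y) en.2 x / toReal y 0) (along en) b := by
  rw [startOf, startIn, Int.cast_list_sum, List.map_map, div_eq_mul_inv, ← List.sum_map_mul_right]
  congr 1
  refine List.map_congr_left fun x _ => ?_
  rw [Function.comp_apply, intForm_cast, shareLen, div_eq_mul_inv]

theorem toSet_shareInterval {c : ℕ} {y : List ℤ} (h : 0 < y.getD 0 0) {en : Entry} {b : ℕ}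
    (hn : en.2.Nodup) (hc : ∀ x ∈ en.2.1 :: en.2.2, x < c) :
    (shareInterval c y h en b).toSet = shareSet c (toReal y) en b := by
  have h0 : 0 < toReal y 0 := by simpa [toReal] using h
  have hD : (((y.getD 0 0).toNat : ℚ) : ℝ) = toReal y 0 := by
    rw [toReal]
    exact_mod_cast Int.toNat_of_nonneg h.le
  have hlo : ((shareInterval c y h en b).lo.value : ℝ) =
      startIn (fun x => shareLen c (toReal y) en.2 x / toReal y 0) (along en) b := by
    rw [← startOf_cast, Fraction.value, Rat.cast_div, ← hD]
    rfl
  have hend : (stopOf c y en b : ℝ) / toReal y 0 =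
      startIn (fun x => shareLen c (toReal y) en.2 x / toReal y 0) (along en) b +
        shareLen c (toReal y) en.2 b / toReal y 0 := by
    rw [← startOf_cast, stopOf, Int.cast_add, add_div, intForm_cast, shareLen]
  have hhi : ((shareInterval c y h en b).hi.value : ℝ) =
      startIn (fun x => shareLen c (toReal y) en.2 x / toReal y 0) (along en) b +
        shareLen c (toReal y) en.2 b / toReal y 0 := by
    rw [← hend, Fraction.value, Rat.cast_div, ← hD]
    rfl
  have hclosed : (shareInterval c y h en b).hiClosed = true ↔
      startIn (fun x => shareLen c (toReal y) en.2 x / toReal y 0) (along en) b +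
        shareLen c (toReal y) en.2 b / toReal y 0 = 1 := by
    rw [← hend, div_eq_one_iff_eq h0.ne', toReal]
    simp [shareInterval]
  ext x
  simp only [RatInterval.toSet, shareSet, slot, Set.mem_ofPred_eq, hlo, hhi, hclosed,
    sum_along h0 hn hc]
  refine and_congr_left fun _ => ?_
  rw [le_iff_lt_or_eq, eq_comm (a := x)]
  simp [shareInterval]

/-- The assignment that the algorithm puts out. -/
def describe (I : Instance) (c : ℕ) (y : List ℤ) (h : 0 < y.getD 0 0) (cfg : List Entry)
    (hcfg : ∀ en ∈ cfg, en.1.1 < I.edges) : I.Description := fun a =>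
  (cfg.filter fun en => en.2.has a).pmap
    (fun en he => ((⟨en.1.1, he⟩ : Fin I.edges), shareInterval c y h en a))
    fun en hen => hcfg en (List.mem_of_mem_filter hen)

theorem encode_describe (c : ℕ) (y : List ℤ) (h : 0 < y.getD 0 0) (cfg : List Entry)
    (hcfg : ∀ en ∈ cfg, en.1.1 < I.edges) :
    (I.describe c y h cfg hcfg).encode = enc (output c (I.utilityList.map scaleRow) cfg y) := by
  have h1 : output c (I.utilityList.map scaleRow) cfg y = List.ofFn fun a : Fin I.agents =>
      (cfg.filter fun en => en.2.has a).map fun en => share c y en a := by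
    refine List.ext_getElem (by simp [output, utilityList]) fun i h1 h2 => ?_
    simp [output]
  have h2 : ((y.getD 0 0).toNat : ℤ) = y.getD 0 0 := Int.toNat_of_nonneg h.le
  rw [h1, Description.encode]
  simp only [enc, List.map_ofFn, Function.comp_def]
  congr 1
  congr 1
  funext a
  congr 1
  rw [describe, List.map_pmap, List.map_map, ← List.pmap_eq_map (p := fun en => en.1.1 < I.edges)
    (H := fun en hen => hcfg en (List.mem_of_mem_filter hen))]
  refine List.pmap_congr_left _ fun en _ _ _ => ?_
  simp only [RatInterval.encode, Fraction.encode, shareInterval, Function.comp_apply, share, h2]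

theorem isShareAssignment_describe {c : ℕ} {y : List ℤ} {h : 0 < y.getD 0 0} {cfg : List Entry}
    {hcfg : ∀ en ∈ cfg, en.1.1 < I.edges} (hkc : I.agents ≤ c) (hv : Valid I.agents cfg) :
    IsShareAssignment c (toReal y) cfg (I.describe c y h cfg hcfg).toAssignment := by
  intro a p
  have hset : ∀ en ∈ cfg, (shareInterval c y h en a).toSet = shareSet c (toReal y) en a :=
    fun en hen => toSet_shareInterval h (hv.nodup hen) fun x hx => (hv.lt hen hx).trans_le hkc
  simp only [Description.toAssignment, describe, List.mem_toFinset, List.mem_map, List.mem_pmap,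
    List.mem_filter, Label.has_iff]
  constructor
  · rintro ⟨q, ⟨en, ⟨hen, ha⟩, rfl⟩, rfl⟩
    exact ⟨en, hen, ha, rfl, hset en hen⟩
  · rintro ⟨en, hen, ha, h1, h2⟩
    exact ⟨_, ⟨en, ⟨hen, ha⟩, rfl⟩, Prod.ext (Fin.ext h1) (by rw [h2]; exact hset en hen)⟩

end Instance

open MeasureTheory

/-! ### From an envy-free assignment to a labelled tree -/

namespace Instance
variable {I : Instance}

/-- Any two edge pieces with the given property are joined by a sequence of such pieces. -/
def Joined (X : I.EdgePiece → Prop) : Prop :=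
  ∀ p q, X p → X q → Relation.ReflTransGen (fun x y => X x ∧ X y ∧ I.AdjacentPieces x y) p q

/-- Connectedness survives the removal of edge pieces each of which meets the remaining ones in at
most one vertex: a path through such a piece can be cut short at that vertex. -/
theorem Joined.of_gate {X Y : I.EdgePiece → Prop} (hX : Joined X)
    (hsame : ∀ p q, Y p → Y q → p.1 = q.1 → ∀ v, I.ContainsVertex p v → I.ContainsVertex q v →
      p = q)
    (hgate : ∀ q, X q → ¬ Y q → ∃ v, ∀ r, X r → q.1 ≠ r.1 → ∀ u, I.ContainsVertex q u →
      I.ContainsVertex r u → u = v) (hYX : ∀ p, Y p → X p) : Joined Y := by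
  intro p q hp hq
  let R := Relation.ReflTransGen fun x y => Y x ∧ Y y ∧ I.AdjacentPieces x y
  -- While the path visits a removed piece `r`, the remaining piece `s` that was visited last and
  -- the vertex `u` where the path left it are kept; `r` meets other pieces in `u` only.
  have key : ∀ r, Relation.ReflTransGen (fun x y => X x ∧ X y ∧ I.AdjacentPieces x y) p r →
      (Y r → R p r) ∧ (¬ Y r → ∃ s u, Y s ∧ R p s ∧ I.ContainsVertex s u ∧
        ∀ r', X r' → r.1 ≠ r'.1 → ∀ w, I.ContainsVertex r w → I.ContainsVertex r' w → w = u) := by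
    intro r hr
    induction hr with
    | refl => exact ⟨fun _ => .refl, fun h => absurd hp h⟩
    | @tail r r' _ hstep ih =>
      obtain ⟨hr, hr', hadj⟩ := hstep
      obtain ⟨hne, w, hw, hw'⟩ := hadj
      by_cases hYr : Y r
      · refine ⟨fun h => (ih.1 hYr).tail ⟨hYr, h, hne, w, hw, hw'⟩, fun h => ?_⟩
        obtain ⟨v, hv⟩ := hgate r' hr' h
        exact ⟨r, w, hYr, ih.1 hYr, hw, hv r hr hne.symm w hw' hw ▸ hv⟩
      · obtain ⟨s, u, hs, hps, hsu, hu⟩ := ih.2 hYr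
        have hwu := hu r' hr' hne w hw hw'
        subst hwu
        refine ⟨fun h => ?_, fun h => ?_⟩
        · by_cases he : s.1 = r'.1
          · exact hsame s r' hs h he w hsu hw' ▸ hps
          · exact hps.tail ⟨hs, h, he, w, hsu, hw'⟩
        · obtain ⟨v, hv⟩ := hgate r' hr' h
          exact ⟨s, w, hs, hps, hsu, hv r hr hne.symm w hw' hw ▸ hv⟩
  exact (key q (hX p q (hYX p hp) (hYX q hq))).1 hq

/-- An edge piece of positive length that belongs to the given agent. -/
def Owns (π : Fin I.agents → Finset I.EdgePiece) (a : Fin I.agents) (p : I.EdgePiece) : Prop :=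
  p ∈ π a ∧ 0 < volume.real p.2

/-- The total length of the parts of an edge that belong to the given agent. -/
noncomputable def ownedLength (π : Fin I.agents → Finset I.EdgePiece) (a : Fin I.agents)
    (e : Fin I.edges) : ℝ := ∑ p ∈ (π a).filter fun p => p.1 = e, volume.real p.2

section
variable {π : Fin I.agents → Finset I.EdgePiece}

theorem eq_of_mem_of_mem (h : I.IsEnvyFree π) {a b : Fin I.agents} {p q : I.EdgePiece}
    (hp : p ∈ π a) (hq : q ∈ π b) (hpq : p.1 = q.1) {α : ℝ} (hα : α ∈ Set.Icc (0 : ℝ) 1)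
    (hαp : α ∈ p.2) (hαq : α ∈ q.2) : a = b ∧ p = q := by
  have := (h.1.2 p.1 α hα).unique (y₁ := (π a, p.2)) (y₂ := (π b, q.2)) ⟨⟨a, rfl⟩, hp, hαp⟩
    ⟨⟨b, rfl⟩, by rw [hpq]; exact hq, hαq⟩
  exact ⟨h.2.1 (congrArg Prod.fst this), Prod.ext hpq (congrArg (fun x => x.2) this)⟩

theorem eq_of_containsVertex (h : I.IsEnvyFree π) {a b : Fin I.agents} {p q : I.EdgePiece}
    (hp : p ∈ π a) (hq : q ∈ π b) (hpq : p.1 = q.1) {v : Fin I.vertices}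
    (hvp : I.ContainsVertex p v) (hvq : I.ContainsVertex q v) : a = b ∧ p = q := by
  have hne := (I.ends_lt p.1).ne
  rcases hvp with ⟨h1, h2⟩ | ⟨h1, h2⟩ <;> rcases hvq with ⟨h3, h4⟩ | ⟨h3, h4⟩
  · exact eq_of_mem_of_mem h hp hq hpq (by simp) h2 h4
  · rw [← hpq] at h3
    exact absurd (h1.trans h3.symm) hne
  · rw [← hpq] at h3
    exact absurd (h3.trans h1.symm) hne
  · exact eq_of_mem_of_mem h hp hq hpq (by simp) h2 h4

theorem subset_Icc (h : I.IsEnvyFree π) {a : Fin I.agents} {p : I.EdgePiece} (hp : p ∈ π a) :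
    p.2 ⊆ Set.Icc 0 1 := ((h.1.1 _ ⟨a, rfl⟩).1 p hp).1

theorem Icc_subset_of_containsVertex (h : I.IsEnvyFree π) {a : Fin I.agents} {p : I.EdgePiece}
    (hp : p ∈ π a) {u v : Fin I.vertices} (hu : I.ContainsVertex p u) (hv : I.ContainsVertex p v)
    (huv : u ≠ v) : Set.Icc 0 1 ⊆ p.2 := by
  have hc := ((h.1.1 _ ⟨a, rfl⟩).1 p hp).2
  rcases hu with ⟨h1, h2⟩ | ⟨h1, h2⟩ <;> rcases hv with ⟨h3, h4⟩ | ⟨h3, h4⟩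
  · exact absurd (h1.symm.trans h3) huv
  · exact hc.out h2 h4
  · exact hc.out h4 h2
  · exact absurd (h1.symm.trans h3) huv

/-- Degenerate edge pieces can be left out. -/
theorem joined_owns (h : I.IsEnvyFree π) (a : Fin I.agents) : Joined (Owns π a) := by
  refine Joined.of_gate (X := fun p => p ∈ π a) (fun p q hp hq => (h.1.1 _ ⟨a, rfl⟩).2 p hp q hq)
    (fun p q hp hq hpq v hv hv' => (eq_of_containsVertex h hp.1 hq.1 hpq hv hv').2)
    (fun q hq hq' => ?_) fun p hp => hp.1
  by_cases hex : ∃ v, I.ContainsVertex q v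
  · obtain ⟨v, hv⟩ := hex
    refine ⟨v, fun r _ _ u hu _ => ?_⟩
    by_contra huv
    -- A piece that contains both ends of an edge is the whole edge.
    refine hq' ⟨hq, ?_⟩
    have hs := Icc_subset_of_containsVertex h hq hu hv huv
    have := measureReal_mono hs (μ := volume)
      (ne_top_of_le_ne_top (by simp) (measure_mono (subset_Icc h hq)))
    have h1 : volume.real (Set.Icc (0 : ℝ) 1) = 1 := by simp [measureReal_def]
    linarith
  · exact ⟨(I.ends q.1).1, fun r _ _ u hu => absurd ⟨u, hu⟩ hex⟩

/-- Edge pieces of positive length that belong to the given agent and lie on one of the given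
arcs. -/
def OwnsIn (π : Fin I.agents → Finset I.EdgePiece) (as : List Arc) (a : Fin I.agents)
    (p : I.EdgePiece) : Prop := Owns π a p ∧ ∃ x ∈ as, x.1 = p.1

theorem containsVertex_ends {p : I.EdgePiece} {v : Fin I.vertices} (hv : I.ContainsVertex p v)
    {x : Arc} (hx : I.IsArc x) (hxp : x.1 = p.1) : x.2.1 = v ∨ x.2.2 = v := by
  obtain ⟨e, he, h⟩ := hx
  have : p.1 = e := Fin.ext (by omega)
  subst this
  rcases hv with ⟨rfl, -⟩ | ⟨rfl, -⟩ <;> omega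

/-- Pieces on the last arc of a grown tree meet the other pieces at the tail of the arc only. -/
theorem eq_tail_of_meet {x : Arc} {as : List Arc} (hg : Grown (x :: as))
    (ha : ∀ z ∈ x :: as, I.IsArc z) {p r : I.EdgePiece} (hp : x.1 = p.1)
    (hr : ∃ z ∈ as, z.1 = r.1) {u : Fin I.vertices} (hu : I.ContainsVertex p u)
    (hu' : I.ContainsVertex r u) : x.2.1 = u := by
  obtain ⟨z, hz, hzr⟩ := hr
  refine (containsVertex_ends hu (ha x (by simp)) hp).resolve_right fun hxu => ?_
  have h1 := containsVertex_ends hu' (ha z (List.mem_cons_of_mem _ hz)) hzr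
  have h2 := hg.1.visited_of_mem hz
  have h3 := hg.2.2
  rcases h1 with h1 | h1 <;> simp_all

theorem mem_of_ne {x : Arc} {as : List Arc} {p r : I.EdgePiece} (hp : x.1 = p.1)
    (hr : ∃ z ∈ x :: as, z.1 = r.1) (hne : p.1 ≠ r.1) : ∃ z ∈ as, z.1 = r.1 := by
  obtain ⟨z, hz, hzr⟩ := hr
  rcases List.mem_cons.1 hz with rfl | hz
  · exact absurd (Fin.ext (hp.symm.trans hzr)) hne
  · exact ⟨z, hz, hzr⟩

/-- In a tree, shares remain connected when they are restricted to a subtree. -/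
theorem joined_ownsIn_of_cons (h : I.IsEnvyFree π) {x : Arc} {as : List Arc} (hg : Grown (x :: as))
    (ha : ∀ z ∈ x :: as, I.IsArc z) {a : Fin I.agents} (hj : Joined (OwnsIn π (x :: as) a)) :
    Joined (OwnsIn π as a) := by
  refine hj.of_gate (fun p q hp hq hpq v hv hv' =>
    (eq_of_containsVertex h hp.1.1 hq.1.1 hpq hv hv').2) (fun q hq hq' => ?_) fun p hp =>
      ⟨hp.1, hp.2.imp fun z hz => ⟨List.mem_cons_of_mem _ hz.1, hz.2⟩⟩
  have hxq : x.1 = q.1 := by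
    obtain ⟨z, hz, hzq⟩ := hq.2
    rcases List.mem_cons.1 hz with rfl | hz
    · exact hzq
    · exact absurd ⟨hq.1, z, hz, hzq⟩ hq'
  obtain ⟨v, hv⟩ : ∃ v : Fin I.vertices, x.2.1 = v := by
    obtain ⟨e, -, h1 | h1⟩ := ha x (by simp)
    · exact ⟨_, h1.1⟩
    · exact ⟨_, h1.1⟩
  exact ⟨v, fun r hr hne u hu hu' =>
    Fin.ext ((eq_tail_of_meet hg ha hxq (mem_of_ne hxq hr.2 hne) hu hu').symm.trans hv)⟩

/-- An agent with a share in the last arc and in an earlier one owns the tail of the last arc and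
the end of an earlier arc there. -/
theorem exists_meet {x : Arc} {as : List Arc} (hg : Grown (x :: as))
    (ha : ∀ z ∈ x :: as, I.IsArc z) {a : Fin I.agents} (hj : Joined (OwnsIn π (x :: as) a))
    {p q : I.EdgePiece} (hp : Owns π a p) (hxp : x.1 = p.1) (hq : OwnsIn π as a q) :
    ∃ r s u, Owns π a r ∧ x.1 = r.1 ∧ OwnsIn π as a s ∧ I.ContainsVertex r u ∧
      I.ContainsVertex s u ∧ x.2.1 = u := by
  have hpath := hj q p ⟨hq.1, hq.2.imp fun z hz => ⟨List.mem_cons_of_mem _ hz.1, hz.2⟩⟩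
    ⟨hp, x, by simp, hxp⟩
  have hqx : q.1 ≠ p.1 := fun hqp => by
    obtain ⟨z, hz, hzq⟩ := hq.2
    have := nodup_of_grown hg ha
    rw [List.map_cons, List.nodup_cons] at this
    exact this.1 (List.mem_map.2 ⟨z, hz, by rw [hzq, hqp, hxp]⟩)
  have key : ∀ t, Relation.ReflTransGen (fun y z => OwnsIn π (x :: as) a y ∧
      OwnsIn π (x :: as) a z ∧ I.AdjacentPieces y z) q t → t.1 ≠ p.1 ∨
      ∃ r s u, Owns π a r ∧ x.1 = r.1 ∧ OwnsIn π as a s ∧ I.ContainsVertex r u ∧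
      I.ContainsVertex s u ∧ x.2.1 = u := by
    intro t ht
    induction ht with
    | refl => exact .inl hqx
    | @tail s r _ hstep ih =>
      rcases ih with ih | ih
      · by_cases hr : r.1 = p.1
        · obtain ⟨hs, hr', hne, u, hu, hu'⟩ := hstep
          have hxr : x.1 = r.1 := by rw [hr, hxp]
          have hs' := mem_of_ne hxr hs.2 hne.symm
          exact .inr ⟨r, s, u, hr'.1, hxr, ⟨hs.1, hs'⟩, hu', hu,
            eq_tail_of_meet hg ha hxr hs' hu' hu⟩
        · exact .inl hr
      · exact .inr ih
  exact (key p hpath).resolve_left fun h => h rfl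

/-- An agent has only one share in the last edge: a path between two such shares would leave one and
enter the other at the tail of the edge, which only one share contains. -/
theorem eq_of_owns (h : I.IsEnvyFree π) {x : Arc} {as : List Arc} (hg : Grown (x :: as))
    (ha : ∀ z ∈ x :: as, I.IsArc z) {a : Fin I.agents} (hj : Joined (OwnsIn π (x :: as) a))
    {p q : I.EdgePiece} (hp : Owns π a p) (hxp : x.1 = p.1) (hq : Owns π a q) (hxq : x.1 = q.1) :
    p = q := by
  have hpX : OwnsIn π (x :: as) a p := ⟨hp, x, by simp, hxp⟩
  have hqX : OwnsIn π (x :: as) a q := ⟨hq, x, by simp, hxq⟩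
  by_contra hpq
  rcases (hj p q hpX hqX).cases_head with h1 | ⟨r, hr, -⟩
  · exact hpq h1
  rcases (hj p q hpX hqX).cases_tail with h1 | ⟨s, -, hs⟩
  · exact hpq h1.symm
  obtain ⟨-, hr, hne, u, hu, hu'⟩ := hr
  obtain ⟨hs, -, hne', w, hw, hw'⟩ := hs
  have h1 := eq_tail_of_meet hg ha hxp (mem_of_ne hxp hr.2 hne) hu hu'
  have h2 := eq_tail_of_meet hg ha hxq (mem_of_ne hxq hs.2 hne'.symm) hw' hw
  have huw : u = w := Fin.ext (h1.symm.trans h2)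
  subst huw
  exact hpq (eq_of_containsVertex h hp.1 hq.1 (Fin.ext (hxp.symm.trans hxq)) hu hw').2

/-! #### Lengths -/

theorem ownedLength_nonneg (a : Fin I.agents) (e : Fin I.edges) : 0 ≤ ownedLength π a e :=
  Finset.sum_nonneg fun _ _ => measureReal_nonneg

theorem ownedLength_pos_iff {a : Fin I.agents} {e : Fin I.edges} :
    0 < ownedLength π a e ↔ ∃ p, Owns π a p ∧ p.1 = e := by
  rw [ownedLength, Finset.sum_pos_iff_of_nonneg fun _ _ => measureReal_nonneg]
  simp only [Finset.mem_filter, Owns]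
  exact exists_congr fun p => by tauto

theorem sum_ownedLength (h : I.IsEnvyFree π) (e : Fin I.edges) : ∑ a, ownedLength π a e = 1 := by
  let S := Finset.univ.sigma fun a => (π a).filter fun p => p.1 = e
  have h1 : ∑ a, ownedLength π a e = ∑ x ∈ S, volume.real x.2.2 := by
    rw [Finset.sum_sigma]
    rfl
  have h2 : ∀ x ∈ S, x.2 ∈ π x.1 ∧ x.2.1 = e := fun x hx =>
    Finset.mem_filter.1 (Finset.mem_sigma.1 hx).2
  have hfin : ∀ x ∈ S, volume x.2.2 ≠ ⊤ := fun x hx =>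
    ne_top_of_le_ne_top (by simp) (measure_mono (subset_Icc h (h2 x hx).1))
  rw [h1, ← measureReal_biUnion_finset (h := hfin)]
  · have : ⋃ x ∈ S, x.2.2 = Set.Icc (0 : ℝ) 1 := by
      refine Set.Subset.antisymm (Set.iUnion₂_subset fun x hx => subset_Icc h (h2 x hx).1) ?_
      intro α hα
      obtain ⟨⟨P, J⟩, ⟨⟨a, rfl⟩, h3, h4⟩, -⟩ := h.1.2 e α hα
      exact Set.mem_iUnion₂.2 ⟨⟨a, (e, J)⟩,
        Finset.mem_sigma.2 ⟨Finset.mem_univ _, Finset.mem_filter.2 ⟨h3, rfl⟩⟩, h4⟩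
    rw [this]
    simp [measureReal_def]
  · intro x hx y hy hxy
    refine Set.disjoint_left.2 fun α hαx hαy => hxy ?_
    obtain ⟨hx1, hx2⟩ := h2 x hx
    obtain ⟨hy1, hy2⟩ := h2 y hy
    obtain ⟨h3, h4⟩ := eq_of_mem_of_mem h hx1 hy1 (hx2.trans hy2.symm) (subset_Icc h hx1 hαx) hαx hαy
    exact Sigma.ext h3 (heq_of_eq h4)
  · exact fun x hx => ((h.1.1 _ ⟨x.1, rfl⟩).1 x.2 (h2 x hx).1).2.measurableSet

theorem pieceUtility_eq_ownedLength (a b : Fin I.agents) :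
    I.pieceUtility a (π b) = ∑ e, ownedLength π b e * I.utility a e := by
  rw [pieceUtility, ← Finset.sum_fiberwise_of_maps_to (s := π b) (t := Finset.univ)
    (g := fun p => p.1) fun _ _ => Finset.mem_univ _]
  refine Finset.sum_congr rfl fun e _ => ?_
  rw [ownedLength, Finset.sum_mul]
  exact Finset.sum_congr rfl fun p hp => by rw [(Finset.mem_filter.1 hp).2]

/-! #### Labels -/

/-- The agent with number `x` has a share in the edge with number `i`. -/
def HasShare (π : Fin I.agents → Finset I.EdgePiece) (x i : ℕ) : Prop :=
  ∃ (a : Fin I.agents) (p : I.EdgePiece), a = x ∧ p.1 = i ∧ Owns π a p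

/-- The agent with number `x` has a share in the edge with number `i` which contains the vertex with
number `v`. -/
def HasEnd (π : Fin I.agents → Finset I.EdgePiece) (x i v : ℕ) : Prop :=
  ∃ (a : Fin I.agents) (p : I.EdgePiece) (u : Fin I.vertices), a = x ∧ p.1 = i ∧ u = v ∧
    Owns π a p ∧ I.ContainsVertex p u

/-- The label of the entry lists the agents with a share in the edge, those that own the ends of the
edge being placed accordingly. -/
def IsLabelled (π : Fin I.agents → Finset I.EdgePiece) (en : Entry) : Prop :=
  (∀ x, x ∈ en.2.1 :: en.2.2 ↔ HasShare π x en.1.1) ∧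
    (∀ x, HasEnd π x en.1.1 en.1.2.1 → en.2.1 = x) ∧ ∀ x, HasEnd π x en.1.1 en.1.2.2 → en.2.last = x

/-- A set `A` of agents can be listed such that given agents come first and last. -/
theorem _root_.EFGC.exists_label {A : Finset ℕ} (hA : A.Nonempty) {F G : ℕ → Prop}
    (hF : ∀ x y, F x → F y → x = y) (hG : ∀ x y, G x → G y → x = y) (hFA : ∀ x, F x → x ∈ A)
    (hGA : ∀ x, G x → x ∈ A) (hFG : ∀ x, F x → G x → A = {x}) :
    ∃ l : Label, l.Nodup ∧ (∀ x, x ∈ l.1 :: l.2 ↔ x ∈ A) ∧ (∀ x, F x → l.1 = x) ∧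
      ∀ x, G x → l.last = x := by
  rcases hA.exists_eq_singleton_or_nontrivial with ⟨z, rfl⟩ | hnt
  · refine ⟨(z, []), by simp [Label.Nodup], by simp, fun x hx => ?_, fun x hx => ?_⟩
    · exact (Finset.mem_singleton.1 (hFA x hx)).symm
    · exact (Finset.mem_singleton.1 (hGA x hx)).symm
  · obtain ⟨f, g, hf, hg, hfg, hfF, hgG⟩ : ∃ f g, f ∈ A ∧ g ∈ A ∧ f ≠ g ∧ (∀ x, F x → f = x) ∧
        ∀ x, G x → g = x := by
      by_cases h1 : ∃ f, F f
      · obtain ⟨f, hf⟩ := h1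
        by_cases h2 : ∃ g, G g
        · obtain ⟨g, hg⟩ := h2
          refine ⟨f, g, hFA f hf, hGA g hg, ?_, fun x => hF f x hf, fun x => hG g x hg⟩
          rintro rfl
          rw [hFG f hf hg] at hnt
          exact absurd hnt (by simp)
        · obtain ⟨g, hg, hgf⟩ := hnt.exists_ne f
          exact ⟨f, g, hFA f hf, hg, hgf.symm, fun x => hF f x hf, fun x hx => absurd ⟨x, hx⟩ h2⟩
      · by_cases h2 : ∃ g, G g
        · obtain ⟨g, hg⟩ := h2
          obtain ⟨f, hf, hfg⟩ := hnt.exists_ne g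
          exact ⟨f, g, hf, hGA g hg, hfg, fun x hx => absurd ⟨x, hx⟩ h1, fun x => hG g x hg⟩
        · obtain ⟨f, hf, g, hg, hfg⟩ := hnt
          exact ⟨f, g, hf, hg, hfg, fun x hx => absurd ⟨x, hx⟩ h1, fun x hx => absurd ⟨x, hx⟩ h2⟩
    refine ⟨(f, ((A.erase f).erase g).toList ++ [g]), ?_, fun x => ?_, hfF, fun x hx => ?_⟩
    · simp only [Label.Nodup, List.nodup_cons, List.mem_append, Finset.mem_toList, Finset.mem_erase,
        List.mem_singleton, List.nodup_append, Finset.nodup_toList]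
      refine ⟨by tauto, trivial, by simp, ?_⟩
      rintro z hz w rfl
      exact hz.1
    · simp only [List.mem_cons, List.mem_append, Finset.mem_toList, Finset.mem_erase,
        List.not_mem_nil, or_false]
      constructor
      · rintro (rfl | ⟨-, -, h⟩ | rfl) <;> assumption
      · intro h
        by_cases h1 : x = f <;> by_cases h2 : x = g <;> tauto
    · rw [Label.last, List.reverse_append]
      simpa using hgG x hx

/-- Every envy-free assignment is described by a labelled tree. The hypothesis on connectedness is
inherited by the subtrees of the induction. -/
theorem exists_labelled (h : I.IsEnvyFree π) {as : List Arc} (hg : Grown as)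
    (ha : ∀ z ∈ as, I.IsArc z) (hj : ∀ a, Joined (OwnsIn π as a)) :
    ∃ cfg : List Entry, cfg.map (fun en => en.1) = as ∧ Valid I.agents cfg ∧
      ∀ en ∈ cfg, IsLabelled π en := by
  classical
  induction as with
  | nil => exact ⟨[], rfl, trivial, by simp⟩
  | cons x as ih =>
    obtain ⟨cfg, hmap, hv, hlab⟩ := ih hg.1 (fun z hz => ha z (List.mem_cons_of_mem _ hz))
      fun a => joined_ownsIn_of_cons h hg ha (hj a)
    obtain ⟨e, he, hends⟩ := ha x (by simp)
    have hlen := sum_ownedLength h e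
    -- The agents with a share in the new edge.
    let A : Finset ℕ := Finset.image (fun a : Fin I.agents => (a : ℕ))
      (Finset.univ.filter fun a => 0 < ownedLength π a e)
    have hmemA : ∀ z, z ∈ A ↔ HasShare π z x.1 := fun z => by
      simp only [A, Finset.mem_image, Finset.mem_filter, Finset.mem_univ, true_and,
        ownedLength_pos_iff, HasShare]
      constructor
      · rintro ⟨a, ⟨p, hp, hpe⟩, rfl⟩
        exact ⟨a, p, rfl, by rw [hpe, he], hp⟩
      · rintro ⟨a, p, rfl, hpe, hp⟩
        exact ⟨a, ⟨p, hp, Fin.ext (hpe.trans he)⟩, rfl⟩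
    have hA : A.Nonempty := by
      obtain ⟨a, -, h1⟩ := Finset.exists_lt_of_sum_lt (s := Finset.univ)
        (f := fun _ : Fin I.agents => (0 : ℝ)) (g := fun a => ownedLength π a e) (by simp [hlen])
      exact ⟨a, Finset.mem_image.2 ⟨a, by simpa using h1, rfl⟩⟩
    have hEnd : ∀ v y z, HasEnd π y x.1 v → HasEnd π z x.1 v → y = z := by
      rintro v _ _ ⟨a, p, u, rfl, hp, rfl, h1, h2⟩ ⟨b, q, w, rfl, hq, hw, h3, h4⟩
      have : w = u := Fin.ext hw
      subst this
      rw [(eq_of_containsVertex h h1.1 h3.1 (Fin.ext (hp.trans hq.symm)) h2 h4).1]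
    have hEndA : ∀ v z, HasEnd π z x.1 v → z ∈ A := by
      rintro v _ ⟨a, p, u, rfl, hp, rfl, h1, h2⟩
      exact (hmemA _).2 ⟨a, p, rfl, hp, h1⟩
    have hends' : x.2.1 ≠ x.2.2 := by
      have := I.ends_lt e
      rw [Fin.lt_def] at this
      omega
    -- An agent that owns both ends has only one share, which is then the whole edge.
    have hboth : ∀ z, HasEnd π z x.1 x.2.1 → HasEnd π z x.1 x.2.2 → A = {z} := by
      rintro _ ⟨a, p, u, rfl, hp, hu, h1, h2⟩ ⟨b, q, w, hba, hq, hw, h3, h4⟩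
      have : b = a := Fin.ext hba
      subst this
      have hpq := eq_of_owns h hg ha (hj b) h1 hp.symm h3 hq.symm
      subst hpq
      have hsub := Icc_subset_of_containsVertex h h1.1 h2 h4 fun huw =>
        hends' (by rw [← hu, ← hw, huw])
      refine Finset.eq_singleton_iff_unique_mem.2 ⟨(hmemA _).2 ⟨b, p, rfl, hp, h1⟩, fun z hz => ?_⟩
      obtain ⟨a, r, rfl, hr, h5⟩ := (hmemA z).1 hz
      obtain ⟨α, hα⟩ : r.2.Nonempty := by
        by_contra hne
        rw [Set.not_nonempty_iff_eq_empty] at hne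
        have := h5.2
        rw [hne] at this
        simp at this
      have hα' := subset_Icc h h5.1 hα
      rw [(eq_of_mem_of_mem h h5.1 h1.1 (Fin.ext (hr.trans hp.symm)) hα' hα (hsub hα')).1]
    obtain ⟨l, hl1, hl2, hl3, hl4⟩ := exists_label hA (F := fun z => HasEnd π z x.1 x.2.1)
      (G := fun z => HasEnd π z x.1 x.2.2) (hEnd _) (hEnd _) (hEndA _) (hEndA _) hboth
    refine ⟨(x, l) :: cfg, by rw [List.map_cons, hmap], ⟨hv, hl1, ?_⟩, ?_⟩
    · -- Agents with shares in earlier edges own the tail of the new arc.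
      have hold : ∀ z ∈ l.1 :: l.2, used cfg z = true → l.1 = z ∧ touches cfg x.2.1 z = true := by
        intro z hz hu
        obtain ⟨en, hen, hzen⟩ := used_iff.1 hu
        obtain ⟨a, p, rfl, hp, h1⟩ := (hmemA z).1 ((hl2 z).1 hz)
        obtain ⟨b, q, hba, hq, h2⟩ := ((hlab en hen).1 _).1 hzen
        have : b = a := Fin.ext hba
        subst this
        have henas : en.1 ∈ as := hmap ▸ List.mem_map_of_mem hen
        obtain ⟨r, s, u, h3, h4, h5, h6, h7, h8⟩ :=
          exists_meet hg ha (hj b) h1 hp.symm ⟨h2, en.1, henas, hq.symm⟩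
        refine ⟨hl3 _ ⟨b, r, u, rfl, h4.symm, h8.symm, h3, h6⟩, touches_iff.2 ?_⟩
        obtain ⟨z, hz, hzs⟩ := h5.2
        obtain ⟨en', hen', rfl⟩ := List.mem_map.1 (hmap ▸ hz)
        refine ⟨en', hen', ?_⟩
        rcases containsVertex_ends h7 (ha _ (List.mem_cons_of_mem _ hz)) hzs with h9 | h9
        · exact .inr ⟨h9.trans h8.symm,
            (hlab en' hen').2.1 _ ⟨b, s, u, rfl, hzs.symm, h9.symm, h5.1, h7⟩⟩
        · exact .inl ⟨h9.trans h8.symm,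
            (hlab en' hen').2.2 _ ⟨b, s, u, rfl, hzs.symm, h9.symm, h5.1, h7⟩⟩
      refine admissible_iff.2 ⟨fun z hz => ?_, fun z hz => ?_, fun hu => (hold _ (by simp) hu).2⟩
      · obtain ⟨a, p, rfl, -⟩ := (hmemA z).1 ((hl2 z).1 hz)
        exact a.2
      · by_contra hu
        have := (hold z (List.mem_cons_of_mem _ hz) (by simpa using hu)).1
        exact (List.nodup_cons.1 hl1).1 (this ▸ hz)
    · refine List.forall_mem_cons.2 ⟨⟨fun z => (hl2 z).trans (hmemA z), hl3, hl4⟩, hlab⟩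

end
end Instance

/-! ### Feasibility of the system of an envy-free assignment -/

/-- Every agent occurs after the first position of a label for at most one edge, since the agents
there are new. So one unknown per agent suffices. -/
theorem Valid.eq_of_mem_rest {k : ℕ} {cfg : List Entry} (h : Valid k cfg) {en en' : Entry}
    (hen : en ∈ cfg) (hen' : en' ∈ cfg) {x : ℕ} (hx : x ∈ en.2.2) (hx' : x ∈ en'.2.2) :
    en = en' := by
  induction cfg with
  | nil => simp at hen
  | cons b done ih =>
    have hnew := (admissible_iff.1 h.2.2).2.1
    have hcontra : ∀ f ∈ done, x ∈ f.2.2 → x ∈ b.2.2 → False := fun f hf hxf hxb => by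
      have h1 := hnew x hxb
      rw [used_iff.2 ⟨f, hf, List.mem_cons_of_mem _ hxf⟩] at h1
      cases h1
    rcases List.mem_cons.1 hen with h1 | h1 <;> rcases List.mem_cons.1 hen' with h2 | h2
    · exact h1.trans h2.symm
    · exact (hcontra _ h2 hx' (h1 ▸ hx)).elim
    · exact (hcontra _ h1 hx (h2 ▸ hx')).elim
    · exact ih h.1 h1 h2

namespace Instance
variable {I : Instance} {π : Fin I.agents → Finset I.EdgePiece}

open Classical in
/-- The length of the parts of an edge that belong to an agent, by their numbers; `0` if there is no
such edge or agent. -/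
noncomputable def lengthAt (π : Fin I.agents → Finset I.EdgePiece) (x i : ℕ) : ℝ :=
  if h : x < I.agents ∧ i < I.edges then ownedLength π ⟨x, h.1⟩ ⟨i, h.2⟩ else 0

/-- The unknowns of the system of inequalities for an envy-free assignment, all edges having
length `1`. The value for an agent that is first wherever it has a share is irrelevant, but it has
to satisfy the bounds. -/
noncomputable def unknowns (π : Fin I.agents → Finset I.EdgePiece) (cfg : List Entry) : ℕ → ℝ
  | 0 => 1
  | i + 1 => (cfg.find? fun en => decide (i ∈ en.2.2)).elim 1 fun en => lengthAt π i en.1.1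

theorem lengthAt_eq (a : Fin I.agents) (e : Fin I.edges) : lengthAt π a e = ownedLength π a e := by
  simp [lengthAt]

theorem lengthAt_pos {x : ℕ} {e : Fin I.edges} (h : HasShare π x e) : 0 < lengthAt π x e := by
  obtain ⟨a, p, rfl, hp, h1⟩ := h
  rw [lengthAt_eq, ownedLength_pos_iff]
  exact ⟨p, h1, Fin.ext hp⟩

theorem lengthAt_eq_zero {x : ℕ} {e : Fin I.edges} (h : ¬ HasShare π x e) :
    lengthAt π x e = 0 := by
  by_cases hx : x < I.agents
  · refine le_antisymm (not_lt.1 fun hlt => h ?_) ?_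
    · rw [show x = ((⟨x, hx⟩ : Fin I.agents) : ℕ) from rfl, lengthAt_eq, ownedLength_pos_iff] at hlt
      obtain ⟨p, hp, hpe⟩ := hlt
      exact ⟨⟨x, hx⟩, p, rfl, by rw [hpe], hp⟩
    · rw [show x = ((⟨x, hx⟩ : Fin I.agents) : ℕ) from rfl, lengthAt_eq]
      exact ownedLength_nonneg _ _
  · exact dif_neg fun h => hx h.1

theorem sum_lengthAt (h : I.IsEnvyFree π) {l : List ℕ} (hl : l.Nodup) (e : Fin I.edges)
    (hmem : ∀ x, x ∈ l ↔ HasShare π x e) : (l.map fun x => lengthAt π x e).sum = 1 := by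
  have hlt : ∀ x ∈ l, x < I.agents := fun x hx => by
    obtain ⟨a, p, rfl, -⟩ := (hmem x).1 hx
    exact a.2
  rw [← List.sum_toFinset _ hl, ← sum_ownedLength h e,
    Finset.sum_subset (s₂ := Finset.range I.agents)
      (fun x hx => Finset.mem_range.2 (hlt x (List.mem_toFinset.1 hx)))
      (fun x _ hx => lengthAt_eq_zero fun hs => hx (List.mem_toFinset.2 ((hmem x).2 hs))),
    Finset.sum_range]
  exact Finset.sum_congr rfl fun a _ => lengthAt_eq a e

theorem unknowns_of_mem {k : ℕ} {cfg : List Entry} (hv : Valid k cfg) {en : Entry} (hen : en ∈ cfg)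
    {x : ℕ} (hx : x ∈ en.2.2) : unknowns π cfg (x + 1) = lengthAt π x en.1.1 := by
  rw [unknowns]
  cases hf : cfg.find? fun en => decide (x ∈ en.2.2) with
  | none => exact absurd hx (by simpa using List.find?_eq_none.1 hf en hen)
  | some f =>
    rw [Option.elim_some, hv.eq_of_mem_rest (List.mem_of_find?_eq_some hf) hen
      (by simpa using List.find?_some hf) hx]

theorem shareLen_unknowns {c : ℕ} (h : I.IsEnvyFree π) (hkc : I.agents ≤ c) {cfg : List Entry}
    (hv : Valid I.agents cfg) {en : Entry} (hen : en ∈ cfg) (hlab : IsLabelled π en)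
    {e : Fin I.edges} (he : en.1.1 = e) (x : ℕ) :
    shareLen c (unknowns π cfg) en.2 x = lengthAt π x e := by
  have hc : ∀ z ∈ en.2.1 :: en.2.2, z < c := fun z hz => (hv.lt hen hz).trans_le hkc
  have hn := hv.nodup hen
  have hmem : ∀ z, z ∈ en.2.1 :: en.2.2 ↔ HasShare π z e := fun z => he ▸ hlab.1 z
  by_cases hx : x ∈ en.2.1 :: en.2.2
  · rcases List.mem_cons.1 hx with rfl | hx'
    · rw [shareLen_first hn fun z hz => hc z (List.mem_cons_of_mem _ hz), unknowns,
        ← sum_lengthAt h hn e hmem, List.map_cons, List.sum_cons]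
      have : (en.2.2.map fun i => unknowns π cfg (i + 1)) =
          en.2.2.map fun i => lengthAt π i e :=
        List.map_congr_left fun i hi => by rw [unknowns_of_mem hv hen hi, he]
      rw [this]
      ring
    · rw [shareLen_rest hn hx' (hc x hx), unknowns_of_mem hv hen hx', he]
  · rw [shareLen_of_notMem hx, lengthAt_eq_zero fun hs => hx ((hmem x).2 hs)]

/-- The lengths in an envy-free assignment solve the system of inequalities. -/
theorem sat_unknowns {c : ℕ} (h : I.IsEnvyFree π) (hkc : I.agents ≤ c) {cfg : List Entry}
    (hv : Valid I.agents cfg) (hlab : ∀ en ∈ cfg, IsLabelled π en) (hcov : I.Covers cfg) :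
    ∀ q ∈ system c (I.utilityList.map scaleRow) cfg, Sat (c + 1) q (unknowns π cfg) := by
  obtain ⟨ent, hent, huniq, hsum⟩ := hcov.exists_entry
  have hedge : ∀ en ∈ cfg, ∃ e : Fin I.edges, en.1.1 = e := fun en hen => by
    obtain ⟨e, he, -⟩ := hcov.1 en hen
    exact ⟨e, he⟩
  have hlen : ∀ e x, shareLen c (unknowns π cfg) (ent e).2 x = lengthAt π x e := fun e x =>
    shareLen_unknowns h hkc hv (hent e).1 (hlab _ (hent e).1) (hent e).2 x
  refine sat_system_iff.2 ⟨one_pos, fun i _ => ?_, fun en hen => ?_, fun a b ha _ => ?_⟩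
  · rw [unknowns, unknowns]
    cases hf : cfg.find? fun en => decide (i ∈ en.2.2) with
    | none => simp
    | some en =>
      have hen := List.mem_of_find?_eq_some hf
      have hi : i ∈ en.2.2 := by simpa using List.find?_some hf
      obtain ⟨e, he⟩ := hedge en hen
      have hs : HasShare π i e := he ▸ ((hlab en hen).1 i).1 (List.mem_cons_of_mem _ hi)
      rw [Option.elim_some, he]
      refine ⟨lengthAt_pos hs, ?_⟩
      obtain ⟨a, -, rfl, -⟩ := hs
      rw [lengthAt_eq, ← sum_ownedLength h e]
      exact Finset.single_le_sum (f := fun a => ownedLength π a e)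
        (fun a _ => ownedLength_nonneg a e) (Finset.mem_univ a)
  · obtain ⟨e, he⟩ := hedge en hen
    rw [shareLen_unknowns h hkc hv hen (hlab en hen) he]
    exact lengthAt_pos (he ▸ ((hlab en hen).1 _).1 List.mem_cons_self)
  · have ha' : a < I.agents := by simpa [utilityList] using ha
    obtain ⟨s, hs, hW⟩ := I.exists_scale ⟨a, ha'⟩
    simp only at hW
    rw [hsum]
    have e1 : ∀ x, (∑ e : Fin I.edges, lengthAt π x e * (I.utility ⟨a, ha'⟩ e : ℝ)) ≤
        I.pieceUtility ⟨a, ha'⟩ (π ⟨a, ha'⟩) := fun x => by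
      by_cases hx : x < I.agents
      · refine le_trans (le_of_eq ?_) (h.2.2 ⟨a, ha'⟩ ⟨x, hx⟩)
        rw [pieceUtility_eq_ownedLength]
        exact Finset.sum_congr rfl fun e _ => by rw [← lengthAt_eq]
      · rw [pieceUtility_eq_ownedLength]
        refine Finset.sum_le_sum fun e _ => ?_
        rw [lengthAt, dif_neg fun h => hx h.1, zero_mul]
        exact mul_nonneg (ownedLength_nonneg _ _) (by exact_mod_cast I.utility_nonneg _ e)
    have e2 : ∑ e, (((I.utilityList.map scaleRow).getD a []).getD (ent e).1.1 0 : ℝ) *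
        (shareLen c (unknowns π cfg) (ent e).2 a - shareLen c (unknowns π cfg) (ent e).2 b) =
        (I.pieceUtility ⟨a, ha'⟩ (π ⟨a, ha'⟩) -
          ∑ e : Fin I.edges, lengthAt π b e * (I.utility ⟨a, ha'⟩ e : ℝ)) * s := by
      rw [pieceUtility_eq_ownedLength, ← Finset.sum_sub_distrib, Finset.sum_mul]
      refine Finset.sum_congr rfl fun e _ => ?_
      rw [(hent e).2, hW, hlen, hlen, ← lengthAt_eq]
      ring
    rw [e2]
    exact mul_nonneg (sub_nonneg.2 (e1 b)) hs.le

end Instance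

/-! ### Few labels deviate from the default -/

/-- The entries whose label is not the default. -/
def deviating (c : ℕ) : List Entry → List Entry
  | [] => []
  | en :: done => if en.2 = (defaultAgent c done en.1.2.1, []) then deviating c done
      else en :: deviating c done

/-- The prescriptions that reproduce a labelled tree. -/
def deviations (c : ℕ) (cfg : List Entry) : List (ℕ × Label) :=
  (deviating c cfg).map fun en => (en.1.1, en.2)

theorem deviating_sublist (c : ℕ) (cfg : List Entry) : (deviating c cfg).Sublist cfg := by
  induction cfg with
  | nil => exact .slnil
  | cons en done ih =>
    rw [deviating]
    split_ifs
    · exact ih.cons _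
    · exact ih.cons_cons _

theorem build_deviations {c k : ℕ} {cfg : List Entry} (hv : Valid k cfg)
    (hn : (cfg.map fun en => en.1.1).Nodup) :
    build c k (deviations c cfg) (cfg.map fun en => en.1) = some cfg := by
  -- The prescriptions for later arcs, which are kept in a list `A`, do not matter.
  have key : ∀ (cfg : List Entry) (A : List (ℕ × Label)), Valid k cfg →
      (cfg.map fun en => en.1.1).Nodup → (∀ p ∈ A, ∀ en ∈ cfg, p.1 ≠ en.1.1) →
      build c k (A ++ deviations c cfg) (cfg.map fun en => en.1) = some cfg := by
    intro cfg
    induction cfg with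
    | nil => intros; rfl
    | cons en done ih =>
      intro A hv hn hA
      rw [List.map_cons, List.nodup_cons] at hn
      have hA' : ∀ p ∈ A, ∀ en ∈ done, p.1 ≠ en.1.1 :=
        fun p hp f hf => hA p hp f (List.mem_cons_of_mem _ hf)
      have hfA : A.find? (fun p => decide (p.1 = en.1.1)) = none :=
        List.find?_eq_none.2 fun p hp => by simpa using hA p hp en (by simp)
      rw [List.map_cons, build_cons]
      by_cases hd : en.2 = (defaultAgent c done en.1.2.1, [])
      · have e1 : deviations c (en :: done) = deviations c done := by
          rw [deviations, deviating, if_pos hd, ← deviations]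
        rw [e1, ih A hv.1 hn.2 hA', Option.elim_some, addArc]
        have e2 : chooseLabel c (A ++ deviations c done) done en.1 = en.2 := by
          have : (deviations c done).find? (fun p => decide (p.1 = en.1.1)) = none := by
            refine List.find?_eq_none.2 fun p hp => ?_
            obtain ⟨f, hf, rfl⟩ := List.mem_map.1 hp
            have hf' := (deviating_sublist c done).subset hf
            simpa using fun h : f.1.1 = en.1.1 => hn.1 (List.mem_map.2 ⟨f, hf', h⟩)
          rw [chooseLabel, List.find?_append, hfA, this, hd]
          rfl
        rw [e2, hv.2.2]
        rfl
      · have e1 : deviations c (en :: done) = (en.1.1, en.2) :: deviations c done := by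
          rw [deviations, deviating, if_neg hd, List.map_cons, ← deviations]
        have e3 := ih (A ++ [(en.1.1, en.2)]) hv.1 hn.2 fun p hp f hf => by
          rcases List.mem_append.1 hp with hp | hp
          · exact hA' p hp f hf
          · rw [List.mem_singleton.1 hp]
            exact fun h => hn.1 (List.mem_map.2 ⟨f, hf, h.symm⟩)
        rw [List.append_assoc, List.singleton_append, ← e1] at e3
        rw [e3, Option.elim_some, addArc]
        have e2 : chooseLabel c (A ++ deviations c (en :: done)) done en.1 = en.2 := by
          rw [chooseLabel, List.find?_append, hfA, e1]
          simp
        rw [e2, hv.2.2]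
        rfl
  exact key cfg [] hv hn (by simp)

/-- The tail of the first arc in which the agent has a share. -/
def firstTail : List Entry → ℕ → Option ℕ
  | [], _ => none
  | en :: done, x => bif used done x then firstTail done x
      else bif en.2.has x then some en.1.2.1 else none

theorem used_of_firstTail {cfg : List Entry} {x v : ℕ} (h : firstTail cfg x = some v) :
    used cfg x = true := by
  cases cfg with
  | nil => cases h
  | cons en done =>
    rw [firstTail] at h
    cases hu : used done x with
    | true =>
      obtain ⟨f, hf, hx⟩ := used_iff.1 hu
      exact used_iff.2 ⟨f, List.mem_cons_of_mem _ hf, hx⟩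
    | false =>
      rw [hu] at h
      cases hx : en.2.has x with
      | true => exact used_iff.2 ⟨en, by simp, Label.has_iff.1 hx⟩
      | false => rw [hx] at h; cases h

theorem firstTail_cons_of_used {en : Entry} {done : List Entry} {x : ℕ} (h : used done x = true) :
    firstTail (en :: done) x = firstTail done x := by
  rw [firstTail, h]
  rfl

theorem firstTail_cons_of_new {en : Entry} {done : List Entry} {x : ℕ} (h : used done x = false)
    (hx : x ∈ en.2.1 :: en.2.2) : firstTail (en :: done) x = some en.1.2.1 := by
  rw [firstTail, h, Label.has_iff.2 hx]
  rfl

theorem used_of_touches {done : List Entry} {v x : ℕ} (h : touches done v x = true) :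
    used done x = true := by
  obtain ⟨en, hen, h | h⟩ := touches_iff.1 h
  · exact used_iff.2 ⟨en, hen, h.2 ▸ Label.last_mem _⟩
  · exact used_iff.2 ⟨en, hen, h.2 ▸ List.mem_cons_self⟩

theorem arrives_or_firstTail {k : ℕ} {done : List Entry} (hv : Valid k done) {v x : ℕ}
    (h : touches done v x = true) : arrives done v x = true ∨ firstTail done x = some v := by
  induction done with
  | nil => simp [touches] at h
  | cons en done ih =>
    have hold : touches done v x = true →
        arrives (en :: done) v x = true ∨ firstTail (en :: done) x = some v := fun h' => by
      rcases ih hv.1 h' with h1 | h1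
      · obtain ⟨f, hf, h2⟩ := arrives_iff.1 h1
        exact .inl (arrives_iff.2 ⟨f, List.mem_cons_of_mem _ hf, h2⟩)
      · exact .inr (by rw [firstTail_cons_of_used (used_of_touches h'), h1])
    obtain ⟨f, hf, h1⟩ := touches_iff.1 h
    rcases List.mem_cons.1 hf with rfl | hf
    · rcases h1 with h1 | ⟨rfl, rfl⟩
      · exact .inl (arrives_iff.2 ⟨f, by simp, h1⟩)
      · cases hu : used done f.2.1 with
        | true => exact hold ((admissible_iff.1 hv.2.2).2.2 hu)
        | false => exact .inr (firstTail_cons_of_new hu (by simp))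
    · exact hold (touches_iff.2 ⟨f, hf, h1⟩)

theorem nodup_heads {as : List Arc} (h : Grown as) : (as.map fun a => a.2.2).Nodup := by
  induction as with
  | nil => simp
  | cons a rest ih =>
    rw [List.map_cons, List.nodup_cons]
    refine ⟨fun hmem => ?_, ih h.1⟩
    obtain ⟨b, hb, hab⟩ := List.mem_map.1 hmem
    have := (h.1.visited_of_mem hb).2
    rw [hab, h.2.2] at this
    cases this

theorem defaultAgent_eq {c : ℕ} {done : List Entry} (hn : (done.map fun en => en.1.2.2).Nodup)
    {v x : ℕ} (hx : x < c) (h : arrives done v x = true) : defaultAgent c done v = x := by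
  have huniq : ∀ z, arrives done v z = true → z = x := fun z hz => by
    obtain ⟨f, hf, h1, h2⟩ := arrives_iff.1 hz
    obtain ⟨g, hg, h3, h4⟩ := arrives_iff.1 h
    rw [← h2, ← h4, List.inj_on_of_nodup_map hn hf hg (h1.trans h3.symm)]
  rw [defaultAgent]
  cases hf : (List.range c).find? fun x => arrives done v x with
  | none => exact absurd h (by simpa using List.find?_eq_none.1 hf x (List.mem_range.2 hx))
  | some z => exact huniq z (by simpa using List.find?_some hf)

/-- The arcs whose label is not the default leave the vertices where new agents are introduced. -/
theorem exists_firstTail_of_deviating {c k : ℕ} (hkc : k ≤ c) {cfg : List Entry} (hv : Valid k cfg)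
    (hg : Grown (cfg.map fun en => en.1)) {en : Entry} (hen : en ∈ deviating c cfg) :
    ∃ x < k, firstTail cfg x = some en.1.2.1 := by
  induction cfg with
  | nil => simp [deviating] at hen
  | cons b done ih =>
    have hold : en ∈ deviating c done → ∃ x < k, firstTail (b :: done) x = some en.1.2.1 :=
      fun h => by
        obtain ⟨x, hx, h1⟩ := ih hv.1 hg.1 h
        exact ⟨x, hx, by rw [firstTail_cons_of_used (used_of_firstTail h1), h1]⟩
    rw [deviating] at hen
    split_ifs at hen with hd
    · exact hold hen
    · rcases List.mem_cons.1 hen with rfl | hen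
      · obtain ⟨h1, h2, h3⟩ := admissible_iff.1 hv.2.2
        rcases ht : en.2.2 with _ | ⟨x, t⟩
        · refine ⟨en.2.1, h1 _ (by simp), ?_⟩
          cases hu : used done en.2.1 with
          | false => exact firstTail_cons_of_new hu (by simp)
          | true =>
            rw [firstTail_cons_of_used hu]
            refine (arrives_or_firstTail hv.1 (h3 hu)).resolve_left fun harr => hd ?_
            have hn : (done.map fun en => en.1.2.2).Nodup := by
              have := nodup_heads hg.1
              rwa [List.map_map] at this
            rw [defaultAgent_eq hn ((h1 _ (by simp)).trans_le hkc) harr, ← ht]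
        · have hx : x ∈ en.2.2 := ht ▸ List.mem_cons_self
          exact ⟨x, h1 x (List.mem_cons_of_mem _ hx),
            firstTail_cons_of_new (h2 x hx) (List.mem_cons_of_mem _ hx)⟩
      · exact hold hen

/-- In a tree of maximum degree at most `d`, at most `d` labels per agent deviate: the arcs are
determined by their heads, and these are neighbours of the tails, where agents are introduced. -/
theorem length_deviations_le {I : Instance} {c d : ℕ} (hd : I.graph.maxDegree ≤ d)
    (hkc : I.agents ≤ c) {cfg : List Entry} (hv : Valid I.agents cfg)
    (hg : Grown (cfg.map fun en => en.1)) (ha : ∀ en ∈ cfg, I.IsArc en.1) :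
    (deviations c cfg).length ≤ c * d := by
  classical
  have hn : (cfg.map fun en => en.1.2.2).Nodup := by
    have := nodup_heads hg
    rwa [List.map_map] at this
  have hsub := deviating_sublist c cfg
  rw [deviations, List.length_map, ← List.toFinset_card_of_nodup (hn.of_map.sublist hsub)]
  -- The tails of the arcs in which an agent has its first share.
  let T : Finset ℕ := (Finset.range I.agents).image fun x => (firstTail cfg x).getD 0
  have hT : T.card ≤ c := Finset.card_image_le.trans (by rwa [Finset.card_range])
  have h1 : (deviating c cfg).toFinset.card ≤ d * T.card := by
    refine Finset.card_le_mul_card_image_of_maps_to (f := fun en => en.1.2.1) (fun en hen => ?_) d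
      fun v _ => ?_
    · obtain ⟨x, hx, h1⟩ := exists_firstTail_of_deviating hkc hv hg (List.mem_toFinset.1 hen)
      exact Finset.mem_image.2 ⟨x, Finset.mem_range.2 hx, by rw [h1]; rfl⟩
    · rcases Finset.eq_empty_or_nonempty
        ((deviating c cfg).toFinset.filter fun en => en.1.2.1 = v) with hem | ⟨en, hen⟩
      · rw [hem]
        simp
      · obtain ⟨u, hu⟩ : ∃ u : Fin I.vertices, v = u := by
          obtain ⟨hmem, htail⟩ := Finset.mem_filter.1 hen
          rw [← htail]
          obtain ⟨e, -, h | h⟩ := ha en (hsub.subset (List.mem_toFinset.1 hmem))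
          · exact ⟨_, h.1⟩
          · exact ⟨_, h.1⟩
        refine le_trans ?_ ((I.graph.degree_le_maxDegree u).trans hd)
        rw [← SimpleGraph.card_neighborFinset_eq_degree, ← Finset.card_map Fin.valEmbedding]
        refine Finset.card_le_card_of_injOn (fun en => en.1.2.2) (fun en hen => ?_)
          fun f hf g hg hfg => ?_
        · obtain ⟨hen, htail⟩ := Finset.mem_filter.1 (Finset.mem_coe.1 hen)
          obtain ⟨e, -, h⟩ := ha en (hsub.subset (List.mem_toFinset.1 hen))
          have hadj : ∀ w : Fin I.vertices, (w : ℕ) = en.1.2.2 → I.graph.Adj u w := fun w hw => by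
            rcases h with ⟨h2, h3⟩ | ⟨h2, h3⟩
            · exact ⟨e, .inl (Prod.ext (Fin.ext (h2.symm.trans (htail.trans hu)))
                (Fin.ext (h3.symm.trans hw.symm)))⟩
            · exact ⟨e, .inr (Prod.ext (Fin.ext (h3.symm.trans hw.symm))
                (Fin.ext (h2.symm.trans (htail.trans hu))))⟩
          refine Finset.mem_coe.2 (Finset.mem_map.2 ?_)
          rcases h with ⟨h2, h3⟩ | ⟨h2, h3⟩
          · exact ⟨_, (SimpleGraph.mem_neighborFinset _ _ _).2 (hadj _ h3.symm), h3.symm⟩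
          · exact ⟨_, (SimpleGraph.mem_neighborFinset _ _ _).2 (hadj _ h3.symm), h3.symm⟩
        · exact List.inj_on_of_nodup_map hn
            (hsub.subset (List.mem_toFinset.1 (Finset.mem_filter.1 (Finset.mem_coe.1 hf)).1))
            (hsub.subset (List.mem_toFinset.1 (Finset.mem_filter.1 (Finset.mem_coe.1 hg)).1)) hfg
  calc _ ≤ d * T.card := h1
    _ ≤ d * c := by gcongr
    _ = c * d := mul_comm _ _

/-! ### Correctness of the algorithm -/

theorem mem_listsUpTo {α : Type} {n : ℕ} {xs l : List α} :
    l ∈ listsUpTo n xs ↔ l.length ≤ n ∧ ∀ x ∈ l, x ∈ xs := by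
  induction n generalizing l with
  | zero =>
    cases l <;> simp [listsUpTo]
  | succ n ih =>
    rw [listsUpTo]
    cases l with
    | nil => simp
    | cons a l => simp [ih, and_left_comm]

theorem mem_labels {c : ℕ} {l : Label} :
    l ∈ labels c ↔ l.Nodup ∧ ∀ x ∈ l.1 :: l.2, x < c := by
  obtain ⟨h, t⟩ := l
  simp only [labels, List.mem_flatMap, List.mem_map, List.mem_filter, mem_listsUpTo, List.mem_range,
    decide_eq_true_eq, Prod.mk.injEq, Label.Nodup, List.forall_mem_cons]
  constructor
  · rintro ⟨h', h1, t', ⟨⟨-, h2⟩, h3⟩, rfl, rfl⟩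
    exact ⟨h3, h1, h2⟩
  · rintro ⟨h1, h2, h3⟩
    refine ⟨h, h2, t, ⟨⟨?_, h3⟩, h1⟩, rfl, rfl⟩
    have h4 := Finset.card_le_card (s := t.toFinset) (t := Finset.range c)
      fun x hx => Finset.mem_range.2 (h3 x (List.mem_toFinset.1 hx))
    rwa [List.toFinset_card_of_nodup (List.nodup_cons.1 h1).2, Finset.card_range] at h4

theorem mem_prescriptions {c n : ℕ} {E : List (ℕ × ℕ)} {ov : List (ℕ × Label)} :
    ov ∈ prescriptions c n E ↔ ov.length ≤ n ∧ ∀ p ∈ ov, p.1 < E.length ∧ p.2 ∈ labels c := by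
  rw [prescriptions, mem_listsUpTo]
  refine and_congr_right fun _ => forall₂_congr fun p _ => ?_
  simp only [List.mem_flatMap, List.mem_map]
  constructor
  · rintro ⟨q, hq, l, hl, rfl⟩
    exact ⟨(List.mem_zipIdx' hq).1, hl⟩
  · rintro ⟨h1, h2⟩
    exact ⟨(E[p.1], p.1), by rw [List.mem_zipIdx_iff_getElem?]; simp [h1], p.2, h2, rfl⟩

namespace Instance
variable {I : Instance}

theorem covers_of_map_eq (hI : I.graph.IsTree) {cfg : List Entry}
    (h : cfg.map (fun en => en.1) = arcs I.edgeList) : I.Covers cfg := by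
  obtain ⟨h1, h2, h3⟩ := arcs_spec hI
  refine ⟨fun en hen => h2 _ (h ▸ List.mem_map_of_mem hen), fun e => ?_, ?_⟩
  · obtain ⟨a, ha, hae⟩ := h3 e
    obtain ⟨en, hen, rfl⟩ := List.mem_map.1 (h ▸ ha)
    exact ⟨en, hen, hae⟩
  · have := nodup_of_grown h1 h2
    rwa [← h, List.map_map] at this

theorem isCorrectAnswer_solveInstance {c d : ℕ} (hpos : ∀ a, 0 < ∑ e, I.utility a e)
    (hkc : I.agents ≤ c) (hI : I.graph.IsTree) (hd : I.graph.maxDegree ≤ d) :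
    I.IsCorrectAnswer (enc (solveInstance c (c * d) (I.vertices, I.edgeList, I.utilityList))) := by
  have hlen : I.utilityList.length = I.agents := List.length_ofFn
  rw [solveInstance]
  simp only [hlen]
  generalize hL : ((prescriptions c (c * d) I.edgeList).flatMap fun ov =>
    (build c I.agents ov (arcs I.edgeList)).elim [] fun cfg =>
      (solve c (system c (I.utilityList.map scaleRow) cfg)).elim [] fun y =>
        [output c (I.utilityList.map scaleRow) cfg y]) = L
  cases hh : L.head? with
  | none =>
    -- The labelled tree of an envy-free assignment would be found.
    refine .inl ⟨rfl, ?_⟩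
    rintro ⟨π, hπ⟩
    have hnil : L = [] := List.head?_eq_none_iff.1 hh
    obtain ⟨h1, h2, h3⟩ := arcs_spec hI
    obtain ⟨cfg, hmap, hv, hlab⟩ := exists_labelled hπ h1 h2 fun a => by
      have : OwnsIn π (arcs I.edgeList) a = Owns π a := funext fun p => propext
        ⟨fun h => h.1, fun h => ⟨h, h3 p.1⟩⟩
      rw [this]
      exact joined_owns hπ a
    have hcov := covers_of_map_eq hI hmap
    obtain ⟨y, hy⟩ := exists_solve_system (sat_unknowns hπ hkc hv hlab hcov)
    have hb := build_deviations (c := c) hv hcov.2.2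
    have hmem : deviations c cfg ∈ prescriptions c (c * d) I.edgeList := by
      refine mem_prescriptions.2 ⟨length_deviations_le hd hkc hv (hmap ▸ h1) hcov.1, fun p hp => ?_⟩
      obtain ⟨en, hen, rfl⟩ := List.mem_map.1 hp
      have hen' := (deviating_sublist c cfg).subset hen
      refine ⟨?_, mem_labels.2 ⟨hv.nodup hen', fun x hx => (hv.lt hen' hx).trans_le hkc⟩⟩
      simpa [edgeList] using (hcov.1 en hen').lt_edges
    have : output c (I.utilityList.map scaleRow) cfg y ∈ L := by
      rw [← hL]
      refine List.mem_flatMap.2 ⟨_, hmem, ?_⟩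
      rw [← hmap, hb, Option.elim_some, hy]
      simp
    rw [hnil] at this
    simp at this
  | some out =>
    refine .inr ?_
    have hout : out ∈ L := List.mem_of_mem_head? hh
    rw [← hL] at hout
    obtain ⟨ov, hov, hout⟩ := List.mem_flatMap.1 hout
    cases hb : build c I.agents ov (arcs I.edgeList) with
    | none => rw [hb] at hout; simp at hout
    | some cfg =>
      rw [hb, Option.elim_some] at hout
      cases hs : solve c (system c (I.utilityList.map scaleRow) cfg) with
      | none => rw [hs] at hout; simp at hout
      | some y =>
        rw [hs, Option.elim_some, List.mem_singleton] at hout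
        subst hout
        obtain ⟨hv, hmap⟩ := valid_of_build
          (fun p hp => (mem_labels.1 ((mem_prescriptions.1 hov).2 p hp).2).1) hb
        have hcov := covers_of_map_eq hI hmap
        have hsat := sat_of_solve hs
        have hy : 0 < y.getD 0 0 := by
          have := (sat_system_iff.1 hsat).1
          rw [toReal] at this
          exact_mod_cast this
        have hcfg : ∀ en ∈ cfg, en.1.1 < I.edges := fun en hen => (hcov.1 en hen).lt_edges
        refine ⟨I.describe c y hy cfg hcfg, ?_, ?_⟩
        · rw [encode_describe]
          rfl
        · exact isEnvyFree_of_sat hkc hpos hv hcov hsat (isShareAssignment_describe hkc hv)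

end Instance

end EFGC

theorem mainTheorem3 (c d : ℕ) :
    EFGC.PolyTimeSolvableOn
      {I : EFGC.Instance |
        (∀ a, 0 < ∑ e, I.utility a e) ∧
        I.agents ≤ c ∧ I.graph.IsTree ∧ I.graph.maxDegree ≤ d} := by
  obtain ⟨p, T, h⟩ := EFGC.PolyTime.solveInstance c (c * d)
  refine ⟨p, T, fun I ⟨hpos, hkc, hI, hd⟩ => ?_⟩
  obtain ⟨t, hrun, ht⟩ := h (I.vertices, I.edgeList, I.utilityList)
  rw [EFGC.len, I.enc_input] at ht
  rw [I.enc_input] at hrun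
  exact ⟨_, t, hrun, ht, EFGC.Instance.isCorrectAnswer_solveInstance hpos hkc hI hd⟩
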